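/- **Conventions.** Let $g\ge 0$, $n\ge 1$. A graph $\Gamma$ is a finite vertex-weighted graph (loops and multiple edges allowed) with $n$ labelled legs; it is stable of genus $g$ if it is connected, $\sum_v w(v)+b_1(\Gamma)=g$ and $2w(v)-2+\deg(v)+L(v)>0$ for every vertex $v$, where $L(v)$ is the number of legs at $v$. Let $v_0$ be the vertex carrying the first leg, $K_\Gamma(v)=2w(v)-2+\deg(v)$ and $\mu=K_\Gamma/2$. A specialization $\Gamma\to\Gamma'$ is an identification of $\Gamma'$ with a contraction of edges of $\Gamma$. For $\mathcal E\subset E(\Gamma)$, let $\Gamma^{\mathcal E}$ be obtained by inserting one (exceptional, weight $0$) vertex in each edge of $\mathcal E$. A pseudo-divisor $(\mathcal E,D)$ on $\Gamma$ consists of $\mathcal E$ and a divisor $D$ on $\Gamma^{\mathcal E}$, of degree $\deg\mu=g-1$ in the stability conditions below, with value $-1$ at exceptional vertices. It is *quasistable* if $\beta_D(W)=\deg D|_W-\mu(W)+\tfrac12\#E(W,W^c)\ge 0$ for all proper $W\subsetneq V(\Gamma^{\mathcal E})$, with strict inequality if $v_0\in W$ (with $\mu$ extended by $0$). It is *polystable*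 if, for all $W\subset V(\Gamma)$, $\deg D|_W-\mu(W)-\tfrac12\deg_{\mathcal E}(W)+\tfrac12\#(E(W,W^c)\setminus\mathcal E)\ge 0$, with strict inequality if $E(W,W^c)\not\subset\mathcal E$; here $\deg_{\mathcal E}(W)=\sum_{v\in W}\deg_{\mathcal E}(v)$. It is a *pseudo-root* if $2D+\mathrm{Div}(\phi)=K_{\Gamma^{\mathcal E}}$ for an acyclic integral flow $\phi$ on $\Gamma^{\mathcal E}$, where $\mathrm{Div}(\phi)=\sum_e\phi(e)\,t(e)$ over oriented edges $e$ with target $t(e)$, and acyclic means that no oriented cycle has $\phi\ge 0$ on all its edges and $\phi\neq 0$ on some; for quasistable and polystable pseudo-roots $\phi=\phi_{(\mathcal E,D)}$ is unique. A specialization of triples $(\Gamma,\mathcal E,D)\ge(\Gamma',\mathcal E',D')$ consists of a specialization $\iota\colon\Gamma\to\Gamma'$ with $\mathcal E'\subset\mathcal E$ (via $E(\Gamma')\subset E(\Gamma)$) and a compatible specialization $\hat\iota\colon\Gamma^{\mathcal E}\to\Gamma'^{\mathcal E'}$ with $\hat\iota_*D=D'$; it is a specialization of root-graphs if moreover $\hat\iota_*\phi_{(\mathcal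 E,D)}=\phi_{(\mathcal E',D')}$. For pseudo-divisors on one graph, $(\mathcal E,D)\ge(\mathcal E',D')$ means that there is such a specialization of triples with $\iota=\mathrm{id}$; $\mathrm{pol}(\mathcal E',D')$ is the minimal polystable pseudo-divisor on $\Gamma$ with $\mathrm{pol}(\mathcal E',D')\ge(\mathcal E',D')$. **Cones.** Let $\lambda_{(\Gamma,\mathcal E,D)}$ be the cone of $x\in\mathbb R_{\ge 0}^{E(\Gamma^{\mathcal E})}$ with $\sum_{e\in\gamma}\phi_{(\mathcal E,D)}(e)x_e=0$ for all oriented cycles $\gamma$ of $\Gamma^{\mathcal E}$, and $\lambda^\circ_{(\Gamma,\mathcal E,D)}$ its subset of points with all $x_e>0$. Let $\mathcal L_{\mathcal E}\subset\mathbb R^{E(\Gamma^{\mathcal E})}$ be spanned by the vectors $u_W$, for $W\subset V(\Gamma)$ with $E(W,W^c)\subset\mathcal E$, where $u_W$ has coordinate $1$ (resp. $-1$) at the edges over $E(W,W^c)$ incident to $W$ (resp. to $W^c$) and $0$ elsewhere. Let $\kappa_{(\Gamma,\mathcal E,D)}$ and $\kappa^\circ_{(\Gamma,\mathcal E,D)}$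 be the images of $\lambda_{(\Gamma,\mathcal E,D)}$ and $\lambda^\circ_{(\Gamma,\mathcal E,D)}$ in $\mathbb R^{E(\Gamma^{\mathcal E})}/\mathcal L_{\mathcal E}$. Specializations of root-graphs induce inclusions of cones (extension by zero at the contracted edges). Let $R^{\rm trop}_{g,n}=\varinjlim\lambda_{(\Gamma,\mathcal E,D)}$ over quasistable root-graphs and $T^{\rm trop}_{g,n}=\varinjlim\kappa_{(\Gamma,\mathcal E,D)}$ over polystable root-graphs, with $\Gamma$ stable of genus $g$ with $n$ legs (colimits of topological spaces over specializations of root-graphs). A point of $\lambda^\circ$ (resp. $\kappa^\circ$), represented by $x\in\mathbb R_{>0}^{E(\Gamma^{\mathcal E})}$, is the class of the pair $(X,\mathcal D)$, where $X$ is the tropical curve with model $\Gamma^{\mathcal E}$ and edge lengths $x_e$, and $\mathcal D$ is the divisor on $X$ given by $D$. **Proposition.** There is a unique map $\rho_T^{\rm trop}\colon R^{\rm trop}_{g,n}\to T^{\rm trop}_{g,n}$ taking the class of $(X,\mathcal D)$, with $\mathcal D$ a quasistable root of $X$, to the class of $(X,\mathcal D')$, where $\mathcal D'$ is any polystable root of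 $X$ linearly equivalent to $\mathcal D$. It is a refinement of generalized cone complexes, i.e. it is a morphism (it is continuous, and on each cone $\lambda$ it factors through an integral linear map from $\lambda$ to some cone $\kappa$) and a bijection. For every specialization of root-graphs $(\Gamma,\mathcal E,D)\ge(\Gamma',\mathcal E',D')$ with $(\mathcal E,D)$ polystable and $(\mathcal E',D')$ quasistable, $\rho_T^{\rm trop}$ restricted to $\lambda_{(\Gamma',\mathcal E',D')}$ is induced by the map $\lambda_{(\Gamma',\mathcal E',D')}\to\kappa_{(\Gamma,\mathcal E,D)}$ given by extension by zero. Moreover, for every polystable root-graph $(\Gamma,\mathcal E,D)$ with $\Gamma$ stable of genus $g$ with $n$ legs, there are decompositions into disjoint subsets $$\kappa^\circ_{(\Gamma,\mathcal E,D)}=\coprod_{(\mathcal E,D)=\mathrm{pol}(\mathcal E',D')}\lambda^\circ_{(\Gamma,\mathcal E',D')},\qquad \kappa_{(\Gamma,\mathcal E,D)}=\coprod_{(\Gamma,\mathcal E,D)\ge(\Gamma',\mathcal E',D')}\lambda^\circ_{(\Gamma',\mathcal E',D')}.$$ The first is indexed by the quasistable pseudo-roots $(\mathcal E',D')$ on $\Gamma$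 with $\mathrm{pol}(\mathcal E',D')=(\mathcal E,D)$; for each of them there is a specialization of root-graphs $(\Gamma,\mathcal E,D)\ge(\Gamma,\mathcal E',D')$ over $\mathrm{id}_\Gamma$. The second is indexed by the specializations of root-graphs from $(\Gamma,\mathcal E,D)$ to quasistable root-graphs $(\Gamma',\mathcal E',D')$, up to isomorphism of the target. In both, $\lambda^\circ$ is mapped injectively to $\kappa$ by extension by zero. -/

import Mathlib

open Set Filter Topology

noncomputable section

/-- A finite weighted graph (loops and multiple edges allowed) with `n` labelled legs. Every edge
has two ends, labelled by `Bool`; the labelling only serves as a reference orientation. -/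
structure LegGraph (n : ℕ) where
  V : Type
  E : Type
  [fintypeV : Fintype V]
  [fintypeE : Fintype E]
  [decEqV : DecidableEq V]
  [decEqE : DecidableEq E]
  ends : E → Bool → V
  weight : V → ℕ
  leg : Fin n → V

attribute [instance] LegGraph.fintypeV LegGraph.fintypeE LegGraph.decEqV LegGraph.decEqE

namespace LegGraph

section Basic

variable {n : ℕ} (Γ : LegGraph n)

/-- Oriented edges: `(e, b)` is the edge `e` oriented from its end `b` to its end `!b`. -/
abbrev Dart : Type := Γ.E × Bool

def source (d : Γ.Dart) : Γ.V := Γ.ends d.1 d.2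

def target (d : Γ.Dart) : Γ.V := Γ.ends d.1 (!d.2)

def Adj (u v : Γ.V) : Prop := ∃ d : Γ.Dart, Γ.source d = u ∧ Γ.target d = v

/-- The number of connected components. -/
def b0 : ℕ := Nat.card (Quot Γ.Adj)

def Connected : Prop := Γ.b0 = 1

/-- Total weight plus first Betti number. -/
def genus : ℤ :=
  ∑ v, (Γ.weight v : ℤ) + ((Fintype.card Γ.E : ℤ) - (Fintype.card Γ.V : ℤ) + (Γ.b0 : ℤ))

/-- The number of edges in `S` incident to `v`, loops counting twice. -/
def degIn (S : Finset Γ.E) (v : Γ.V) : ℕ :=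
  (Finset.univ.filter fun d : Γ.Dart => d.1 ∈ S ∧ Γ.source d = v).card

def deg (v : Γ.V) : ℕ := Γ.degIn Finset.univ v

def legCount (v : Γ.V) : ℕ := (Finset.univ.filter fun i : Fin n => Γ.leg i = v).card

def IsStable : Prop :=
  ∀ v, 0 < 2 * (Γ.weight v : ℤ) - 2 + (Γ.deg v : ℤ) + (Γ.legCount v : ℤ)

/-- The edge `e` joins `W` and its complement. -/
def Crosses (e : Γ.E) (W : Finset Γ.V) : Prop :=
  ∃ b, Γ.ends e b ∈ W ∧ Γ.ends e (!b) ∉ W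

instance (e : Γ.E) (W : Finset Γ.V) : Decidable (Γ.Crosses e W) := by
  unfold Crosses; infer_instance

/-- The canonical divisor (legs do not contribute). -/
def canonicalDivisor (v : Γ.V) : ℤ := 2 * (Γ.weight v : ℤ) - 2 + (Γ.deg v : ℤ)

/-- The canonical polarization of degree `g - 1`. -/
def polarization (v : Γ.V) : ℝ := (2 * (Γ.weight v : ℝ) - 2 + (Γ.deg v : ℝ)) / 2

/-- An oriented cycle, with cyclically indexed oriented edges: consecutive oriented edges are
composable, and no vertex and no edge is repeated. -/
structure OrientedCycle where
  len : ℕ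
  dart : Fin (len + 1) → Γ.Dart
  closed : ∀ i, Γ.target (dart i) = Γ.source (dart (i + 1))
  vertex_inj : Function.Injective fun i => Γ.source (dart i)
  edge_inj : Function.Injective fun i => (dart i).1

/-- An integral flow: an antisymmetric function on oriented edges. -/
structure Flow where
  val : Γ.Dart → ℤ
  antisymm : ∀ e b, val (e, !b) = -val (e, b)

namespace Flow

variable {Γ}

instance : Zero Γ.Flow := ⟨⟨fun _ => 0, fun _ _ => by simp⟩⟩

/-- The divisor of a flow. -/
def div (φ : Γ.Flow) (v : Γ.V) : ℤ := ∑ d : Γ.Dart, if Γ.target d = v then φ.val d else 0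

/-- No oriented cycle along which the flow is nonnegative and not identically zero. -/
def Acyclic (φ : Γ.Flow) : Prop :=
  ∀ γ : Γ.OrientedCycle, (∀ i, 0 ≤ φ.val (γ.dart i)) → ∀ i, φ.val (γ.dart i) = 0

end Flow

/-- The graph `Γ^S`, with one exceptional vertex of weight zero inserted in every edge of `S`.
For `e ∈ S`, the edge `Sum.inr (e, b)` of the new graph joins the end `b` of `e` (its end `false`)
to the exceptional vertex inside `e` (its end `true`). -/
def subdivide (S : Finset Γ.E) : LegGraph n where
  V := Γ.V ⊕ {e : Γ.E // e ∈ S}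
  E := {e : Γ.E // e ∉ S} ⊕ ({e : Γ.E // e ∈ S} × Bool)
  ends := fun x b => match x with
    | Sum.inl e => Sum.inl (Γ.ends e.1 b)
    | Sum.inr (e, c) => if b then Sum.inr e else Sum.inl (Γ.ends e.1 c)
  weight := Sum.elim Γ.weight fun _ => 0
  leg := fun i => Sum.inl (Γ.leg i)

/-- The edge of `Γ` over which an edge of `Γ^S` lies. -/
def edgeOver (S : Finset Γ.E) : (Γ.subdivide S).E → Γ.E :=
  Sum.elim (fun e => e.1) fun p => p.1.1

/-- A pseudo-divisor `(S, D)` on `Γ`: a divisor `D` on `Γ^S` with value `-1` at every exceptional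
vertex. -/
structure PseudoDivisor where
  S : Finset Γ.E
  D : (Γ.subdivide S).V → ℤ
  exceptional : ∀ e : {e : Γ.E // e ∈ S}, D (Sum.inr e) = -1

end Basic

section Specialization

variable {n : ℕ}

/-- A specialization `Γ → Γ'`, that is, an identification of `Γ'` with the contraction of `Γ` at a
set of edges: a surjection on vertices and an injection `E(Γ') → E(Γ)`. The function `flip` records
how the reference orientations correspond, so that oriented edges of `Γ'` are oriented edges of `Γ`.
The contracted edges are those not in the image of `emap`. Two vertices have the same image exactly
if they are joined by contracted edges, and the weight of a vertex of `Γ'` is the genus of the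
connected subgraph contracted to it. -/
structure Specialization (Γ Γ' : LegGraph n) where
  vmap : Γ.V → Γ'.V
  emap : Γ'.E → Γ.E
  flip : Γ'.E → Bool
  vmap_surj : Function.Surjective vmap
  emap_inj : Function.Injective emap
  map_ends : ∀ e b, vmap (Γ.ends (emap e) (xor b (flip e))) = Γ'.ends e b
  map_contracted : ∀ e, (∀ e', emap e' ≠ e) → vmap (Γ.ends e false) = vmap (Γ.ends e true)
  fiber_connected : ∀ u v, vmap u = vmap v →
    Relation.ReflTransGen
      (fun a b => ∃ d : Γ.Dart, (∀ e', emap e' ≠ d.1) ∧ Γ.source d = a ∧ Γ.target d = b) u v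
  map_weight : ∀ v',
    Γ'.weight v' + (Finset.univ.filter fun v => vmap v = v').card =
      (∑ v ∈ Finset.univ.filter fun v => vmap v = v', Γ.weight v) +
        (Finset.univ.filter fun e => (∀ e', emap e' ≠ e) ∧ vmap (Γ.ends e false) = v').card + 1
  map_leg : ∀ i, vmap (Γ.leg i) = Γ'.leg i

namespace Specialization

variable {Γ Γ' : LegGraph n} (f : Specialization Γ Γ')

/-- The inclusion of oriented edges. -/
def dart (d : Γ'.Dart) : Γ.Dart := (f.emap d.1, xor d.2 (f.flip d.1))

/-- Push-forward of divisors. -/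
def pushDivisor (D : Γ.V → ℤ) (v' : Γ'.V) : ℤ := ∑ v ∈ Finset.univ.filter fun v => f.vmap v = v', D v

/-- Push-forward of flows. -/
def pushFlow (φ : Γ.Flow) : Γ'.Flow where
  val := fun d => φ.val (f.dart d)
  antisymm := fun e b => by
    have h : (xor (!b) (f.flip e)) = !(xor b (f.flip e)) := by
      cases b <;> cases f.flip e <;> rfl
    simp only [dart, h, φ.antisymm]

/-- The inclusion `ℝ^{E(Γ')} → ℝ^{E(Γ)}`, extension by zero at the contracted edges. -/
def incl : (Γ'.E → ℝ) →ₗ[ℝ] (Γ.E → ℝ) := Function.ExtendByZero.linearMap ℝ f.emap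

end Specialization

end Specialization

namespace PseudoDivisor

variable {n : ℕ} {Γ : LegGraph n} (A : Γ.PseudoDivisor)

/-- The graph `Γ^S`. -/
abbrev graph : LegGraph n := Γ.subdivide A.S

/-- The total degree equals the degree of the canonical polarization. -/
def HasPolarizationDegree : Prop := ((∑ v, A.D v : ℤ) : ℝ) = ∑ v, A.graph.polarization v

/-- `β_D(W) = deg D|_W - μ(W) + δ_W / 2` on `Γ^S`; the canonical polarization of `Γ^S` is the
extension of that of `Γ` by zero. -/
def beta (W : Finset A.graph.V) : ℝ :=
  ((∑ v ∈ W, A.D v : ℤ) : ℝ) - ∑ v ∈ W, A.graph.polarization v +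
    ((Finset.univ.filter fun e => A.graph.Crosses e W).card : ℝ) / 2

/-- `(v₀, μ)`-quasistability: `β_D(W) ≥ 0` for all proper subsets `W` of the vertices of `Γ^S`, with
strict inequality if `v₀ ∈ W`. -/
def IsQuasistable (v₀ : Γ.V) : Prop :=
  A.HasPolarizationDegree ∧ ∀ W : Finset A.graph.V, W ≠ Finset.univ →
    0 ≤ A.beta W ∧ (Sum.inl v₀ ∈ W → 0 < A.beta W)

/-- `β_{S,D}(W) = deg D|_W - (μ(W) + deg_S(W) / 2) + δ_{Γ_S, W} / 2`, where `Γ_S` is `Γ` with the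
edges of `S` removed. -/
def betaRemoved (W : Finset Γ.V) : ℝ :=
  ((∑ v ∈ W, A.D (Sum.inl v) : ℤ) : ℝ) -
    ∑ v ∈ W, (Γ.polarization v + (Γ.degIn A.S v : ℝ) / 2) +
    ((Finset.univ.filter fun e => e ∉ A.S ∧ Γ.Crosses e W).card : ℝ) / 2

/-- Polystability: `β_{S,D}(W) ≥ 0` for all `W`, with strict inequality if some edge not in `S` joins
`W` and its complement. -/
def IsPolystable : Prop :=
  A.HasPolarizationDegree ∧ ∀ W : Finset Γ.V,
    0 ≤ A.betaRemoved W ∧ ((∃ e, Γ.Crosses e W ∧ e ∉ A.S) → 0 < A.betaRemoved W)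

/-- `φ` is an acyclic flow on `Γ^S` with `2D + Div(φ) = K`. -/
def IsRootFlow (φ : A.graph.Flow) : Prop :=
  φ.Acyclic ∧ ∀ v, 2 * A.D v + φ.div v = A.graph.canonicalDivisor v

def IsPseudoRoot : Prop := ∃ φ, A.IsRootFlow φ

open Classical in
/-- The acyclic flow of a pseudo-root (unique if the pseudo-root is semistable). -/
def flow : A.graph.Flow := if h : A.IsPseudoRoot then h.choose else 0

def IsPolystableRoot : Prop := A.IsPseudoRoot ∧ A.IsPolystable

def IsQuasistableRoot (v₀ : Γ.V) : Prop := A.IsPseudoRoot ∧ A.IsQuasistable v₀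

/-- The linear subspace `Λ`. -/
def Lam : Set (A.graph.E → ℝ) :=
  {x | ∀ γ : A.graph.OrientedCycle, ∑ i, (A.flow.val (γ.dart i) : ℝ) * x (γ.dart i).1 = 0}

/-- The cone `λ`. -/
def lam : Set (A.graph.E → ℝ) := {x | x ∈ A.Lam ∧ ∀ e, 0 ≤ x e}

/-- The open cone `λ°`. -/
def lamInt : Set (A.graph.E → ℝ) := {x | x ∈ A.Lam ∧ ∀ e, 0 < x e}

/-- The vector `u_W`: over every edge between `W` and its complement, coordinate `1` at the
edge of `Γ^S` incident to `W` and `-1` at the one incident to the complement. -/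
def cutVector (W : Finset Γ.V) : A.graph.E → ℝ :=
  Sum.elim (fun _ => 0) fun p =>
    if Γ.Crosses p.1.1 W then (if Γ.ends p.1.1 p.2 ∈ W then 1 else -1) else 0

/-- The subspace `L_S`, spanned by the `u_W` with all edges between `W` and its complement in `S`. -/
def cutSpace : Submodule ℝ (A.graph.E → ℝ) :=
  Submodule.span ℝ {u | ∃ W : Finset Γ.V, (∀ e, Γ.Crosses e W → e ∈ A.S) ∧ u = A.cutVector W}

/-- The ambient space of the cone `κ`. -/
abbrev KapSpace : Type := (A.graph.E → ℝ) ⧸ A.cutSpace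

/-- The cone `κ`. -/
def kap : Set A.KapSpace := A.cutSpace.mkQ '' A.lam

/-- The open cone `κ°`. -/
def kapInt : Set A.KapSpace := A.cutSpace.mkQ '' A.lamInt

/-- The linear map `ℝ^{E(Γ^S)} → ℝ^{E(Γ)}` adding up the coordinates over every edge. -/
def lengths (x : A.graph.E → ℝ) (e : Γ.E) : ℝ :=
  ∑ e' ∈ Finset.univ.filter fun e' => Γ.edgeOver A.S e' = e, x e'

end PseudoDivisor

/-- A specialization of triples `(Γ, S, D) ≥ (Γ', S', D')`. -/
structure TripleSpecialization {n : ℕ} {Γ Γ' : LegGraph n} (A : Γ.PseudoDivisor)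
    (B : Γ'.PseudoDivisor) where
  base : Specialization Γ Γ'
  hat : Specialization A.graph B.graph
  subset : ∀ e ∈ B.S, base.emap e ∈ A.S
  compat_vertex : ∀ v, hat.vmap (Sum.inl v) = Sum.inl (base.vmap v)
  compat_edge : ∀ e, Γ.edgeOver A.S (hat.emap e) = base.emap (Γ'.edgeOver B.S e)
  push : hat.pushDivisor A.D = B.D

namespace TripleSpecialization

variable {n : ℕ} {Γ : LegGraph n} {A B : Γ.PseudoDivisor}

/-- The underlying specialization of graphs is the identity. -/
def IsOverId (f : TripleSpecialization A B) : Prop :=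
  (∀ v, f.base.vmap v = v) ∧ ∀ e, f.base.emap e = e

end TripleSpecialization

namespace PseudoDivisor

variable {n : ℕ} {Γ : LegGraph n}

/-- The relation `A ≥ B` between pseudo-divisors on the same graph. -/
def Ge (A B : Γ.PseudoDivisor) : Prop := ∃ f : TripleSpecialization A B, f.IsOverId

/-- `A = pol(B)`: the minimal polystable pseudo-divisor specializing to `B`. -/
def IsPol (A B : Γ.PseudoDivisor) : Prop :=
  A.IsPolystable ∧ A.Ge B ∧ ∀ C : Γ.PseudoDivisor, C.IsPolystable → C.Ge B → C.Ge A

end PseudoDivisor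

/-- A specialization of root-graphs: a specialization of triples that is compatible with the
associated acyclic flows. -/
structure RootSpecialization {n : ℕ} {Γ Γ' : LegGraph n} (A : Γ.PseudoDivisor)
    (B : Γ'.PseudoDivisor) extends TripleSpecialization A B where
  push_flow : hat.pushFlow A.flow = B.flow

namespace RootSpecialization

variable {n : ℕ} {Γ Γ' : LegGraph n} {A : Γ.PseudoDivisor} {B : Γ'.PseudoDivisor}

/-- The map from the space of `λ_B` to the space of `κ_A` induced by a specialization `A ≥ B`. -/
def inclKap (f : RootSpecialization A B) : (B.graph.E → ℝ) →ₗ[ℝ] A.KapSpace :=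
  A.cutSpace.mkQ ∘ₗ f.hat.incl

theorem crosses_iff (f : RootSpecialization A B) (W : Finset Γ'.V) (e : Γ'.E) :
    Γ.Crosses (f.base.emap e) (Finset.univ.filter fun v => f.base.vmap v ∈ W) ↔
      Γ'.Crosses e W := by
  have h0 := f.base.map_ends e false
  have h1 := f.base.map_ends e true
  simp only [Crosses, Finset.mem_filter, Finset.mem_univ, true_and, Bool.exists_bool,
    Bool.not_false, Bool.not_true, ← h0, ← h1]
  cases f.base.flip e <;> simp [or_comm]

theorem exists_of_crosses (f : RootSpecialization A B) (W : Finset Γ'.V) (e : Γ.E)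
    (h : Γ.Crosses e (Finset.univ.filter fun v => f.base.vmap v ∈ W)) :
    ∃ e', f.base.emap e' = e ∧ Γ'.Crosses e' W := by
  by_contra hc
  have hr : ∀ e', f.base.emap e' ≠ e := by
    intro e' he
    exact hc ⟨e', he, (f.crosses_iff W e').1 (he ▸ h)⟩
  have h2 := f.base.map_contracted e hr
  simp only [Crosses, Finset.mem_filter, Finset.mem_univ, true_and, Bool.exists_bool,
    Bool.not_false, Bool.not_true, h2] at h
  tauto

theorem hat_inr (f : RootSpecialization A B) (e : {e // e ∈ B.S}) (b : Bool) :
    ∃ c, f.hat.emap (Sum.inr (e, b)) = Sum.inr (⟨f.base.emap e.1, f.subset e.1 e.2⟩, c) ∧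
      f.base.vmap (Γ.ends (f.base.emap e.1) c) = Γ'.ends e.1 b := by
  have h1 := f.compat_edge (Sum.inr (e, b))
  have h2 := f.hat.map_ends (Sum.inr (e, b))
  rcases h : f.hat.emap (Sum.inr (e, b)) with e0 | ⟨e0, c⟩
  · rw [h] at h1
    exact absurd (f.subset e.1 e.2) (by
      have : e0.1 = f.base.emap e.1 := h1
      exact this ▸ e0.2)
  · rw [h] at h1
    have h3 : e0 = ⟨f.base.emap e.1, f.subset e.1 e.2⟩ := Subtype.ext h1
    subst h3
    refine ⟨c, rfl, ?_⟩
    rw [h] at h2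
    have h4 := h2 true
    have h5 := h2 false
    cases hf : f.hat.flip (Sum.inr (e, b)) with
    | true =>
      rw [hf] at h4
      have h6 := (f.compat_vertex (Γ.ends (f.base.emap e.1) c)).symm.trans h4
      exact absurd h6 Sum.inl_ne_inr
    | false =>
      rw [hf] at h5
      have h6 := (f.compat_vertex (Γ.ends (f.base.emap e.1) c)).symm.trans h5
      exact Sum.inl.inj h6

theorem cutVector_incl (f : RootSpecialization A B) (W : Finset Γ'.V)
    (hW : ∀ e, Γ'.Crosses e W → e ∈ B.S) : f.hat.incl (B.cutVector W) ∈ A.cutSpace := by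
  refine Submodule.subset_span ⟨Finset.univ.filter fun v => f.base.vmap v ∈ W, ?_, ?_⟩
  · intro e he
    obtain ⟨e', rfl, h⟩ := f.exists_of_crosses W e he
    exact f.subset e' (hW e' h)
  · funext x
    change Function.extend f.hat.emap (B.cutVector W) 0 x = _
    by_cases hx : ∃ y, f.hat.emap y = x
    · obtain ⟨y, rfl⟩ := hx
      rw [f.hat.emap_inj.extend_apply]
      by_cases hc : Γ'.Crosses (Γ'.edgeOver B.S y) W
      · rcases y with y | ⟨e, b⟩
        · exact absurd (hW _ hc) y.2
        · obtain ⟨c, h1, h2⟩ := f.hat_inr e b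
          have hc1 : Γ'.Crosses e.1 W := hc
          have hc2 := (f.crosses_iff W e.1).2 hc1
          rw [h1]
          simp only [PseudoDivisor.cutVector, Sum.elim_inr, if_pos hc1, if_pos hc2,
            Finset.mem_filter, Finset.mem_univ, true_and, h2]
      · have hc2 : ¬ Γ.Crosses (Γ.edgeOver A.S (f.hat.emap y))
            (Finset.univ.filter fun v => f.base.vmap v ∈ W) := by
          rw [f.compat_edge, f.crosses_iff]
          exact hc
        have h1 : B.cutVector W y = 0 := by
          rcases y with y | ⟨e, b⟩
          · rfl
          · exact if_neg hc
        rw [h1]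
        rcases hy : f.hat.emap y with z | ⟨e, b⟩
        · rfl
        · rw [hy] at hc2
          exact (if_neg hc2).symm
    · rw [Function.extend_apply' _ _ _ hx]
      rcases x with x | ⟨e, b⟩
      · rfl
      · refine (if_neg fun hc => hx ?_).symm
        obtain ⟨e', he, hc'⟩ := f.exists_of_crosses W e.1 hc
        obtain ⟨c0, h0, -⟩ := f.hat_inr ⟨e', hW e' hc'⟩ false
        obtain ⟨c1, h1, -⟩ := f.hat_inr ⟨e', hW e' hc'⟩ true
        have he' : (⟨f.base.emap e', f.subset e' (hW e' hc')⟩ : {e // e ∈ A.S}) = e :=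
          Subtype.ext he
        rw [he'] at h0 h1
        by_cases hb0 : c0 = b
        · exact ⟨_, hb0 ▸ h0⟩
        · by_cases hb1 : c1 = b
          · exact ⟨_, hb1 ▸ h1⟩
          · have h01 : c0 = c1 := by
              cases c0 <;> cases c1 <;> cases b <;> simp_all
            rw [h01, ← h1] at h0
            have h2 := congrArg Prod.snd (Sum.inr.inj (f.hat.emap_inj h0))
            exact absurd h2 Bool.false_ne_true

/-- The map from the space of `κ_B` to the space of `κ_A` induced by a specialization `A ≥ B`. -/
def mapKap (f : RootSpecialization A B) : B.KapSpace →ₗ[ℝ] A.KapSpace :=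
  B.cutSpace.mapQ A.cutSpace f.hat.incl (by
    rw [PseudoDivisor.cutSpace, Submodule.span_le]
    rintro u ⟨W, hW, rfl⟩
    exact f.cutVector_incl W hW)

end RootSpecialization

/-- A stable graph of genus `g` with `n` legs. -/
structure StableGraph (g n : ℕ) where
  graph : LegGraph n
  connected : graph.Connected
  stable : graph.IsStable
  genus_eq : graph.genus = g

/-- A polystable root-graph on a stable graph of genus `g` with `n` legs. -/
structure PolystableRootGraph (g n : ℕ) where
  base : StableGraph g n
  root : base.graph.PseudoDivisor
  isRoot : root.IsPolystableRoot

/-- A `v₀`-quasistable root-graph on a stable graph of genus `g` with `n` legs, where `v₀` is the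
vertex carrying the first leg. -/
structure QuasistableRootGraph (g n : ℕ) [NeZero n] where
  base : StableGraph g n
  root : base.graph.PseudoDivisor
  isRoot : root.IsQuasistableRoot (base.graph.leg 0)

/-- A metric on `Γ`: the pair of `Γ` and a metric is a tropical curve. -/
structure Metric {n : ℕ} (Γ : LegGraph n) where
  len : Γ.E → ℝ
  len_pos : ∀ e, 0 < len e

namespace Metric

variable {n : ℕ} {Γ : LegGraph n} (X : Γ.Metric)

/-- The points of the tropical curve: vertices, and interior points of edges, given by their
distance to the end `false` of the edge. -/
abbrev Point : Type := Γ.V ⊕ {p : Γ.E × ℝ // 0 < p.2 ∧ p.2 < X.len p.1}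

/-- The point of the edge `e` at distance `t ∈ [0, ℓ(e)]` from the end `false`. -/
def pt (e : Γ.E) (t : ℝ) : X.Point :=
  if h : 0 < t ∧ t < X.len e then Sum.inr ⟨(e, t), h⟩
  else if t ≤ 0 then Sum.inl (Γ.ends e false) else Sum.inl (Γ.ends e true)

/-- A rational function: a continuous function that is piecewise linear with integer slopes, in the
form that, locally on either side of any point of an edge, it is affine with integer slope. The
outgoing slope at `pt e t` is `slope e true t` in the direction of the end `true` of `e`, and
`slope e false t` in the direction of the end `false`. -/
structure RationalFunction where
  val : X.Point → ℝ
  slope : Γ.E → Bool → ℝ → ℤ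
  slope_true : ∀ e t, 0 ≤ t → t < X.len e →
    ∀ᶠ s in 𝓝[>] t, val (X.pt e s) = val (X.pt e t) + (slope e true t : ℝ) * (s - t)
  slope_false : ∀ e t, 0 < t → t ≤ X.len e →
    ∀ᶠ s in 𝓝[<] t, val (X.pt e s) = val (X.pt e t) + (slope e false t : ℝ) * (t - s)

/-- The principal divisor of a rational function: the sum of all outgoing slopes at a point. -/
def RationalFunction.div {X : Γ.Metric} (f : X.RationalFunction) : X.Point → ℤ
  | Sum.inl v => ∑ e, ((if Γ.ends e false = v then f.slope e true 0 else 0) +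
      (if Γ.ends e true = v then f.slope e false (X.len e) else 0))
  | Sum.inr p => f.slope p.1.1 true p.1.2 + f.slope p.1.1 false p.1.2

/-- Linear equivalence of divisors on a tropical curve. -/
def LinearlyEquivalent (D D' : X.Point → ℤ) : Prop :=
  ∃ f : X.RationalFunction, ∀ p, D p - D' p = f.div p

open Classical in
/-- The unitary divisor of combinatorial type `A`, where the coordinates of `x` are the lengths of
the edges of `Γ^S`: at a vertex `v` it is `D(v)`, it is `-1` at the point of `e ∈ S` at distance
`x (e, false)` from the end `false` of `e`, and zero elsewhere. -/
def divisor (A : Γ.PseudoDivisor) (x : A.graph.E → ℝ) : X.Point → ℤ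
  | Sum.inl v => A.D (Sum.inl v)
  | Sum.inr p => if ∃ h : p.1.1 ∈ A.S, p.1.2 = x (Sum.inr (⟨p.1.1, h⟩, false)) then -1 else 0

end Metric

end LegGraph

/-- A (contravariant) diagram of cones in real vector spaces with lattices. -/
structure ConeDiagram where
  Obj : Type 1
  Arrow : Obj → Obj → Type
  Amb : Obj → Type
  [addCommGroup : ∀ i, AddCommGroup (Amb i)]
  [module : ∀ i, Module ℝ (Amb i)]
  [topology : ∀ i, TopologicalSpace (Amb i)]
  lattice : ∀ i, Set (Amb i)
  cone : ∀ i, Set (Amb i)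
  map : ∀ {i j}, Arrow i j → Amb j →ₗ[ℝ] Amb i

attribute [instance] ConeDiagram.addCommGroup ConeDiagram.module ConeDiagram.topology

namespace ConeDiagram

/-- Gluing: a point of a cone is identified with its image under every map of the diagram. -/
def Glue (C : ConeDiagram) (p q : Σ i, C.cone i) : Prop :=
  ∃ f : C.Arrow q.1 p.1, (q.2 : C.Amb q.1) = C.map f (p.2 : C.Amb p.1)

/-- The colimit of the diagram as a topological space: the quotient of the disjoint union of all
cones by the equivalence relation generated by the gluing. -/
def Space (C : ConeDiagram) : Type 1 := Quot C.Glue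

instance (C : ConeDiagram) : TopologicalSpace C.Space :=
  inferInstanceAs (TopologicalSpace (Quot C.Glue))

def toSpace (C : ConeDiagram) (i : C.Obj) (x : C.cone i) : C.Space := Quot.mk _ ⟨i, x⟩

/-- A morphism of generalized cone complexes: a continuous map whose restriction to every cone of
the source factors through a morphism to a cone of the target, that is, through a linear map
preserving the lattices and mapping the first cone to the second. -/
def IsMorphism {C C' : ConeDiagram} (ρ : C.Space → C'.Space) : Prop :=
  Continuous ρ ∧ ∀ i, ∃ j, ∃ T : C.Amb i →ₗ[ℝ] C'.Amb j,
    (∀ v ∈ C.lattice i, T v ∈ C'.lattice j) ∧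
    ∃ hT : ∀ x ∈ C.cone i, T x ∈ C'.cone j,
      ∀ x : C.cone i, ρ (C.toSpace i x) = C'.toSpace j ⟨T x, hT x x.2⟩

/-- A refinement: a bijective morphism of generalized cone complexes. -/
def IsRefinement {C C' : ConeDiagram} (ρ : C.Space → C'.Space) : Prop :=
  IsMorphism ρ ∧ Function.Bijective ρ

end ConeDiagram

open LegGraph

/-- The integral vectors of `ℝ^ι`. -/
def integralVectors (ι : Type) : Set (ι → ℝ) := {x | ∀ i, ∃ m : ℤ, x i = m}

/-- The diagram of the cones `λ` of quasistable root-graphs; its space is `R^trop_{g,n}`. -/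
def quasistableDiagram (g n : ℕ) [NeZero n] : ConeDiagram where
  Obj := QuasistableRootGraph g n
  Arrow := fun P Q => RootSpecialization P.root Q.root
  Amb := fun P => P.root.graph.E → ℝ
  lattice := fun P => integralVectors P.root.graph.E
  cone := fun P => P.root.lam
  map := fun f => f.hat.incl

/-- The diagram of the cones `κ` of polystable root-graphs; its space is `T^trop_{g,n}`. -/
def polystableDiagram (g n : ℕ) : ConeDiagram where
  Obj := PolystableRootGraph g n
  Arrow := fun P Q => RootSpecialization P.root Q.root
  Amb := fun P => P.root.KapSpace
  lattice := fun P => P.root.cutSpace.mkQ '' integralVectors P.root.graph.E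
  cone := fun P => P.root.kap
  map := fun f => f.mapKap

/-- The moduli space of quasistable roots. -/
abbrev RTrop (g n : ℕ) [NeZero n] : Type 1 := (quasistableDiagram g n).Space

/-- The moduli space of tropical theta characteristics. -/
abbrev TTrop (g n : ℕ) : Type 1 := (polystableDiagram g n).Space

/-- `r` is the class of a pair `(X, 𝒟)` with `𝒟` a quasistable root of the tropical curve `X`, and
`t` is the class of a pair `(X, 𝒟')` with `𝒟'` a polystable root of `X` linearly equivalent
to `𝒟`. -/
def SameTheta {g n : ℕ} [NeZero n] (r : RTrop g n) (t : TTrop g n) : Prop :=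
  ∃ (Q : QuasistableRootGraph g n) (B : Q.base.graph.PseudoDivisor) (hB : B.IsPolystableRoot)
    (X : Q.base.graph.Metric) (x : Q.root.graph.E → ℝ) (y : B.graph.E → ℝ)
    (hx : x ∈ Q.root.lam) (hy : y ∈ B.lam),
    (∀ e, 0 < x e) ∧ (∀ e, 0 < y e) ∧ Q.root.lengths x = X.len ∧ B.lengths y = X.len ∧
    X.LinearlyEquivalent (X.divisor Q.root x) (X.divisor B y) ∧
    r = (quasistableDiagram g n).toSpace Q ⟨x, hx⟩ ∧
    t = (polystableDiagram g n).toSpace ⟨Q.base, B, hB⟩ ⟨B.cutSpace.mkQ y, y, hy, rfl⟩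

/-- Two specializations from the same root-graph `P` agree up to an isomorphism of their targets. -/
def SameSpecialization {n : ℕ} {Γ Γ₁ Γ₂ : LegGraph n} {P : Γ.PseudoDivisor} {A : Γ₁.PseudoDivisor}
    {B : Γ₂.PseudoDivisor} (f : RootSpecialization P A) (f' : RootSpecialization P B) : Prop :=
  ∃ α : RootSpecialization A B, Function.Bijective α.hat.emap ∧
    (∀ v, α.hat.vmap (f.hat.vmap v) = f'.hat.vmap v) ∧
    ∀ d, f.hat.dart (α.hat.dart d) = f'.hat.dart d

end

open LegGraph

/-! Everything is read off from the acyclic flow of a root. If `2D + Div(φ) = K`, then `2 β_D(W)` is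
the sum of `φ + 1` over the oriented edges leaving `W` (`two_mul_beta`). Acyclicity gives a height
function on the vertices that increases strictly along positive flow and is constant where the flow
vanishes. Testing semistability on its superlevel sets shows that the flow of a semistable root
takes values in `{-1, 0, 1}` and is unique. On an exceptional edge it runs with value `1` into the
exceptional vertex. Polystability means that the flow vanishes off the exceptional edges, so that a
polystable root is determined by its exceptional set. Quasistability means that every vertex is
reachable from `v₀` along oriented non-exceptional edges with nonnegative flow. The root `pol(B)`
makes every edge with nonzero flow exceptional; `B` is recovered by contracting the new vertices to
the heads of the flow.

A specialization from a polystable `P` to a root `Q` turns a point of `λ°_Q` into a nonnegative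
vector on the edges of `P.graph` that is zero exactly at the contracted edges. By the criterion
above, `Q` is quasistable if and only if all vertices can be reached from `v₀` by steps whose
half-edge at the target, if there is one, has length zero (`reach_free_iff`). The space `L` consists
of the differentials of functions on the vertices that are constant across non-exceptional edges,
and `λ_P` is closed under nonnegative representatives modulo `L`. Each class of a nonnegative vector
modulo `L` has exactly one nonnegative representative satisfying this reachability: existence is a
chip-firing argument (`exists_reach`), uniqueness a maximum principle (`eq_of_reach`). Its support
determines the contraction, so every point of `κ_P` lies in exactly one face `λ°_Q`. Adding elements
of `L` preserves edge lengths; hence over `κ°_P` no edge of the graph is contracted, and `P =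
pol(Q)`. Conversely, adding a small multiple of the differential of the height makes an interior
point of such a face positive.

The map `rho` is extension by zero into `κ` of `pol(Q)`. Every specialization from a polystable root
to `Q` factors through `pol(Q)` (`exists_factor_pol`), which gives compatibility with all faces, and
the decomposition of `κ` gives bijectivity.

For linear equivalence, a rational function with divisor `D_Q - D_B` becomes affine on edges once
its bends at exceptional points are removed. Twice its slopes, minus those predicted by the flows,
form a harmonic integral one-form whose product with the lengths is exact, hence zero
(`slopes_of_roots`). Parity of the resulting formula gives `B = pol(Q)`, and the vertex values of
the function exhibit the two length vectors as congruent modulo `L`. Conversely, these slopes and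
values define a rational function. -/

open Set Filter Topology

namespace LegGraph

/-! ### Closed walks, potentials, and heights of acyclic flows -/

section Walks

variable {n : ℕ} (Γ : LegGraph n)

/-- A list of composable oriented edges from `u` to `v`. -/
def IsWalk : Γ.V → List Γ.Dart → Γ.V → Prop
  | u, [], v => u = v
  | u, d :: l, v => Γ.source d = u ∧ IsWalk (Γ.target d) l v

variable {Γ}

theorem isWalk_append {u v : Γ.V} {l m : List Γ.Dart} :
    Γ.IsWalk u (l ++ m) v ↔ ∃ w, Γ.IsWalk u l w ∧ Γ.IsWalk w m v := by
  induction l generalizing u with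
  | nil => simp [IsWalk]
  | cons d l ih => simp [IsWalk, ih, and_assoc]

/-- The opposite orientation. -/
def Dart.rev (d : Γ.Dart) : Γ.Dart := (d.1, !d.2)

@[simp] theorem source_rev (d : Γ.Dart) : Γ.source (Dart.rev d) = Γ.target d := rfl

@[simp] theorem target_rev (d : Γ.Dart) : Γ.target (Dart.rev d) = Γ.source d := by
  simp [Dart.rev, source, target]

theorem isWalk_reverse {u v : Γ.V} {l : List Γ.Dart} (h : Γ.IsWalk u l v) :
    Γ.IsWalk v (l.reverse.map Dart.rev) u := by
  induction l generalizing u with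
  | nil => exact h.symm
  | cons d l ih =>
    rw [List.reverse_cons, List.map_append, isWalk_append]
    exact ⟨_, ih h.2, rfl, by simpa [IsWalk] using h.1⟩

theorem isWalk_source_succ {u v : Γ.V} {l : List Γ.Dart} (h : Γ.IsWalk u l v) (i : ℕ)
    (hi : i + 1 < l.length) : Γ.target l[i] = Γ.source l[i + 1] := by
  induction l generalizing u i with
  | nil => simp at hi
  | cons d l ih =>
    cases i with
    | zero =>
      cases l with
      | nil => simp at hi
      | cons d' l => exact h.2.1.symm
    | succ i => exact ih h.2 i (by simpa using hi)

theorem isWalk_source_zero {u v : Γ.V} {l : List Γ.Dart} (h : Γ.IsWalk u l v)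
    (hl : 0 < l.length) : Γ.source l[0] = u := by
  cases l with
  | nil => simp at hl
  | cons d l => exact h.1

theorem isWalk_target_last {u v : Γ.V} {l : List Γ.Dart} (h : Γ.IsWalk u l v) (i : ℕ)
    (hi : i + 1 = l.length) : Γ.target l[i] = v := by
  induction l generalizing u i with
  | nil => simp at hi
  | cons d l ih =>
    cases i with
    | zero =>
      have : l = [] := by
        apply List.eq_nil_of_length_eq_zero
        simpa using hi.symm
      subst this
      exact h.2
    | succ i => exact ih h.2 i (by simpa using hi)

/-- Every closed walk is built from oriented cycles and backtracks. -/
theorem closedWalk_induction {M : List Γ.Dart → Prop} (nil : M [])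
    (cycle : ∀ γ : Γ.OrientedCycle, M (List.ofFn γ.dart))
    (backtrack : ∀ d : Γ.Dart, M [d, Dart.rev d])
    (splice : ∀ l₁ m l₂, M (l₁ ++ l₂) → M m → M (l₁ ++ m ++ l₂))
    {u : Γ.V} {l : List Γ.Dart} (hl : Γ.IsWalk u l u) : M l := by
  induction hk : l.length using Nat.strong_induction_on generalizing u l with
  | _ k ih =>
    -- A repeated vertex splits off a closed subwalk; both this subwalk and the rest are closed and
    -- shorter.
    by_cases hs : ∃ i j : ℕ, ∃ (hij : i < j) (hj : j < l.length),
        Γ.source l[i] = Γ.source l[j]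
    · obtain ⟨i, j, hij, hj, he⟩ := hs
      have h1 : l = l.take i ++ ((l.drop i).take (j - i) ++ l.drop j) := by
        conv_lhs => rw [← List.take_append_drop i l, ← List.take_append_drop (j - i) (l.drop i)]
        rw [List.drop_drop]
        congr 3
        omega
      have hd : ∀ a (ha : a < l.length) w, Γ.IsWalk w (l.drop a) u → w = Γ.source l[a] := by
        intro a ha w hw
        rw [List.drop_eq_getElem_cons ha] at hw
        exact hw.1.symm
      rw [h1, isWalk_append] at hl
      obtain ⟨w, hw1, hw2⟩ := hl
      have hwi := hd i (by omega) w (by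
        have : l.drop i = (l.drop i).take (j - i) ++ l.drop j := by
          conv_lhs => rw [← List.take_append_drop (j - i) (l.drop i)]
          rw [List.drop_drop]
          congr 2
          omega
        rw [this]
        exact hw2)
      rw [isWalk_append] at hw2
      obtain ⟨w', hw2, hw3⟩ := hw2
      have hwj := hd j hj w' hw3
      have hww : w' = w := by rw [hwi, hwj, he]
      subst hww
      rw [h1, ← List.append_assoc]
      refine splice _ _ _ (ih _ ?_ (isWalk_append.2 ⟨_, hw1, hw3⟩) rfl) (ih _ ?_ hw2 rfl)
      · simp only [List.length_append, List.length_take, List.length_drop]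
        omega
      · simp only [List.length_take, List.length_drop]
        omega
    · push Not at hs
      rcases Nat.eq_zero_or_pos l.length with h0 | h0
      · rw [List.eq_nil_of_length_eq_zero h0]
        exact nil
      have hinj : ∀ i j (hi : i < l.length) (hj : j < l.length),
          Γ.source l[i] = Γ.source l[j] → i = j := by
        intro i j hi hj h
        rcases lt_trichotomy i j with hlt | heq | hlt
        · exact absurd h (hs i j hlt hj)
        · exact heq
        · exact absurd h.symm (hs j i hlt hi)
      -- As the sources are distinct, a repeated edge is traversed in opposite directions.
      -- Distinctness then makes the two passes consecutive and leaves no room for other steps, so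
      -- the walk is a single backtrack. Without a repeated edge it is an oriented cycle.
      by_cases he : ∃ i j : ℕ, ∃ (hij : i < j) (hj : j < l.length), (l[i]).1 = (l[j]).1
      · obtain ⟨i, j, hij, hj, he⟩ := he
        have hrev : l[j] = Dart.rev l[i] := by
          refine Prod.ext he.symm ?_
          by_contra hb
          have hb' : (l[i]).2 = (l[j]).2 := by
            change (l[j]).2 ≠ !(l[i]).2 at hb
            cases h1 : (l[i]).2 <;> cases h2 : (l[j]).2 <;> simp_all
          exact hs i j hij hj (by rw [Prod.ext he hb'])
        have hj1 : j = i + 1 := by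
          have h1 := isWalk_source_succ hl i (by omega)
          have h2 : Γ.source l[j] = Γ.target l[i] := by rw [hrev]; rfl
          exact hinj _ _ hj (by omega) (h2.trans h1)
        have h3 : Γ.target l[j] = Γ.source l[i] := by rw [hrev, target_rev]
        have hlen : l.length = 2 ∧ i = 0 := by
          by_cases hjl : j + 1 < l.length
          · have h4 := isWalk_source_succ hl j hjl
            have := hinj _ _ hjl (by omega) (h4.symm.trans h3)
            omega
          · have h4 := isWalk_target_last hl j (by omega)
            have h5 := isWalk_source_zero hl h0
            have := hinj _ _ h0 (by omega) ((h5.trans h4.symm).trans h3)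
            omega
        obtain ⟨hlen, rfl⟩ := hlen
        subst hj1
        have : l = [l[0], l[1]] := by
          apply List.ext_getElem
          · simp [hlen]
          · intro i h1 h2
            simp only [List.length_cons, List.length_nil] at h2
            interval_cases i <;> simp
        rw [this, hrev]
        exact backtrack _
      · push Not at he
        obtain ⟨k', hk'⟩ : ∃ k', l.length = k' + 1 := ⟨l.length - 1, by omega⟩
        let γ : Γ.OrientedCycle :=
          { len := k'
            dart := fun i => l[i.1]'(by omega)
            closed := by
              intro i
              by_cases hi : i.1 + 1 < l.length
              · have : (i + 1).1 = i.1 + 1 := by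
                  rw [Fin.val_add_one_of_lt']
                  omega
                simp only [this]
                exact isWalk_source_succ hl _ hi
              · have hi' : i = Fin.last k' := by
                  apply Fin.ext
                  simp only [Fin.val_last]
                  omega
                subst hi'
                simp only [Fin.last_add_one, Fin.val_last, Fin.val_zero]
                rw [isWalk_target_last hl k' hk'.symm, isWalk_source_zero hl h0]
            vertex_inj := fun i j h => Fin.ext (hinj _ _ (by omega) (by omega) h)
            edge_inj := by
              intro i j h
              rcases lt_trichotomy i.1 j.1 with hlt | heq | hlt
              · exact absurd h (he _ _ hlt (by omega))
              · exact Fin.ext heq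
              · exact absurd h.symm (he _ _ hlt (by omega)) }
        have : l = List.ofFn γ.dart := by
          apply List.ext_getElem
          · simp [γ, hk']
          · intro i h1 h2
            rw [List.getElem_ofFn]
        rw [this]
        exact cycle γ

theorem exists_isWalk_of_reflTransGen {R : Γ.Dart → Prop} {u v : Γ.V}
    (h : Relation.ReflTransGen (fun a b => ∃ d, R d ∧ Γ.source d = a ∧ Γ.target d = b) u v) :
    ∃ l, Γ.IsWalk u l v ∧ ∀ d ∈ l, R d := by
  induction h with
  | refl => exact ⟨[], rfl, by simp⟩
  | tail _ hs ih =>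
    obtain ⟨l, hl, hR⟩ := ih
    obtain ⟨d, hd, rfl, rfl⟩ := hs
    refine ⟨l ++ [d], isWalk_append.2 ⟨_, hl, rfl, rfl⟩, ?_⟩
    intro d' hd'
    rcases List.mem_append.1 hd' with h | h
    · exact hR _ h
    · rw [List.mem_singleton.1 h]; exact hd

theorem OrientedCycle.sum_sub {M : Type*} [AddCommGroup M] (γ : Γ.OrientedCycle) (F : Γ.V → M) :
    ∑ i, (F (Γ.target (γ.dart i)) - F (Γ.source (γ.dart i))) = 0 := by
  rw [Finset.sum_sub_distrib, sub_eq_zero]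
  simp only [γ.closed]
  exact Equiv.sum_comp (Equiv.addRight (1 : Fin (γ.len + 1))) fun i => F (Γ.source (γ.dart i))

theorem exists_isWalk_of_quot {u v : Γ.V} (h : Quot.mk Γ.Adj u = Quot.mk Γ.Adj v) :
    ∃ l, Γ.IsWalk u l v := by
  rw [Quot.eq] at h
  induction h with
  | rel _ _ h =>
    obtain ⟨d, h1, h2⟩ := h
    exact ⟨[d], h1, h2⟩
  | refl _ => exact ⟨[], rfl⟩
  | symm _ _ _ ih =>
    obtain ⟨l, hl⟩ := ih
    exact ⟨_, isWalk_reverse hl⟩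
  | trans _ _ _ _ _ ih1 ih2 =>
    obtain ⟨l, hl⟩ := ih1
    obtain ⟨m, hm⟩ := ih2
    exact ⟨l ++ m, isWalk_append.2 ⟨_, hl, hm⟩⟩

/-- An antisymmetric function on oriented edges is a coboundary if and only if it sums to zero
along all oriented cycles. -/
theorem exists_potential_iff {ψ : Γ.Dart → ℝ} (hψ : ∀ d, ψ (Dart.rev d) = -ψ d) :
    (∀ γ : Γ.OrientedCycle, ∑ i, ψ (γ.dart i) = 0) ↔
      ∃ F : Γ.V → ℝ, ∀ d, ψ d = F (Γ.target d) - F (Γ.source d) := by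
  constructor
  · intro h
    have hc : ∀ {u : Γ.V} {l : List Γ.Dart}, Γ.IsWalk u l u → (l.map ψ).sum = 0 := by
      intro u l hl
      refine closedWalk_induction (M := fun l => (l.map ψ).sum = 0) (by simp) ?_ ?_ ?_ hl
      · intro γ
        rw [List.map_ofFn, List.sum_ofFn]
        exact h γ
      · intro d
        simp [hψ]
      · intro l₁ m l₂ h1 h2
        simp only [List.map_append, List.sum_append] at h1 ⊢
        rw [h2, add_zero, h1]
    -- The potential at `v` is the integral of `ψ` along a chosen walk to `v` from a fixed
    -- representative of its component. Vanishing on closed walks makes its differences equal to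
    -- `ψ`.
    choose w hw using fun v : Γ.V =>
      exists_isWalk_of_quot (Quot.out_eq (Quot.mk Γ.Adj v))
    have hrev : ∀ l : List Γ.Dart, ((l.reverse.map Dart.rev).map ψ).sum = -(l.map ψ).sum := by
      intro l
      induction l with
      | nil => simp
      | cons d l ih =>
        rw [List.reverse_cons, List.map_append, List.map_append, List.sum_append, ih]
        simp [hψ]
    refine ⟨fun v => ((w v).map ψ).sum, fun d => ?_⟩
    have hq : Quot.mk Γ.Adj (Γ.source d) = Quot.mk Γ.Adj (Γ.target d) :=
      Quot.sound ⟨d, rfl, rfl⟩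
    have h1 := hw (Γ.source d)
    have h2 := hw (Γ.target d)
    rw [hq] at h1
    have h0 : Γ.IsWalk (Γ.source d) [d] (Γ.target d) := ⟨rfl, rfl⟩
    have h3 := hc (isWalk_append.2 ⟨_, h1, isWalk_append.2 ⟨_, h0, isWalk_reverse h2⟩⟩)
    rw [List.map_append, List.sum_append, List.map_append, List.sum_append, hrev] at h3
    simp only [List.map_cons, List.map_nil, List.sum_cons, List.sum_nil] at h3
    linarith
  · rintro ⟨F, hF⟩ γ
    simp only [hF]
    exact γ.sum_sub F

namespace Flow

variable (φ : Γ.Flow)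

theorem val_rev (d : Γ.Dart) : φ.val (Dart.rev d) = -φ.val d := φ.antisymm d.1 d.2

/-- The height differences sum to zero around a cycle. If the flow is nonnegative they are all
nonnegative, hence zero, which excludes positive flow. -/
theorem acyclic_of_height {h : Γ.V → ℝ}
    (hpos : ∀ d, 0 < φ.val d → h (Γ.source d) < h (Γ.target d))
    (hzero : ∀ d, φ.val d = 0 → h (Γ.source d) = h (Γ.target d)) : φ.Acyclic := by
  intro γ hγ i
  by_contra hi
  have h0 := γ.sum_sub h
  have h1 : ∀ j ∈ Finset.univ, 0 ≤ h (Γ.target (γ.dart j)) - h (Γ.source (γ.dart j)) := by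
    intro j _
    rcases (hγ j).lt_or_eq with hj | hj
    · exact sub_nonneg.2 (hpos _ hj).le
    · exact sub_nonneg.2 (hzero _ hj.symm).le
  have h2 := (Finset.sum_eq_zero_iff_of_nonneg h1).1 h0 i (Finset.mem_univ i)
  have h3 := hpos _ (lt_of_le_of_ne (hγ i) (Ne.symm hi))
  linarith

/-- The height of `v` counts the vertices from which `v` can be reached along nonnegative flow. It
is weakly increasing along such edges, and an edge of zero flow can be used both ways. Along
positive flow the target is new in the set: a way back to the source would close up to a closed walk
with nonnegative, somewhere positive flow. -/
theorem Acyclic.exists_height {φ : Γ.Flow} (hφ : φ.Acyclic) :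
    ∃ h : Γ.V → ℝ, (∀ d, 0 < φ.val d → h (Γ.source d) < h (Γ.target d)) ∧
      ∀ d, φ.val d = 0 → h (Γ.source d) = h (Γ.target d) := by
  classical
  let R : Γ.V → Γ.V → Prop :=
    Relation.ReflTransGen fun a b => ∃ d, 0 ≤ φ.val d ∧ Γ.source d = a ∧ Γ.target d = b
  have hc : ∀ {u : Γ.V} {l : List Γ.Dart}, Γ.IsWalk u l u →
      (∀ d ∈ l, 0 ≤ φ.val d) → ∀ d ∈ l, φ.val d = 0 := by
    intro u l hl
    refine closedWalk_induction
      (M := fun l => (∀ d ∈ l, 0 ≤ φ.val d) → ∀ d ∈ l, φ.val d = 0) (by simp) ?_ ?_ ?_ hl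
    · intro γ h d hd
      obtain ⟨i, rfl⟩ := (List.mem_ofFn' _ _).1 hd
      exact hφ γ (fun j => h _ ((List.mem_ofFn' _ _).2 ⟨j, rfl⟩)) i
    · intro d h d' hd'
      have h1 := h d (by simp)
      have h2 := h (Dart.rev d) (by simp)
      rw [φ.val_rev] at h2
      have h3 : φ.val d = 0 := by omega
      simp only [List.mem_cons, List.not_mem_nil, or_false] at hd'
      rcases hd' with rfl | rfl
      · exact h3
      · rw [φ.val_rev, h3, neg_zero]
    · intro l₁ m l₂ h1 h2 h d hd
      simp only [List.mem_append] at h1 h hd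
      rcases hd with (hd | hd) | hd
      · exact h1 (fun d' hd' => h d' (by tauto)) d (Or.inl hd)
      · exact h2 (fun d' hd' => h d' (by tauto)) d hd
      · exact h1 (fun d' hd' => h d' (by tauto)) d (Or.inr hd)
  let r : Γ.V → Finset Γ.V := fun v => Finset.univ.filter fun u => R u v
  have hmono : ∀ d, 0 ≤ φ.val d → r (Γ.source d) ⊆ r (Γ.target d) := by
    intro d hd u hu
    simp only [r, Finset.mem_filter, Finset.mem_univ, true_and] at hu ⊢
    exact hu.tail ⟨d, hd, rfl, rfl⟩
  refine ⟨fun v => ((r v).card : ℝ), fun d hd => ?_, fun d hd => ?_⟩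
  · have : r (Γ.source d) ⊂ r (Γ.target d) := by
      refine (Finset.ssubset_iff_of_subset (hmono d hd.le)).2 ⟨Γ.target d, ?_, ?_⟩
      · simp only [r, Finset.mem_filter, Finset.mem_univ, true_and]
        exact Relation.ReflTransGen.refl
      · simp only [r, Finset.mem_filter, Finset.mem_univ, true_and]
        intro hR
        obtain ⟨l, hl, hl'⟩ := exists_isWalk_of_reflTransGen hR
        have := hc (l := d :: l) (u := Γ.source d) ⟨rfl, hl⟩ (by
          intro d' hd'
          rcases List.mem_cons.1 hd' with rfl | h
          · exact hd.le
          · exact hl' _ h) d (by simp)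
        omega
    exact Nat.cast_lt.2 (Finset.card_lt_card this)
  · have h1 := hmono d hd.ge
    have h2 := hmono (Dart.rev d) (by rw [φ.val_rev, hd, neg_zero])
    rw [target_rev, source_rev] at h2
    simp only [Finset.Subset.antisymm h1 h2]

end Flow

end Walks

end LegGraph

/-! ### Calculus of specializations -/

open Set Filter Topology

namespace LegGraph

variable {n : ℕ}

section Sums

variable {Γ Γ' : LegGraph n}

theorem sum_dart_eq (Γ : LegGraph n) {M : Type*} [AddCommMonoid M] (g : Γ.Dart → M) :
    ∑ d, g d = ∑ e, (g (e, false) + g (e, true)) := by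
  rw [Fintype.sum_prod_type]
  refine Finset.sum_congr rfl fun e _ => ?_
  rw [Fintype.sum_bool, add_comm]

theorem sum_dart_rev {M : Type*} [AddCommMonoid M] (g : Γ.Dart → M) :
    ∑ d, g (Dart.rev d) = ∑ d, g d := by
  rw [sum_dart_eq, sum_dart_eq]
  exact Finset.sum_congr rfl fun e _ => add_comm _ _

/-- A sum over oriented edges, split into the edges in the image of an injection and the others. -/
theorem sum_dart_of_injective {M : Type*} [AddCommMonoid M] {emap : Γ'.E → Γ.E}
    (hinj : Function.Injective emap) (flip : Γ'.E → Bool) (g : Γ.Dart → M) :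
    ∑ d, g d = ∑ d : Γ'.Dart, g (emap d.1, xor d.2 (flip d.1)) +
      ∑ e ∈ Finset.univ.filter fun e => ∀ e', emap e' ≠ e, (g (e, false) + g (e, true)) := by
  rw [sum_dart_eq, sum_dart_eq,
    ← Finset.sum_filter_not_add_sum_filter Finset.univ fun e => ∀ e', emap e' ≠ e]
  congr 1
  have : (Finset.univ.filter fun e => ¬ ∀ e', emap e' ≠ e) = Finset.univ.image emap := by
    ext e
    simp
  rw [this, Finset.sum_image fun _ _ _ _ h => hinj h]
  refine Finset.sum_congr rfl fun e _ => ?_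
  cases flip e
  · simp
  · simp [add_comm]

theorem sum_fiber_fiber {α β γ M : Type*} [Fintype α] [Fintype β] [DecidableEq β]
    [DecidableEq γ] [AddCommMonoid M] (p : α → β) (q : β → γ) (D : α → M) (c : γ) :
    ∑ b ∈ Finset.univ.filter fun b => q b = c, ∑ a ∈ Finset.univ.filter fun a => p a = b, D a =
      ∑ a ∈ Finset.univ.filter fun a => q (p a) = c, D a := by
  simp only [Finset.sum_filter]
  have : ∀ b, (if q b = c then ∑ a, (if p a = b then D a else 0) else 0) =
      ∑ a, if p a = b then (if q (p a) = c then D a else 0) else 0 := by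
    intro b
    split_ifs with h
    · refine Finset.sum_congr rfl fun a _ => ?_
      split_ifs with h1 h2
      · rfl
      · exact absurd (h1 ▸ h) h2
      · rfl
    · refine (Finset.sum_eq_zero fun a _ => ?_).symm
      split_ifs with h1 h2
      · exact absurd (h1 ▸ h2) h
      · rfl
      · rfl
  simp only [this]
  rw [Finset.sum_comm]
  simp

theorem sum_filter_sum_ite {α β M : Type*} [Fintype α] [Fintype β] [DecidableEq β]
    [AddCommMonoid M] (P : β → Prop) [DecidablePred P] (s : α → β) (g : α → M) :
    ∑ b ∈ Finset.univ.filter P, ∑ a, (if s a = b then g a else 0) =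
      ∑ a, if P (s a) then g a else 0 := by
  rw [Finset.sum_comm]
  refine Finset.sum_congr rfl fun a _ => ?_
  rw [Finset.sum_ite_eq]
  simp

theorem degIn_eq_sum (Γ : LegGraph n) (S : Finset Γ.E) (v : Γ.V) :
    Γ.degIn S v = ∑ d : Γ.Dart, if Γ.source d = v then (if d.1 ∈ S then 1 else 0) else 0 := by
  rw [degIn, Finset.card_filter]
  refine Finset.sum_congr rfl fun d _ => ?_
  by_cases h1 : Γ.source d = v <;> by_cases h2 : d.1 ∈ S <;> simp [h1, h2]

theorem degIn_eq_sum_int (Γ : LegGraph n) (S : Finset Γ.E) (v : Γ.V) : (Γ.degIn S v : ℤ) =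
    ∑ d : Γ.Dart, if Γ.source d = v then (if d.1 ∈ S then 1 else 0) else 0 := by
  rw [degIn_eq_sum]
  push_cast
  rfl

/-- A contracted edge has both ends in the same fiber, where it is counted twice in the degrees. -/
theorem sum_deg_fiber {vmap : Γ.V → Γ'.V} {emap : Γ'.E → Γ.E} {flip : Γ'.E → Bool}
    (hinj : Function.Injective emap)
    (hends : ∀ e b, vmap (Γ.ends (emap e) (xor b (flip e))) = Γ'.ends e b)
    (hcon : ∀ e, (∀ e', emap e' ≠ e) → vmap (Γ.ends e false) = vmap (Γ.ends e true)) (v' : Γ'.V) :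
    ∑ v ∈ Finset.univ.filter fun v => vmap v = v', Γ.deg v = Γ'.deg v' +
      2 * (Finset.univ.filter fun e => (∀ e', emap e' ≠ e) ∧ vmap (Γ.ends e false) = v').card := by
  simp only [deg, degIn_eq_sum]
  rw [sum_filter_sum_ite, sum_dart_of_injective hinj flip]
  congr 1
  · refine Finset.sum_congr rfl fun d _ => ?_
    have : vmap (Γ.source (emap d.1, xor d.2 (flip d.1))) = Γ'.source d := hends _ _
    rw [this]
    simp
  · rw [Finset.card_eq_sum_ones, Finset.mul_sum, ← Finset.filter_filter,
      Finset.sum_filter fun e => vmap (Γ.ends e false) = v']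
    refine Finset.sum_congr rfl fun e he => ?_
    have h := hcon e (Finset.mem_filter.1 he).2
    simp only [source, ← h]
    split_ifs with hv <;> simp [hv]

end Sums

/-- Reachability along oriented edges satisfying a predicate. -/
def Reach (Γ : LegGraph n) (R : Γ.Dart → Prop) : Γ.V → Γ.V → Prop :=
  Relation.ReflTransGen fun a b => ∃ d, R d ∧ Γ.source d = a ∧ Γ.target d = b

theorem Reach.mono {Γ : LegGraph n} {R R' : Γ.Dart → Prop} (h : ∀ d, R d → R' d) {u v : Γ.V}
    (huv : Γ.Reach R u v) : Γ.Reach R' u v :=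
  Relation.ReflTransGen.mono (fun _ _ ⟨d, hd, h1, h2⟩ => ⟨d, h d hd, h1, h2⟩) _ _ huv

theorem Reach.single {Γ : LegGraph n} {R : Γ.Dart → Prop} {d : Γ.Dart} (h : R d) :
    Γ.Reach R (Γ.source d) (Γ.target d) :=
  Relation.ReflTransGen.single ⟨d, h, rfl, rfl⟩

theorem Reach.invariant {Γ : LegGraph n} {R : Γ.Dart → Prop} {u v : Γ.V} {p : Γ.V → Prop}
    (hp : ∀ d, R d → p (Γ.source d) → p (Γ.target d)) (h : Γ.Reach R u v) (hu : p u) : p v := by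
  induction h with
  | refl => exact hu
  | tail _ hs ih =>
    obtain ⟨d, hd, rfl, rfl⟩ := hs
    exact hp d hd ih

/-- A potential for the one-cochain `φ · x`. -/
def IsPotential (Γ : LegGraph n) (φ : Γ.Flow) (x : Γ.E → ℝ) (F : Γ.V → ℝ) : Prop :=
  ∀ d : Γ.Dart, (φ.val d : ℝ) * x d.1 = F (Γ.target d) - F (Γ.source d)

@[ext] theorem Flow.ext {Γ : LegGraph n} {φ φ' : Γ.Flow} (h : ∀ d, φ.val d = φ'.val d) :
    φ = φ' := by
  cases φ
  cases φ'
  congr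
  exact funext h

/-- With positive lengths, the potential is itself a height function for the flow. -/
theorem IsPotential.acyclic {Γ : LegGraph n} {φ : Γ.Flow} {x : Γ.E → ℝ} {F : Γ.V → ℝ}
    (h : Γ.IsPotential φ x F) (hx : ∀ e, 0 < x e) : φ.Acyclic := by
  refine φ.acyclic_of_height (h := F) (fun d hd => ?_) fun d hd => ?_
  · have h1 := h d
    have : (0 : ℝ) < φ.val d * x d.1 := mul_pos (Int.cast_pos.2 hd) (hx _)
    linarith
  · have h1 := h d
    rw [hd, Int.cast_zero, zero_mul] at h1
    linarith

namespace Specialization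

variable {Γ Γ' Γ'' : LegGraph n}

/-- The weight condition on a specialization amounts to compatibility of canonical divisors. The
latter is additive over fibers, so it is the form used to construct compositions, factorizations and
lifts. -/
theorem sum_canonicalDivisor_iff {vmap : Γ.V → Γ'.V} {emap : Γ'.E → Γ.E} {flip : Γ'.E → Bool}
    (hinj : Function.Injective emap)
    (hends : ∀ e b, vmap (Γ.ends (emap e) (xor b (flip e))) = Γ'.ends e b)
    (hcon : ∀ e, (∀ e', emap e' ≠ e) → vmap (Γ.ends e false) = vmap (Γ.ends e true)) (v' : Γ'.V) :
    Γ'.canonicalDivisor v' =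
        ∑ v ∈ Finset.univ.filter fun v => vmap v = v', Γ.canonicalDivisor v ↔
      Γ'.weight v' + (Finset.univ.filter fun v => vmap v = v').card =
        (∑ v ∈ Finset.univ.filter fun v => vmap v = v', Γ.weight v) +
        (Finset.univ.filter fun e => (∀ e', emap e' ≠ e) ∧ vmap (Γ.ends e false) = v').card + 1 := by
  have h := sum_deg_fiber hinj hends hcon v'
  zify at h ⊢
  simp only [canonicalDivisor, Finset.sum_add_distrib, Finset.sum_sub_distrib, Finset.sum_const,
    ← Finset.mul_sum, h, nsmul_eq_mul]
  constructor <;> intro h <;> linarith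

/-- The condition on weights can be replaced by the compatibility of canonical divisors. -/
def mkOfCanonical (vmap : Γ.V → Γ'.V) (emap : Γ'.E → Γ.E) (flip : Γ'.E → Bool)
    (vmap_surj : Function.Surjective vmap) (emap_inj : Function.Injective emap)
    (map_ends : ∀ e b, vmap (Γ.ends (emap e) (xor b (flip e))) = Γ'.ends e b)
    (map_contracted : ∀ e, (∀ e', emap e' ≠ e) → vmap (Γ.ends e false) = vmap (Γ.ends e true))
    (fiber_connected : ∀ u v, vmap u = vmap v → Γ.Reach (fun d => ∀ e', emap e' ≠ d.1) u v)
    (canonical : ∀ v', Γ'.canonicalDivisor v' =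
        ∑ v ∈ Finset.univ.filter fun v => vmap v = v', Γ.canonicalDivisor v)
    (map_leg : ∀ i, vmap (Γ.leg i) = Γ'.leg i) : Specialization Γ Γ' where
  vmap := vmap
  emap := emap
  flip := flip
  vmap_surj := vmap_surj
  emap_inj := emap_inj
  map_ends := map_ends
  map_contracted := map_contracted
  fiber_connected := fiber_connected
  map_weight := fun v' =>
    (sum_canonicalDivisor_iff emap_inj map_ends map_contracted v').1 (canonical v')
  map_leg := map_leg

variable (f : Specialization Γ Γ')

theorem push_canonicalDivisor : f.pushDivisor Γ.canonicalDivisor = Γ'.canonicalDivisor :=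
  funext fun v' => ((sum_canonicalDivisor_iff f.emap_inj f.map_ends f.map_contracted v').2
    (f.map_weight v')).symm

theorem vmap_source (d : Γ'.Dart) : f.vmap (Γ.source (f.dart d)) = Γ'.source d :=
  f.map_ends d.1 d.2

theorem dart_rev (d : Γ'.Dart) : f.dart (Dart.rev d) = Dart.rev (f.dart d) := by
  simp [dart, Dart.rev]

theorem vmap_target (d : Γ'.Dart) : f.vmap (Γ.target (f.dart d)) = Γ'.target d := by
  rw [← source_rev, ← dart_rev, vmap_source, source_rev]

theorem exists_dart_or (d : Γ.Dart) : (∃ d', f.dart d' = d) ∨ ∀ e', f.emap e' ≠ d.1 := by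
  by_cases h : ∃ e', f.emap e' = d.1
  · obtain ⟨e', he⟩ := h
    exact Or.inl ⟨(e', xor d.2 (f.flip e')), Prod.ext he (by simp [dart])⟩
  · exact Or.inr fun e' he => h ⟨e', he⟩

theorem vmap_eq_of_contracted (d : Γ.Dart) (h : ∀ e', f.emap e' ≠ d.1) :
    f.vmap (Γ.source d) = f.vmap (Γ.target d) := by
  have := f.map_contracted d.1 h
  obtain ⟨e, b⟩ := d
  cases b
  · exact this
  · exact this.symm

theorem incl_emap (x : Γ'.E → ℝ) (e : Γ'.E) : f.incl x (f.emap e) = x e :=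
  f.emap_inj.extend_apply x 0 e

theorem incl_contracted (x : Γ'.E → ℝ) {e : Γ.E} (h : ∀ e', f.emap e' ≠ e) : f.incl x e = 0 :=
  Function.extend_apply' _ _ _ fun ⟨e', he⟩ => h e' he

theorem incl_nonneg {x : Γ'.E → ℝ} (hx : ∀ e, 0 ≤ x e) (e : Γ.E) : 0 ≤ f.incl x e := by
  by_cases h : ∃ e', f.emap e' = e
  · obtain ⟨e', rfl⟩ := h
    rw [incl_emap]
    exact hx e'
  · rw [incl_contracted f x fun e' he => h ⟨e', he⟩]

theorem incl_injective : Function.Injective f.incl := fun x y h => by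
  funext e
  rw [← f.incl_emap x, h, f.incl_emap]

theorem reach_map {R : Γ.Dart → Prop} {R' : Γ'.Dart → Prop}
    (h : ∀ d, R d → f.vmap (Γ.source d) = f.vmap (Γ.target d) ∨
      ∃ d', R' d' ∧ Γ'.source d' = f.vmap (Γ.source d) ∧ Γ'.target d' = f.vmap (Γ.target d))
    {u v : Γ.V} (huv : Γ.Reach R u v) : Γ'.Reach R' (f.vmap u) (f.vmap v) := by
  induction huv with
  | refl => exact Relation.ReflTransGen.refl
  | tail _ hs ih =>
    obtain ⟨d, hd, rfl, rfl⟩ := hs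
    rcases h d hd with h | ⟨d', h1, h2, h3⟩
    · exact h ▸ ih
    · exact ih.tail ⟨d', h1, h2, h3⟩

/-- Consecutive lifted edges need not be composable, but the gap lies in one fiber and is bridged by
contracted edges. -/
theorem reach_lift {R : Γ.Dart → Prop} {R' : Γ'.Dart → Prop}
    (hc : ∀ d : Γ.Dart, (∀ e', f.emap e' ≠ d.1) → R d) (hR : ∀ d', R' d' → R (f.dart d'))
    {u v : Γ.V} (h : Γ'.Reach R' (f.vmap u) (f.vmap v)) : Γ.Reach R u v := by
  suffices ∀ a, Γ'.Reach R' (f.vmap u) a → ∀ v, f.vmap v = a → Γ.Reach R u v from this _ h v rfl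
  intro a ha
  induction ha with
  | refl => exact fun v hv => Reach.mono hc (f.fiber_connected u v hv.symm)
  | tail _ hs ih =>
    intro v hv
    obtain ⟨d, hd, rfl, rfl⟩ := hs
    have h1 := ih _ (f.vmap_source d)
    have h2 : Γ.Reach R _ v := Reach.mono hc (f.fiber_connected (Γ.target (f.dart d)) v
      (by rw [vmap_target, hv]))
    exact (h1.trans (Reach.single (hR d hd))).trans h2

theorem push_div (φ : Γ.Flow) : f.pushDivisor φ.div = (f.pushFlow φ).div := by
  funext v'
  simp only [pushDivisor, Flow.div]
  rw [sum_filter_sum_ite, sum_dart_of_injective f.emap_inj f.flip,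
    Finset.sum_eq_zero (s := Finset.filter _ _), add_zero]
  · refine Finset.sum_congr rfl fun d _ => ?_
    have : f.vmap (Γ.target (f.emap d.1, xor d.2 (f.flip d.1))) = Γ'.target d := f.vmap_target d
    rw [this]
    rfl
  · intro e he
    have h := f.map_contracted e (Finset.mem_filter.1 he).2
    have h2 : φ.val (e, true) = -φ.val (e, false) := φ.antisymm e false
    simp only [target, Bool.not_true, Bool.not_false, h, h2]
    split_ifs <;> simp

theorem pushDivisor_add (D D' : Γ.V → ℤ) :
    f.pushDivisor (fun v => D v + D' v) = fun v => f.pushDivisor D v + f.pushDivisor D' v :=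
  funext fun _ => Finset.sum_add_distrib

theorem pushDivisor_const_mul (c : ℤ) (D : Γ.V → ℤ) :
    f.pushDivisor (fun v => c * D v) = fun v => c * f.pushDivisor D v :=
  funext fun _ => (Finset.mul_sum _ _ _).symm

/-- The composition of two specializations. -/
def comp (f : Specialization Γ Γ') (g : Specialization Γ' Γ'') : Specialization Γ Γ'' :=
  mkOfCanonical (fun v => g.vmap (f.vmap v)) (fun e => f.emap (g.emap e))
    (fun e => xor (g.flip e) (f.flip (g.emap e)))
    (g.vmap_surj.comp f.vmap_surj) (f.emap_inj.comp g.emap_inj)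
    (fun e b => by rw [← Bool.xor_assoc, f.map_ends, g.map_ends])
    (fun e he => by
      rcases f.exists_dart_or (e, false) with ⟨d, hd⟩ | h
      · have h1 := f.vmap_source d
        have h2 := f.vmap_target d
        rw [hd] at h1 h2
        change f.vmap (Γ.ends e false) = _ at h1
        change f.vmap (Γ.ends e true) = _ at h2
        rw [h1, h2]
        refine g.vmap_eq_of_contracted d fun e' he' => he e' ?_
        rw [he']
        exact congrArg Prod.fst hd
      · rw [f.map_contracted e h])
    (fun u v huv => f.reach_lift (fun d hd e' => hd _)
      (fun d hd e' he => hd e' (f.emap_inj he)) (g.fiber_connected _ _ huv))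
    (fun v => by
      rw [← g.push_canonicalDivisor, ← f.push_canonicalDivisor]
      exact sum_fiber_fiber f.vmap g.vmap _ v)
    (fun i => by rw [f.map_leg, g.map_leg])

theorem comp_dart (g : Specialization Γ' Γ'') (d : Γ''.Dart) :
    (f.comp g).dart d = f.dart (g.dart d) :=
  Prod.ext rfl (Bool.xor_assoc _ _ _).symm

theorem comp_incl (g : Specialization Γ' Γ'') (x : Γ''.E → ℝ) :
    (f.comp g).incl x = f.incl (g.incl x) := by
  funext e
  by_cases h : ∃ e', f.emap e' = e
  · obtain ⟨e', rfl⟩ := h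
    rw [f.incl_emap]
    by_cases h : ∃ e'', g.emap e'' = e'
    · obtain ⟨e'', rfl⟩ := h
      rw [g.incl_emap]
      exact (f.comp g).incl_emap x e''
    · rw [g.incl_contracted _ fun e'' he => h ⟨e'', he⟩]
      exact (f.comp g).incl_contracted x fun e'' he => h ⟨e'', f.emap_inj he⟩
  · rw [f.incl_contracted _ fun e' he => h ⟨e', he⟩]
    exact (f.comp g).incl_contracted x fun e'' he => h ⟨_, he⟩

theorem comp_pushDivisor (g : Specialization Γ' Γ'') (D : Γ.V → ℤ) :
    (f.comp g).pushDivisor D = g.pushDivisor (f.pushDivisor D) :=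
  funext fun v => (sum_fiber_fiber f.vmap g.vmap D v).symm

theorem comp_pushFlow (g : Specialization Γ' Γ'') (φ : Γ.Flow) :
    (f.comp g).pushFlow φ = g.pushFlow (f.pushFlow φ) :=
  Flow.ext fun d => congrArg φ.val (f.comp_dart g d)

/-- If fewer edges are contracted by `g` than by `f`, then `f` factors through `g`. -/
theorem exists_factor (f : Specialization Γ Γ') (g : Specialization Γ Γ'')
    (h : ∀ e, ∃ e', g.emap e' = f.emap e) :
    ∃ k : Specialization Γ'' Γ', (∀ v, k.vmap (g.vmap v) = f.vmap v) ∧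
      ∀ d, g.dart (k.dart d) = f.dart d := by
  choose em hem using h
  choose s hs using g.vmap_surj
  have hc : ∀ e, (∀ e', g.emap e' ≠ e) → ∀ e', f.emap e' ≠ e := fun e he e' he' =>
    he (em e') ((hem e').trans he')
  -- What `g` contracts is also contracted by `f`, so `f` is constant on the fibers of `g` and
  -- descends along any section of `g`.
  have hk : ∀ u v, g.vmap u = g.vmap v → f.vmap u = f.vmap v := by
    intro u v huv
    refine Reach.invariant (p := fun w => f.vmap u = f.vmap w) (fun d hd hu => ?_)
      (g.fiber_connected u v huv) rfl
    rw [hu, f.vmap_eq_of_contracted d (hc _ hd)]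
  have hv : ∀ v, f.vmap (s (g.vmap v)) = f.vmap v := fun v => hk _ _ (hs _)
  have hdart : ∀ e b, g.dart (em e, xor b (xor (f.flip e) (g.flip (em e)))) = f.dart (e, b) := by
    intro e b
    refine Prod.ext (hem e) ?_
    simp [dart]
  have hends : ∀ e b, f.vmap (s (Γ''.ends (em e) (xor b (xor (f.flip e) (g.flip (em e)))))) =
      Γ'.ends e b := by
    intro e b
    have h1 := g.vmap_source (em e, xor b (xor (f.flip e) (g.flip (em e))))
    have h2 := f.vmap_source (e, b)
    rw [hdart] at h1
    change _ = Γ''.ends (em e) _ at h1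
    rw [← h1, hv]
    exact h2
  refine ⟨mkOfCanonical (fun v => f.vmap (s v)) em (fun e => xor (f.flip e) (g.flip (em e)))
    ?_ ?_ hends ?_ ?_ ?_ ?_, hv, fun d => hdart d.1 d.2⟩
  · intro v'
    obtain ⟨v, rfl⟩ := f.vmap_surj v'
    exact ⟨g.vmap v, hv v⟩
  · intro e e' hee
    apply f.emap_inj
    rw [← hem, ← hem, hee]
  · intro e he
    have h1 := g.vmap_source (e, false)
    have h2 := g.vmap_target (e, false)
    change _ = Γ''.ends e false at h1
    change _ = Γ''.ends e true at h2
    rw [← h1, ← h2, hv, hv]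
    exact f.vmap_eq_of_contracted _ fun e' he' => he e' (g.emap_inj ((hem e').trans he'))
  · intro u v huv
    rw [← hs u, ← hs v]
    refine g.reach_map (fun d hd => ?_) (f.fiber_connected _ _ huv)
    rcases g.exists_dart_or d with ⟨d', rfl⟩ | h
    · exact Or.inr ⟨d', fun e' he' => hd e' ((hem e').symm.trans (congrArg g.emap he')),
        (g.vmap_source d').symm, (g.vmap_target d').symm⟩
    · exact Or.inl (g.vmap_eq_of_contracted d h)
  · intro v'
    rw [← f.push_canonicalDivisor, ← g.push_canonicalDivisor]
    have := sum_fiber_fiber g.vmap (fun v => f.vmap (s v)) Γ.canonicalDivisor v'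
    simp only [hv] at this
    exact this.symm
  · intro i
    rw [← g.map_leg, hv, f.map_leg]

/-- A vector extended by zero forces every potential to be constant on the fibers, so potentials
upstairs and downstairs correspond. This is why cones of specializations are faces. -/
theorem exists_isPotential_iff (φ : Γ.Flow) (x : Γ'.E → ℝ) :
    (∃ F, Γ.IsPotential φ (f.incl x) F) ↔ ∃ F, Γ'.IsPotential (f.pushFlow φ) x F := by
  constructor
  · rintro ⟨F, hF⟩
    have hk : ∀ u v, f.vmap u = f.vmap v → F u = F v := by
      intro u v huv
      refine Reach.invariant (p := fun w => F u = F w) (fun d hd hu => ?_)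
        (f.fiber_connected u v huv) rfl
      have := hF d
      rw [f.incl_contracted x hd, mul_zero] at this
      linarith
    choose s hs using f.vmap_surj
    refine ⟨fun v => F (s v), fun d => ?_⟩
    have h1 := hF (f.dart d)
    change _ = F (s _) - F (s _)
    rw [← f.vmap_source d, ← f.vmap_target d, hk _ _ (hs _), hk _ _ (hs _), ← h1]
    exact congrArg _ (f.incl_emap x d.1).symm
  · rintro ⟨F, hF⟩
    refine ⟨fun v => F (f.vmap v), fun d => ?_⟩
    rcases f.exists_dart_or d with ⟨d, rfl⟩ | h
    · simp only [vmap_source, vmap_target, ← hF d]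
      exact congrArg _ (f.incl_emap x d.1)
    · change _ = F (f.vmap _) - F (f.vmap _)
      rw [f.incl_contracted x h, f.vmap_eq_of_contracted d h, mul_zero, sub_self]

end Specialization

end LegGraph

/-! ### Subdivisions and the specializations between them -/

open Set Filter Topology

noncomputable section

namespace LegGraph

variable {n : ℕ}

theorem sum_subtype_eq_sum_dite {α M : Type*} [Fintype α] [AddCommMonoid M] {p : α → Prop}
    [DecidablePred p] [Fintype {x // p x}] (g : {x // p x} → M) :
    ∑ x, g x = ∑ x, if h : p x then g ⟨x, h⟩ else 0 := by
  rw [← Fintype.sum_subtype_add_sum_subtype p]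
  have : ∑ e : {e // ¬ p e}, (if h : p e.1 then g ⟨e.1, h⟩ else 0) = 0 :=
    Finset.sum_eq_zero fun e _ => dif_neg e.2
  rw [this, add_zero]
  refine Finset.sum_congr (by ext; simp) fun e _ => ?_
  rw [dif_pos e.2]

section Subdivide

variable {Γ : LegGraph n} {S : Finset Γ.E}

/-- The vertices of `Γ` as vertices of `Γ^S`. -/
def vtx (S : Finset Γ.E) (v : Γ.V) : (Γ.subdivide S).V := Sum.inl v

/-- The exceptional vertices of `Γ^S`. -/
def exc (e : Γ.E) (h : e ∈ S) : (Γ.subdivide S).V := Sum.inr ⟨e, h⟩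

/-- The edges of `Γ` outside `S` as edges of `Γ^S`. -/
def keep (e : Γ.E) (h : e ∉ S) : (Γ.subdivide S).E := Sum.inl ⟨e, h⟩

/-- The half-edge of `e ∈ S` at the end `b`. -/
def half (e : Γ.E) (h : e ∈ S) (b : Bool) : (Γ.subdivide S).E := Sum.inr (⟨e, h⟩, b)

theorem vtx_or_exc (x : (Γ.subdivide S).V) : (∃ v, x = vtx S v) ∨ ∃ e h, x = exc e h := by
  rcases x with v | e
  · exact Or.inl ⟨v, rfl⟩
  · exact Or.inr ⟨e.1, e.2, rfl⟩

theorem keep_or_half (x : (Γ.subdivide S).E) :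
    (∃ e h, x = keep e h) ∨ ∃ e h b, x = half e h b := by
  rcases x with e | ⟨e, b⟩
  · exact Or.inl ⟨e.1, e.2, rfl⟩
  · exact Or.inr ⟨e.1, e.2, b, rfl⟩

@[simp] theorem vtx_inj {u v : Γ.V} : vtx S u = vtx S v ↔ u = v := Sum.inl_injective.eq_iff

@[simp] theorem exc_inj {e e' : Γ.E} {h : e ∈ S} {h' : e' ∈ S} : exc e h = exc e' h' ↔ e = e' :=
  ⟨fun he => congrArg Subtype.val (Sum.inr.inj he), fun he => by subst he; rfl⟩

@[simp] theorem vtx_ne_exc {v : Γ.V} {e : Γ.E} {h : e ∈ S} : vtx S v ≠ exc e h := Sum.inl_ne_inr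

@[simp] theorem exc_ne_vtx {v : Γ.V} {e : Γ.E} {h : e ∈ S} : exc e h ≠ vtx S v := Sum.inr_ne_inl

@[simp] theorem half_inj {e e' : Γ.E} {h : e ∈ S} {h' : e' ∈ S} {b b' : Bool} :
    half e h b = half e' h' b' ↔ e = e' ∧ b = b' :=
  ⟨fun he => ⟨congrArg (fun p => p.1.1) (Sum.inr.inj he), congrArg Prod.snd (Sum.inr.inj he)⟩,
    fun ⟨he, hb⟩ => by subst he hb; rfl⟩

@[simp] theorem subdivide_ends_keep (e : Γ.E) (h : e ∉ S) (b : Bool) :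
    (Γ.subdivide S).ends (keep e h) b = vtx S (Γ.ends e b) := rfl

@[simp] theorem subdivide_ends_half_false (e : Γ.E) (h : e ∈ S) (b : Bool) :
    (Γ.subdivide S).ends (half e h b) false = vtx S (Γ.ends e b) := rfl

@[simp] theorem subdivide_ends_half_true (e : Γ.E) (h : e ∈ S) (b : Bool) :
    (Γ.subdivide S).ends (half e h b) true = exc e h := rfl

@[simp] theorem edgeOver_keep (e : Γ.E) (h : e ∉ S) : Γ.edgeOver S (keep e h) = e := rfl

@[simp] theorem edgeOver_half (e : Γ.E) (h : e ∈ S) (b : Bool) :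
    Γ.edgeOver S (half e h b) = e := rfl

variable (S)

/-- Definition of functions on the vertices of `Γ^S`. -/
def elimV {α : Type*} (f : Γ.V → α) (g : ∀ e ∈ S, α) : (Γ.subdivide S).V → α :=
  Sum.elim f fun e => g e.1 e.2

/-- Definition of functions on the edges of `Γ^S`. -/
def elimE {α : Type*} (f : ∀ e ∉ S, α) (g : ∀ e ∈ S, Bool → α) : (Γ.subdivide S).E → α :=
  Sum.elim (fun e => f e.1 e.2) fun p => g p.1.1 p.1.2 p.2

@[simp] theorem elimV_vtx {α : Type*} (f : Γ.V → α) (g : ∀ e ∈ S, α) (v : Γ.V) :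
    elimV S f g (vtx S v) = f v := rfl

@[simp] theorem elimV_exc {α : Type*} (f : Γ.V → α) (g : ∀ e ∈ S, α) (e : Γ.E) (h : e ∈ S) :
    elimV S f g (exc e h) = g e h := rfl

@[simp] theorem elimE_keep {α : Type*} (f : ∀ e ∉ S, α) (g : ∀ e ∈ S, Bool → α) (e : Γ.E)
    (h : e ∉ S) : elimE S f g (keep e h) = f e h := rfl

@[simp] theorem elimE_half {α : Type*} (f : ∀ e ∉ S, α) (g : ∀ e ∈ S, Bool → α) (e : Γ.E)
    (h : e ∈ S) (b : Bool) : elimE S f g (half e h b) = g e h b := rfl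

theorem sum_subdivide_V {M : Type*} [AddCommMonoid M] (g : (Γ.subdivide S).V → M) :
    ∑ v, g v = ∑ v, g (vtx S v) + ∑ e, if h : e ∈ S then g (exc e h) else 0 := by
  refine (Fintype.sum_sum_type (α₁ := Γ.V) (α₂ := {e // e ∈ S}) g).trans ?_
  congr 1
  exact sum_subtype_eq_sum_dite (p := fun e => e ∈ S) fun e => g (exc e.1 e.2)

theorem sum_subdivide_E {M : Type*} [AddCommMonoid M] (g : (Γ.subdivide S).E → M) :
    ∑ e, g e = ∑ e, if h : e ∈ S then g (half e h false) + g (half e h true)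
      else g (keep e h) := by
  refine (Fintype.sum_sum_type (α₁ := {e // e ∉ S}) (α₂ := {e // e ∈ S} × Bool) g).trans ?_
  have h1 := sum_subtype_eq_sum_dite (p := fun e => e ∉ S) fun e => g (keep e.1 e.2)
  have h2 := sum_subtype_eq_sum_dite (p := fun e => e ∈ S) fun e =>
    g (half e.1 e.2 false) + g (half e.1 e.2 true)
  have h3 : ∑ x : {e // e ∈ S} × Bool, g (Sum.inr x) =
      ∑ e : {e // e ∈ S}, (g (half e.1 e.2 false) + g (half e.1 e.2 true)) := by
    rw [Fintype.sum_prod_type]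
    exact Finset.sum_congr rfl fun e _ => (Fintype.sum_bool _).trans (add_comm _ _)
  refine (congrArg₂ (· + ·) h1 (h3.trans h2)).trans ?_
  rw [← Finset.sum_add_distrib]
  refine Finset.sum_congr rfl fun e _ => ?_
  by_cases h : e ∈ S <;> simp [h]

/-- Sums over the oriented edges of `Γ^S`: an oriented edge `d` in `S` contributes the half-edge
leaving its source, in both orientations. -/
theorem sum_subdivide_dart {M : Type*} [AddCommMonoid M] (g : (Γ.subdivide S).Dart → M) :
    ∑ d, g d = ∑ d : Γ.Dart, if h : d.1 ∈ S then
      g (half d.1 h d.2, false) + g (half d.1 h d.2, true) else g (keep d.1 h, d.2) := by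
  rw [sum_dart_eq, sum_dart_eq, sum_subdivide_E]
  refine Finset.sum_congr rfl fun e _ => ?_
  by_cases h : e ∈ S
  · simp only [dif_pos h]
  · simp only [dif_neg h]

theorem subdivide_deg_vtx (v : Γ.V) : (Γ.subdivide S).deg (vtx S v) = Γ.deg v := by
  simp only [deg, degIn_eq_sum]
  rw [sum_subdivide_dart]
  refine Finset.sum_congr rfl fun d _ => ?_
  split_ifs with h <;> simp_all [source]

theorem subdivide_deg_exc (e : Γ.E) (h : e ∈ S) : (Γ.subdivide S).deg (exc e h) = 2 := by
  simp only [deg, degIn_eq_sum]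
  rw [sum_subdivide_dart, sum_dart_eq, Finset.sum_eq_single_of_mem e (Finset.mem_univ _)]
  · simp [source, h]
  · intro e' _ he
    by_cases h' : e' ∈ S
    · simp [source, h', he]
    · simp [source, h']

theorem subdivide_canonicalDivisor_vtx (v : Γ.V) :
    (Γ.subdivide S).canonicalDivisor (vtx S v) = Γ.canonicalDivisor v := by
  simp only [canonicalDivisor, subdivide_deg_vtx]
  rfl

theorem subdivide_canonicalDivisor_exc (e : Γ.E) (h : e ∈ S) :
    (Γ.subdivide S).canonicalDivisor (exc e h) = 0 := by
  simp only [canonicalDivisor, subdivide_deg_exc]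
  rfl

end Subdivide

namespace Specialization

variable {Γ Γ' : LegGraph n} (f : Specialization Γ Γ') (S : Finset Γ.E) (S' : Finset Γ'.E)
  (c : Γ'.E → Bool)

open Classical in
/-- The vertex map of `liftSubdivide`. -/
def liftVmap : (Γ.subdivide S).V → (Γ'.subdivide S').V :=
  elimV S (fun v => vtx S' (f.vmap v)) fun e _ =>
    if h : ∃ e', f.emap e' = e then
      if h' : h.choose ∈ S' then exc h.choose h'
      else vtx S' (f.vmap (Γ.ends e (xor (c h.choose) (f.flip h.choose))))
    else vtx S' (f.vmap (Γ.ends e false))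

theorem liftVmap_vtx (v : Γ.V) : f.liftVmap S S' c (vtx S v) = vtx S' (f.vmap v) := rfl

theorem liftVmap_exc_of_mem {e' : Γ'.E} (he : f.emap e' ∈ S) (h : e' ∈ S') :
    f.liftVmap S S' c (exc (f.emap e') he) = exc e' h := by
  have h1 : ∃ e'', f.emap e'' = f.emap e' := ⟨e', rfl⟩
  have h2 : h1.choose = e' := f.emap_inj h1.choose_spec
  simp only [liftVmap, elimV_exc, dif_pos h1, h2, dif_pos h]

theorem liftVmap_exc_of_notMem {e' : Γ'.E} (he : f.emap e' ∈ S) (h : e' ∉ S') :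
    f.liftVmap S S' c (exc (f.emap e') he) = vtx S' (Γ'.ends e' (c e')) := by
  have h1 : ∃ e'', f.emap e'' = f.emap e' := ⟨e', rfl⟩
  have h2 : h1.choose = e' := f.emap_inj h1.choose_spec
  have h3 : h1.choose ∉ S' := h2.symm ▸ h
  simp only [liftVmap, elimV_exc, dif_pos h1, dif_neg h3]
  rw [← f.map_ends, h2]

theorem liftVmap_exc_of_contracted {e : Γ.E} (he : e ∈ S) (h : ∀ e', f.emap e' ≠ e) (b : Bool) :
    f.liftVmap S S' c (exc e he) = vtx S' (f.vmap (Γ.ends e b)) := by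
  have h1 : ¬ ∃ e', f.emap e' = e := fun ⟨e', he⟩ => h e' he
  simp only [liftVmap, elimV_exc, dif_neg h1]
  cases b
  · rfl
  · rw [f.map_contracted _ h]

/-- The edge map of `liftSubdivide`. -/
def liftEmap (hS : ∀ e ∈ S', f.emap e ∈ S) : (Γ'.subdivide S').E → (Γ.subdivide S).E :=
  elimE S'
    (fun e _ => if h : f.emap e ∈ S then half (f.emap e) h (xor (!(c e)) (f.flip e))
      else keep (f.emap e) h)
    fun e he b => half (f.emap e) (hS e he) (xor b (f.flip e))

/-- The orientations in `liftSubdivide`. -/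
def liftFlip : (Γ'.subdivide S').E → Bool :=
  elimE S' (fun e _ => if f.emap e ∈ S then !(c e) else f.flip e) fun _ _ _ => false

variable {S S'} (hS : ∀ e ∈ S', f.emap e ∈ S)

theorem liftEmap_keep_of_mem {e : Γ'.E} (he : e ∉ S') (h : f.emap e ∈ S) :
    f.liftEmap S S' c hS (keep e he) = half (f.emap e) h (xor (!(c e)) (f.flip e)) := dif_pos h

theorem liftEmap_keep_of_notMem {e : Γ'.E} (he : e ∉ S') (h : f.emap e ∉ S) :
    f.liftEmap S S' c hS (keep e he) = keep (f.emap e) h := dif_neg h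

theorem liftEmap_half {e : Γ'.E} (he : e ∈ S') (b : Bool) :
    f.liftEmap S S' c hS (half e he b) = half (f.emap e) (hS e he) (xor b (f.flip e)) := rfl

theorem edgeOver_liftEmap (x : (Γ'.subdivide S').E) :
    Γ.edgeOver S (f.liftEmap S S' c hS x) = f.emap (Γ'.edgeOver S' x) := by
  rcases keep_or_half x with ⟨e, he, rfl⟩ | ⟨e, he, b, rfl⟩
  · by_cases h : f.emap e ∈ S
    · rw [liftEmap_keep_of_mem f c hS he h]; rfl
    · rw [liftEmap_keep_of_notMem f c hS he h]; rfl
  · rfl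

theorem liftEmap_injective : Function.Injective (f.liftEmap S S' c hS) := by
  intro x y hxy
  have h1 := congrArg (Γ.edgeOver S) hxy
  rw [edgeOver_liftEmap, edgeOver_liftEmap] at h1
  have h2 := f.emap_inj h1
  rcases keep_or_half x with ⟨e, he, rfl⟩ | ⟨e, he, b, rfl⟩ <;>
    rcases keep_or_half y with ⟨e', he', rfl⟩ | ⟨e', he', b', rfl⟩ <;>
    simp only [edgeOver_keep, edgeOver_half] at h2 <;> subst h2
  · rfl
  · exact absurd he' he
  · exact absurd he he'
  · rw [liftEmap_half, liftEmap_half, half_inj] at hxy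
    simpa using hxy

theorem liftVmap_ends (x : (Γ'.subdivide S').E) (b : Bool) :
    f.liftVmap S S' c ((Γ.subdivide S).ends (f.liftEmap S S' c hS x)
      (xor b (f.liftFlip S' (S := S) c x))) = (Γ'.subdivide S').ends x b := by
  rcases keep_or_half x with ⟨e, he, rfl⟩ | ⟨e, he, b', rfl⟩
  · by_cases h : f.emap e ∈ S
    · have hf : f.liftFlip S S' c (keep e he) = !(c e) := if_pos h
      rw [liftEmap_keep_of_mem f c hS he h, hf]
      by_cases hb : b = c e
      · subst hb
        have : (xor (c e) (!(c e))) = true := by cases c e <;> rfl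
        rw [this]
        exact f.liftVmap_exc_of_notMem S S' c _ he
      · have hb' : b = !(c e) := by
          revert hb; cases b <;> cases c e <;> simp
        subst hb'
        rw [Bool.xor_self, subdivide_ends_half_false, liftVmap_vtx, f.map_ends]
        rfl
    · have hf : f.liftFlip S S' c (keep e he) = f.flip e := if_neg h
      rw [liftEmap_keep_of_notMem f c hS he h, hf, subdivide_ends_keep, liftVmap_vtx, f.map_ends]
      rfl
  · have hf : f.liftFlip S S' c (half e he b') = false := rfl
    rw [liftEmap_half, hf, Bool.xor_false]
    cases b
    · rw [subdivide_ends_half_false, liftVmap_vtx, f.map_ends]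
      rfl
    · exact f.liftVmap_exc_of_mem S S' c _ he

theorem liftEmap_ne_of_contracted {x : (Γ.subdivide S).E}
    (h : ∀ e', f.emap e' ≠ Γ.edgeOver S x) (y) : f.liftEmap S S' c hS y ≠ x := by
  rintro rfl
  exact h _ (edgeOver_liftEmap f c hS y).symm

theorem liftEmap_ne_half {e : Γ'.E} (he : f.emap e ∈ S) (h : e ∉ S') (y) :
    f.liftEmap S S' c hS y ≠ half (f.emap e) he (xor (c e) (f.flip e)) := by
  intro hy
  have h1 := edgeOver_liftEmap f c hS y
  rw [hy, edgeOver_half] at h1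
  have h2 := f.emap_inj h1
  rcases keep_or_half y with ⟨e', he', rfl⟩ | ⟨e', he', b', rfl⟩ <;>
    simp only [edgeOver_keep, edgeOver_half] at h2 <;> subst h2
  · rw [liftEmap_keep_of_mem f c hS he' he, half_inj] at hy
    simp at hy
  · exact h he'

theorem liftEmap_half_of_ne {e : Γ'.E} (he : f.emap e ∈ S) (h : e ∉ S') {b : Bool}
    (hb : b ≠ xor (c e) (f.flip e)) :
    f.liftEmap S S' c hS (keep e h) = half (f.emap e) he b := by
  rw [liftEmap_keep_of_mem f c hS h he]
  have : (xor (!(c e)) (f.flip e)) = b := by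
    revert hb
    cases b <;> cases c e <;> cases f.flip e <;> simp
  rw [this]

theorem liftVmap_contracted (x : (Γ.subdivide S).E) (hx : ∀ y, f.liftEmap S S' c hS y ≠ x) :
    f.liftVmap S S' c ((Γ.subdivide S).ends x false) =
      f.liftVmap S S' c ((Γ.subdivide S).ends x true) := by
  rcases keep_or_half x with ⟨e, he, rfl⟩ | ⟨e, he, b, rfl⟩
  · rw [subdivide_ends_keep, subdivide_ends_keep, liftVmap_vtx, liftVmap_vtx]
    refine congrArg _ (f.map_contracted e fun e' he' => ?_)
    subst he'
    exact hx (keep e' fun h => he (hS _ h)) (liftEmap_keep_of_notMem f c hS _ he)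
  · rw [subdivide_ends_half_false, subdivide_ends_half_true, liftVmap_vtx]
    by_cases h : ∃ e', f.emap e' = e
    · obtain ⟨e', rfl⟩ := h
      by_cases h' : e' ∈ S'
      · exact absurd (by rw [liftEmap_half, Bool.xor_assoc, Bool.xor_self, Bool.xor_false])
          (hx (half e' h' (xor b (f.flip e'))))
      · rw [liftVmap_exc_of_notMem f S S' c he h', ← f.map_ends]
        by_cases hb : b = xor (c e') (f.flip e')
        · rw [hb]
        · exact absurd (liftEmap_half_of_ne f c hS he h' hb) (hx _)
    · exact (liftVmap_exc_of_contracted f S S' c he (fun e' he => h ⟨e', he⟩) b).symm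

theorem liftReach_vtx {u v : Γ.V} (huv : f.vmap u = f.vmap v) :
    (Γ.subdivide S).Reach (fun d => ∀ y, f.liftEmap S S' c hS y ≠ d.1) (vtx S u) (vtx S v) := by
  have := f.fiber_connected u v huv
  induction this with
  | refl => exact Relation.ReflTransGen.refl
  | @tail v w h1 hs ih =>
    obtain ⟨⟨e, b⟩, hd, rfl, rfl⟩ := hs
    refine (ih (huv.trans (f.vmap_eq_of_contracted _ hd).symm)).trans ?_
    by_cases he : e ∈ S
    · exact (Reach.single (Γ := Γ.subdivide S) (d := (half e he b, false))
        (liftEmap_ne_of_contracted f c hS (x := half e he b) hd)).trans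
        (Reach.single (Γ := Γ.subdivide S) (d := (half e he !b, true))
        (liftEmap_ne_of_contracted f c hS (x := half e he !b) hd))
    · exact Reach.single (Γ := Γ.subdivide S) (d := (keep e he, b))
        (liftEmap_ne_of_contracted f c hS (x := keep e he) hd)

/-- An exceptional vertex that does not stay exceptional has a contracted half-edge joining it to a
vertex of `Γ`. Connectedness of fibers therefore reduces to vertices of `Γ`. -/
theorem liftReach_exc {e : Γ.E} (he : e ∈ S) : (∃ e', e' ∈ S' ∧ f.emap e' = e) ∨
    ∃ u, (Γ.subdivide S).Reach (fun d => ∀ y, f.liftEmap S S' c hS y ≠ d.1)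
        (vtx S u) (exc e he) ∧
      (Γ.subdivide S).Reach (fun d => ∀ y, f.liftEmap S S' c hS y ≠ d.1)
        (exc e he) (vtx S u) := by
  have key : ∀ b, (∀ y, f.liftEmap S S' c hS y ≠ half e he b) →
      ∃ u, (Γ.subdivide S).Reach (fun d => ∀ y, f.liftEmap S S' c hS y ≠ d.1)
        (vtx S u) (exc e he) ∧
      (Γ.subdivide S).Reach (fun d => ∀ y, f.liftEmap S S' c hS y ≠ d.1)
        (exc e he) (vtx S u) := fun b hb =>
    ⟨Γ.ends e b, Reach.single (Γ := Γ.subdivide S) (d := (half e he b, false)) hb,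
      Reach.single (Γ := Γ.subdivide S) (d := (half e he b, true)) hb⟩
  by_cases h : ∃ e', f.emap e' = e
  · obtain ⟨e', rfl⟩ := h
    by_cases h' : e' ∈ S'
    · exact Or.inl ⟨e', h', rfl⟩
    · exact Or.inr (key (xor (c e') (f.flip e')) (liftEmap_ne_half f c hS he h'))
  · exact Or.inr (key false (liftEmap_ne_of_contracted f c hS (x := half e he false)
      fun e' he => h ⟨e', he⟩))

theorem liftReach {x y : (Γ.subdivide S).V}
    (hxy : f.liftVmap S S' c x = f.liftVmap S S' c y) :
    (Γ.subdivide S).Reach (fun d => ∀ y, f.liftEmap S S' c hS y ≠ d.1) x y := by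
  have hinv : ∀ {u v}, (Γ.subdivide S).Reach (fun d => ∀ y, f.liftEmap S S' c hS y ≠ d.1) u v →
      f.liftVmap S S' c u = f.liftVmap S S' c v := by
    intro u v h
    refine Reach.invariant (p := fun w => f.liftVmap S S' c u = f.liftVmap S S' c w) ?_ h rfl
    rintro ⟨x, b⟩ hd hu
    have := f.liftVmap_contracted c hS x hd
    cases b
    · exact hu.trans this
    · exact hu.trans this.symm
  have hex : ∀ x : (Γ.subdivide S).V, (∃ e', ∃ h : f.emap e' ∈ S, ∃ h' : e' ∈ S',
      x = exc (f.emap e') h ∧ f.liftVmap S S' c x = exc e' h') ∨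
      ∃ u, (Γ.subdivide S).Reach (fun d => ∀ y, f.liftEmap S S' c hS y ≠ d.1) (vtx S u) x ∧
      (Γ.subdivide S).Reach (fun d => ∀ y, f.liftEmap S S' c hS y ≠ d.1) x (vtx S u) := by
    intro x
    rcases vtx_or_exc x with ⟨u, rfl⟩ | ⟨e, he, rfl⟩
    · exact Or.inr ⟨u, Relation.ReflTransGen.refl, Relation.ReflTransGen.refl⟩
    · rcases f.liftReach_exc c hS he with ⟨e', h', rfl⟩ | h
      · exact Or.inl ⟨e', he, h', rfl, f.liftVmap_exc_of_mem S S' c he h'⟩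
      · exact Or.inr h
  rcases hex x with ⟨e', h, h', rfl, h1⟩ | ⟨u, hu1, hu2⟩
  · rcases hex y with ⟨e'', k, k', rfl, h2⟩ | ⟨v, hv1, hv2⟩
    · rw [h1, h2, exc_inj] at hxy
      subst hxy
      exact Relation.ReflTransGen.refl
    · rw [h1, ← hinv hv1] at hxy
      exact absurd hxy exc_ne_vtx
  · rcases hex y with ⟨e'', k, k', rfl, h2⟩ | ⟨v, hv1, hv2⟩
    · rw [h2, ← hinv hu1] at hxy
      exact absurd hxy vtx_ne_exc
    · rw [← hinv hu1, ← hinv hv1] at hxy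
      exact (hu2.trans (f.liftReach_vtx c hS (vtx_inj.1 hxy))).trans hv1

/-- A specialization `Γ → Γ'` induces specializations `Γ^S → Γ'^{S'}`. For an edge `e'` of `Γ'` over
`S` and not in `S'`, the half-edge at the end `c e'` is contracted. -/
def liftSubdivide : Specialization (Γ.subdivide S) (Γ'.subdivide S') :=
  mkOfCanonical (f.liftVmap S S' c) (f.liftEmap S S' c hS) (f.liftFlip S S' c)
    (by
      intro x
      rcases vtx_or_exc x with ⟨v', rfl⟩ | ⟨e', he', rfl⟩
      · obtain ⟨v, rfl⟩ := f.vmap_surj v'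
        exact ⟨vtx S v, rfl⟩
      · exact ⟨exc (f.emap e') (hS _ he'), f.liftVmap_exc_of_mem S S' c _ he'⟩)
    (f.liftEmap_injective c hS) (f.liftVmap_ends c hS) (f.liftVmap_contracted c hS)
    (fun _ _ h => f.liftReach c hS h)
    (by
      intro x
      -- Exceptional vertices have canonical degree zero, so only the compatibility of canonical
      -- divisors for `f` remains.
      rw [Finset.sum_filter, sum_subdivide_V]
      simp only [subdivide_canonicalDivisor_exc, ite_self, dite_eq_ite, Finset.sum_const_zero,
        add_zero, subdivide_canonicalDivisor_vtx, liftVmap_vtx]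
      rcases vtx_or_exc x with ⟨v', rfl⟩ | ⟨e', he', rfl⟩
      · rw [subdivide_canonicalDivisor_vtx, ← f.push_canonicalDivisor, pushDivisor,
            Finset.sum_filter]
        simp only [vtx_inj]
      · rw [subdivide_canonicalDivisor_exc]
        simp only [vtx_ne_exc, if_false, Finset.sum_const_zero])
    (fun i => congrArg (vtx S') (f.map_leg i))

end Specialization

end LegGraph

end

/-! ### Contractions, stability of their targets, push-forward of pseudo-divisors -/

open Set Filter Topology

noncomputable section

namespace LegGraph

variable {n : ℕ}

theorem Reach.symm {Γ : LegGraph n} {R : Γ.Dart → Prop} (hR : ∀ d, R d → R (Dart.rev d))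
    {u v : Γ.V} (h : Γ.Reach R u v) : Γ.Reach R v u := by
  induction h with
  | refl => exact Relation.ReflTransGen.refl
  | tail _ hs ih =>
    obtain ⟨d, hd, rfl, rfl⟩ := hs
    exact (by simpa using Reach.single (hR d hd) : Γ.Reach R (Γ.target d) (Γ.source d)).trans ih

section Contract

variable (Γ : LegGraph n) (Z : Finset Γ.E)

/-- Two vertices are identified if they are joined by an edge of `Z`. -/
def ContractRel (a b : Γ.V) : Prop := ∃ d : Γ.Dart, d.1 ∈ Z ∧ Γ.source d = a ∧ Γ.target d = b

theorem reach_of_quot_eq {u v : Γ.V}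
    (h : Quot.mk (Γ.ContractRel Z) u = Quot.mk (Γ.ContractRel Z) v) :
    Γ.Reach (fun d => d.1 ∈ Z) u v := by
  rw [Quot.eq] at h
  induction h with
  | rel _ _ h =>
    obtain ⟨d, hd, rfl, rfl⟩ := h
    exact Reach.single hd
  | refl _ => exact Relation.ReflTransGen.refl
  | symm _ _ _ ih => exact Reach.symm (fun _ h => h) ih
  | trans _ _ _ _ _ ih1 ih2 => exact ih1.trans ih2

-- The fiber is connected by edges of `Z`; the underlying simple graph has at least one edge less
-- than it has vertices, and its edges inject into the edges of `Z` over `q`. The bound ensures that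
-- the natural subtraction in the weight of `contract` is never truncated.
open Classical in
theorem card_fiber_le (q : Quot (Γ.ContractRel Z)) :
    (Finset.univ.filter fun v => Quot.mk (Γ.ContractRel Z) v = q).card ≤
      (Finset.univ.filter fun e => e ∈ Z ∧ Quot.mk (Γ.ContractRel Z) (Γ.ends e false) = q).card
        + 1 := by
  let W := {v : Γ.V // Quot.mk (Γ.ContractRel Z) v = q}
  let G : SimpleGraph W := SimpleGraph.fromRel fun a b => Γ.ContractRel Z a.1 b.1
  have hstep : ∀ {r u : Γ.V} (hr : Quot.mk (Γ.ContractRel Z) r = q),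
      Γ.Reach (fun d => d.1 ∈ Z) r u → ∃ hu, G.Reachable ⟨r, hr⟩ ⟨u, hu⟩ := by
    intro r u hr h
    induction h with
    | refl => exact ⟨hr, SimpleGraph.Reachable.refl _⟩
    | @tail b c _ hs ih =>
      obtain ⟨hb, hG⟩ := ih
      have hc : Quot.mk (Γ.ContractRel Z) c = q := (Quot.sound hs).symm.trans hb
      refine ⟨hc, hG.trans ?_⟩
      by_cases hbc : b = c
      · subst hbc
        exact SimpleGraph.Reachable.refl _
      · refine SimpleGraph.Adj.reachable ?_
        rw [SimpleGraph.fromRel_adj]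
        exact ⟨fun h => hbc (congrArg Subtype.val h), Or.inl hs⟩
  obtain ⟨r, hr⟩ := Quot.exists_rep q
  have hconn : G.Connected := by
    have : Nonempty W := ⟨⟨r, hr⟩⟩
    refine SimpleGraph.Connected.mk fun a b => ?_
    exact (hstep a.2 (Γ.reach_of_quot_eq Z (a.2.trans b.2.symm))).2
  have h1 := hconn.card_vert_le_card_edgeSet_add_one
  have h2 : Nat.card W =
      (Finset.univ.filter fun v => Quot.mk (Γ.ContractRel Z) v = q).card := by
    rw [Nat.card_eq_fintype_card, Fintype.card_subtype]
  let T := {e : Γ.E // e ∈ Z ∧ Quot.mk (Γ.ContractRel Z) (Γ.ends e false) = q}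
  have h3 : Nat.card T =
      (Finset.univ.filter fun e =>
        e ∈ Z ∧ Quot.mk (Γ.ContractRel Z) (Γ.ends e false) = q).card := by
    rw [Nat.card_eq_fintype_card, Fintype.card_subtype]
  have hex : ∀ s : G.edgeSet, ∃ t : T,
      s.1.map Subtype.val = s(Γ.ends t.1 false, Γ.ends t.1 true) := by
    rintro ⟨s, hs⟩
    induction s using Sym2.ind with
    | _ a b =>
      rw [SimpleGraph.mem_edgeSet, SimpleGraph.fromRel_adj] at hs
      have key : ∀ a b : W, Γ.ContractRel Z a.1 b.1 → ∃ t : T,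
          s(a.1, b.1) = s(Γ.ends t.1 false, Γ.ends t.1 true) := by
        rintro ⟨a, ha⟩ ⟨b, hb⟩ ⟨⟨e, c⟩, he, rfl, rfl⟩
        cases c
        · exact ⟨⟨e, he, ha⟩, rfl⟩
        · exact ⟨⟨e, he, hb⟩, Sym2.eq_swap⟩
      rcases hs.2 with h | h
      · exact key a b h
      · obtain ⟨t, ht⟩ := key b a h
        exact ⟨t, Sym2.eq_swap.trans ht⟩
  choose t ht using hex
  have h4 : Nat.card G.edgeSet ≤ Nat.card T := by
    refine Nat.card_le_card_of_injective t fun s s' hss => ?_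
    have := (ht s).trans (hss ▸ (ht s').symm)
    exact Subtype.ext (Sym2.map.injective Subtype.val_injective this)
  omega

open Classical in
/-- The contraction of the edges in `Z`. -/
def contract : LegGraph n where
  V := Quot (Γ.ContractRel Z)
  E := {e // e ∉ Z}
  fintypeV := Fintype.ofFinite _
  ends := fun e b => Quot.mk _ (Γ.ends e.1 b)
  weight := fun q => (∑ v ∈ Finset.univ.filter fun v => Quot.mk (Γ.ContractRel Z) v = q,
      Γ.weight v) +
    (Finset.univ.filter fun e => e ∈ Z ∧ Quot.mk (Γ.ContractRel Z) (Γ.ends e false) = q).card + 1 -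
    (Finset.univ.filter fun v => Quot.mk (Γ.ContractRel Z) v = q).card
  leg := fun i => Quot.mk _ (Γ.leg i)

theorem contract_notMem_range {e : Γ.E} :
    (∀ e' : {e // e ∉ Z}, e'.1 ≠ e) ↔ e ∈ Z := by
  constructor
  · intro h
    by_contra he
    exact h ⟨e, he⟩ rfl
  · rintro he e' rfl
    exact e'.2 he

/-- The specialization to a contraction. -/
def toContract : Specialization Γ (Γ.contract Z) where
  vmap := Quot.mk _
  emap := Subtype.val
  flip := fun _ => false
  vmap_surj := Quot.exists_rep
  emap_inj := Subtype.val_injective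
  map_ends := fun e b => by rw [Bool.xor_false]; rfl
  map_contracted := fun e he =>
    Quot.sound ⟨(e, false), (Γ.contract_notMem_range Z).1 he, rfl, rfl⟩
  fiber_connected := fun u v h =>
    Reach.mono (fun _ hd => (Γ.contract_notMem_range Z).2 hd) (Γ.reach_of_quot_eq Z h)
  map_weight := fun q => by
    classical
    have h1 := Γ.card_fiber_le Z q
    have h2 : (Finset.univ.filter fun e => (∀ e' : (Γ.contract Z).E, e'.1 ≠ e) ∧
        (Quot.mk (Γ.ContractRel Z) (Γ.ends e false) : (Γ.contract Z).V) = q).card =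
        (Finset.univ.filter fun e =>
          e ∈ Z ∧ Quot.mk (Γ.ContractRel Z) (Γ.ends e false) = q).card := by
      congr 1
      ext e
      simp only [Finset.mem_filter, Finset.mem_univ, true_and]
      exact and_congr_left' (Γ.contract_notMem_range Z)
    have h3 : ∀ (a : ℕ) {b c : ℕ}, c ≤ b + 1 → a + b + 1 - c + c = a + b + 1 := by omega
    have h4 := h3 (∑ v ∈ Finset.univ.filter fun v => Quot.mk (Γ.ContractRel Z) v = q, Γ.weight v) h1
    rw [← h2] at h4
    convert h4 using 2
    · simp only [contract]
      congr 2
      refine congrArg₂ (· + ·) (by congr!) (h2.symm.trans (congrArg Finset.card ?_))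
      ext e
      constructor <;> exact fun h => Finset.mem_filter.2 (Finset.mem_filter.1 h)
    · congr!
    · refine congrArg₂ (· + ·) rfl (congrArg Finset.card ?_)
      ext e
      constructor <;> exact fun h => Finset.mem_filter.2 (Finset.mem_filter.1 h)
  map_leg := fun _ => rfl

end Contract

theorem connected_iff {Γ : LegGraph n} : Γ.Connected ↔
    Nonempty Γ.V ∧ ∀ u v, Quot.mk Γ.Adj u = Quot.mk Γ.Adj v := by
  rw [Connected, b0, Nat.card_eq_one_iff_unique]
  constructor
  · rintro ⟨h1, ⟨q⟩⟩
    obtain ⟨v, -⟩ := Quot.exists_rep q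
    exact ⟨⟨v⟩, fun u v => Subsingleton.elim _ _⟩
  · rintro ⟨⟨v⟩, h⟩
    refine ⟨⟨fun p q => ?_⟩, ⟨Quot.mk _ v⟩⟩
    induction p using Quot.ind
    induction q using Quot.ind
    exact h _ _

/-- In a connected graph, a nonempty proper set of vertices has an outgoing edge. -/
theorem Connected.exists_dart {Γ : LegGraph n} (h : Γ.Connected) {W : Γ.V → Prop} {u v : Γ.V}
    (hu : W u) (hv : ¬ W v) : ∃ d, W (Γ.source d) ∧ ¬ W (Γ.target d) := by
  by_contra hc
  push Not at hc
  have hadj : ∀ a b, Γ.Adj a b → W a = W b := by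
    rintro a b ⟨d, rfl, rfl⟩
    refine propext ⟨hc d, fun hb => ?_⟩
    simpa using hc (Dart.rev d) hb
  have := (connected_iff.1 h).2 u v
  have h2 : Quot.lift W hadj (Quot.mk _ u) = Quot.lift W hadj (Quot.mk _ v) := by rw [this]
  change W u = W v at h2
  exact hv (h2 ▸ hu)

theorem sum_canonicalDivisor {Γ : LegGraph n} :
    ∑ v, Γ.canonicalDivisor v = 2 * (Γ.genus - Γ.b0) := by
  have h : ∑ v, Γ.deg v = 2 * Fintype.card Γ.E := by
    simp only [deg, degIn_eq_sum]
    rw [Finset.sum_comm]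
    simp [Fintype.card_prod, mul_comm]
  zify at h
  simp only [canonicalDivisor, genus, Finset.sum_add_distrib, Finset.sum_sub_distrib,
    ← Finset.mul_sum, h]
  simp
  ring

namespace Specialization

variable {Γ Γ' : LegGraph n} (f : Specialization Γ Γ')

theorem connected (f : Specialization Γ Γ') (h : Γ.Connected) : Γ'.Connected := by
  rw [connected_iff] at h ⊢
  refine ⟨h.1.map f.vmap, fun u' v' => ?_⟩
  obtain ⟨u, rfl⟩ := f.vmap_surj u'
  obtain ⟨v, rfl⟩ := f.vmap_surj v'
  have hl : ∀ a b, Γ.Adj a b → Quot.mk Γ'.Adj (f.vmap a) = Quot.mk Γ'.Adj (f.vmap b) := by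
    rintro a b ⟨d, rfl, rfl⟩
    rcases f.exists_dart_or d with ⟨d', rfl⟩ | hd
    · rw [vmap_source, vmap_target]
      exact Quot.sound ⟨d', rfl, rfl⟩
    · rw [f.vmap_eq_of_contracted d hd]
  exact congrArg (Quot.lift (fun a => Quot.mk Γ'.Adj (f.vmap a)) hl) (h.2 u v)

theorem sum_push (D : Γ.V → ℤ) : ∑ v, f.pushDivisor D v = ∑ v, D v :=
  Finset.sum_fiberwise _ _ _

/-- Push-forward preserves the degree of the canonical divisor, which is twice the genus minus the
number of components. -/
theorem genus_eq (f : Specialization Γ Γ') (h : Γ.Connected) : Γ'.genus = Γ.genus := by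
  have h1 := sum_canonicalDivisor (Γ := Γ)
  have h2 := sum_canonicalDivisor (Γ := Γ')
  rw [← f.push_canonicalDivisor, f.sum_push, h1] at h2
  have h3 : Γ.b0 = 1 := h
  have h4 : Γ'.b0 = 1 := f.connected h
  rw [h3, h4] at h2
  linarith

/-- The stability quantity of a vertex is the sum of the positive stability quantities over its
nonempty fiber. -/
theorem isStable (f : Specialization Γ Γ') (h : Γ.IsStable) : Γ'.IsStable := by
  intro v'
  have h1 : ∑ v ∈ Finset.univ.filter fun v => f.vmap v = v', Γ.legCount v = Γ'.legCount v' := by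
    simp only [legCount, Finset.card_filter]
    rw [sum_filter_sum_ite]
    simp only [f.map_leg]
  have h2 := congrFun f.push_canonicalDivisor v'
  simp only [pushDivisor] at h2
  have h3 : 0 < ∑ v ∈ Finset.univ.filter fun v => f.vmap v = v',
      (Γ.canonicalDivisor v + Γ.legCount v) := by
    refine Finset.sum_pos (fun v _ => h v) ?_
    obtain ⟨v, hv⟩ := f.vmap_surj v'
    exact ⟨v, by simpa using hv⟩
  rw [Finset.sum_add_distrib, h2] at h3
  zify at h1
  rw [h1] at h3
  exact h3

end Specialization

/-- The target of a specialization of a stable graph. -/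
def StableGraph.specialize {g : ℕ} (Γ : StableGraph g n) {Γ' : LegGraph n}
    (f : Specialization Γ.graph Γ') : StableGraph g n where
  graph := Γ'
  connected := f.connected Γ.connected
  stable := f.isStable Γ.stable
  genus_eq := (f.genus_eq Γ.connected).trans Γ.genus_eq

section Triples

variable {Γ Γ' : LegGraph n}

namespace PseudoDivisor

@[ext] theorem ext {A B : Γ.PseudoDivisor} (hS : A.S = B.S)
    (hD : ∀ v, A.D (vtx A.S v) = B.D (vtx B.S v)) : A = B := by
  obtain ⟨S, D, h⟩ := A
  obtain ⟨S', D', h'⟩ := B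
  simp only at hS
  subst hS
  have : D = D' := by
    funext x
    rcases vtx_or_exc x with ⟨v, rfl⟩ | ⟨e, he, rfl⟩
    · exact hD v
    · exact (h ⟨e, he⟩).trans (h' ⟨e, he⟩).symm
  subst this
  rfl

theorem D_exc (A : Γ.PseudoDivisor) {e : Γ.E} (h : e ∈ A.S) : A.D (exc e h) = -1 :=
  A.exceptional ⟨e, h⟩

/-- The push-forward of a pseudo-divisor along `liftSubdivide`. -/
def push (A : Γ.PseudoDivisor) (f : Specialization Γ Γ') {S' : Finset Γ'.E} (c : Γ'.E → Bool)
    (hS : ∀ e ∈ S', f.emap e ∈ A.S) : Γ'.PseudoDivisor where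
  S := S'
  D := (f.liftSubdivide c hS).pushDivisor A.D
  exceptional := by
    intro e
    change Specialization.pushDivisor _ A.D (exc e.1 e.2) = -1
    rw [Specialization.pushDivisor, Finset.sum_eq_single (exc (f.emap e.1) (hS _ e.2)), A.D_exc]
    · intro x hx hne
      have hx := (Finset.mem_filter.1 hx).2
      change f.liftVmap A.S S' c x = _ at hx
      exfalso
      rcases vtx_or_exc x with ⟨v, rfl⟩ | ⟨e₁, he₁, rfl⟩
      · exact vtx_ne_exc hx
      · by_cases h : ∃ e', f.emap e' = e₁
        · obtain ⟨e', rfl⟩ := h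
          by_cases h' : e' ∈ S'
          · rw [f.liftVmap_exc_of_mem _ _ _ _ h', exc_inj] at hx
            subst hx
            exact hne rfl
          · rw [f.liftVmap_exc_of_notMem _ _ _ _ h'] at hx
            exact vtx_ne_exc hx
        · rw [f.liftVmap_exc_of_contracted _ _ _ _ (fun e' he => h ⟨e', he⟩) false] at hx
          exact vtx_ne_exc hx
    · intro h
      exact (h (Finset.mem_filter.2 ⟨Finset.mem_univ _,
        f.liftVmap_exc_of_mem A.S S' c (hS _ e.2) e.2⟩)).elim

end PseudoDivisor

/-- The specialization of triples to a push-forward. -/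
def TripleSpecialization.toPush (A : Γ.PseudoDivisor) (f : Specialization Γ Γ')
    {S' : Finset Γ'.E} (c : Γ'.E → Bool) (hS : ∀ e ∈ S', f.emap e ∈ A.S) :
    TripleSpecialization A (A.push f c hS) where
  base := f
  hat := f.liftSubdivide c hS
  subset := hS
  compat_vertex := fun _ => rfl
  compat_edge := f.edgeOver_liftEmap c hS
  push := rfl

open Classical in
/-- Every set of edges of `Γ^S` can be contracted. -/
theorem exists_tripleSpecialization (A : Γ.PseudoDivisor) (Z : Set A.graph.E) :
    ∃ (Γ' : LegGraph n) (B : Γ'.PseudoDivisor) (f : TripleSpecialization A B),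
      ∀ x, (∃ y, f.hat.emap y = x) ↔ x ∉ Z := by
  -- An edge of `Γ` is contracted if everything over it is in `Z`, and stays exceptional if it was
  -- so and nothing over it is in `Z`. An exceptional edge with just one half in `Z` stops being
  -- exceptional, and `c` is the end of that half.
  let Z₀ : Finset Γ.E := Finset.univ.filter fun e => ∀ x, Γ.edgeOver A.S x = e → x ∈ Z
  let f := Γ.toContract Z₀
  let S' : Finset (Γ.contract Z₀).E :=
    Finset.univ.filter fun e => e.1 ∈ A.S ∧ ∀ x, Γ.edgeOver A.S x = e.1 → x ∉ Z
  let c : (Γ.contract Z₀).E → Bool := fun e => !decide (∃ h : e.1 ∈ A.S, half e.1 h false ∈ Z)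
  have hS : ∀ e ∈ S', f.emap e ∈ A.S := fun e he => (Finset.mem_filter.1 he).2.1
  have hS' : ∀ e, e ∈ S' ↔ e.1 ∈ A.S ∧ ∀ x, Γ.edgeOver A.S x = e.1 → x ∉ Z := fun e =>
    ⟨fun h => (Finset.mem_filter.1 h).2, fun h => Finset.mem_filter.2 ⟨Finset.mem_univ _, h⟩⟩
  have hZ₀ : ∀ e, e ∈ Z₀ ↔ ∀ x, Γ.edgeOver A.S x = e → x ∈ Z := fun e => by simp [Z₀]
  have hcf : ∀ e (h : e.1 ∈ A.S), half e.1 h false ∈ Z → c e = false := fun e h hz => by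
    simp only [c, decide_eq_true (⟨h, hz⟩ : ∃ h : e.1 ∈ A.S, half e.1 h false ∈ Z), Bool.not_true]
  have hct : ∀ e (h : e.1 ∈ A.S), half e.1 h false ∉ Z → c e = true := fun e h hz => by
    have : ¬ ∃ h : e.1 ∈ A.S, half e.1 h false ∈ Z := fun ⟨_, h'⟩ => hz h'
    simp only [c, decide_eq_false this, Bool.not_false]
  refine ⟨Γ.contract Z₀, A.push f c hS, TripleSpecialization.toPush A f c hS, fun x => ?_⟩
  change (∃ y, f.liftEmap A.S S' c hS y = x) ↔ _
  constructor
  · rintro ⟨y, rfl⟩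
    rcases keep_or_half y with ⟨e, he, rfl⟩ | ⟨e, he, b, rfl⟩
    · have he0 : e.1 ∉ Z₀ := e.2
      by_cases h : e.1 ∈ A.S
      · rw [f.liftEmap_keep_of_mem c hS he h]
        change half e.1 h (xor (!(c e)) false) ∉ Z
        rw [Bool.xor_false]
        by_cases hf : half e.1 h false ∈ Z
        · rw [hcf e h hf]
          intro ht
          refine he0 ((hZ₀ _).2 fun x hx => ?_)
          rcases keep_or_half x with ⟨e', he', rfl⟩ | ⟨e', he', b, rfl⟩
          · exact absurd h (hx ▸ he')
          · simp only [edgeOver_half] at hx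
            subst hx
            cases b
            · exact hf
            · exact ht
        · rw [hct e h hf]
          exact hf
      · rw [f.liftEmap_keep_of_notMem c hS he h]
        intro hk
        refine he0 ((hZ₀ _).2 fun x hx => ?_)
        rcases keep_or_half x with ⟨e', he', rfl⟩ | ⟨e', he', b, rfl⟩
        · simp only [edgeOver_keep] at hx
          subst hx
          exact hk
        · exact absurd he' (by simpa [← hx] using h)
    · exact ((hS' e).1 he).2 _ (f.edgeOver_liftEmap c hS _)
  · intro hx
    have he0 : Γ.edgeOver A.S x ∉ Z₀ := fun h => hx ((hZ₀ _).1 h x rfl)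
    rcases keep_or_half x with ⟨e, he, rfl⟩ | ⟨e, he, b, rfl⟩
    · have he' : (⟨e, he0⟩ : (Γ.contract Z₀).E) ∉ S' := fun h => he ((hS' _).1 h).1
      exact ⟨keep ⟨e, he0⟩ he', f.liftEmap_keep_of_notMem c hS he' he⟩
    · by_cases hS₁ : (⟨e, he0⟩ : (Γ.contract Z₀).E) ∈ S'
      · refine ⟨half ⟨e, he0⟩ hS₁ b, ?_⟩
        rw [f.liftEmap_half c hS hS₁]
        exact congrArg (half e he) (Bool.xor_false b)
      · refine ⟨keep ⟨e, he0⟩ hS₁, f.liftEmap_half_of_ne c hS (e := ⟨e, he0⟩) he hS₁ ?_⟩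
        change b ≠ xor (c ⟨e, he0⟩) false
        rw [Bool.xor_false]
        cases b
        · rw [hct ⟨e, he0⟩ he hx]
          exact Bool.false_ne_true
        · rw [hcf ⟨e, he0⟩ he]
          · exact Bool.true_eq_false_eq_False
          · by_contra hf
            refine hS₁ ((hS' _).2 ⟨he, fun x hx' => ?_⟩)
            rcases keep_or_half x with ⟨e', he', rfl⟩ | ⟨e', he', b, rfl⟩
            · simp only [edgeOver_keep] at hx'
              exact absurd he (hx' ▸ he')
            · simp only [edgeOver_half] at hx'
              subst hx'
              cases b
              · exact hf
              · exact hx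

end Triples

end LegGraph

end

/-! ### Stability conditions expressed by flows -/

open Set Filter Topology

noncomputable section

namespace LegGraph

variable {n : ℕ}

theorem cast_ite_one_zero (p : Prop) [Decidable p] :
    ((if p then 1 else 0 : ℕ) : ℝ) = if p then 1 else 0 := by
  split_ifs <;> simp

section Cuts

variable {Γ : LegGraph n}

/-- The oriented edge `d` leaves `W`. -/
def Leaves (W : Finset Γ.V) (d : Γ.Dart) : Prop := Γ.source d ∈ W ∧ Γ.target d ∉ W

instance (W : Finset Γ.V) : DecidablePred (Leaves W) := fun d => by
  unfold Leaves; infer_instance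

/-- Contributions of edges with both ends in `W` cancel by antisymmetry, leaving the inflow across
the boundary. -/
theorem sum_div (φ : Γ.Flow) (W : Finset Γ.V) :
    ∑ v ∈ W, φ.div v = -∑ d, if Leaves W d then φ.val d else 0 := by
  have h1 : ∑ v ∈ W, φ.div v = ∑ d, if Γ.target d ∈ W then φ.val d else 0 := by
    have := sum_filter_sum_ite (fun v => v ∈ W) Γ.target φ.val
    rw [← this]
    simp only [Flow.div, Finset.filter_univ_mem]
  have h2 : ∑ d, (if Γ.target d ∈ W ∧ Γ.source d ∈ W then φ.val d else 0) = 0 := by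
    rw [sum_dart_eq]
    refine Finset.sum_eq_zero fun e _ => ?_
    have : φ.val (e, true) = -φ.val (e, false) := φ.antisymm e false
    simp only [source, target, Bool.not_true, Bool.not_false, this]
    by_cases h1 : Γ.ends e false ∈ W <;> by_cases h2 : Γ.ends e true ∈ W <;> simp [h1, h2]
  have h3 : ∑ d, (if Leaves W d then φ.val d else 0) =
      -∑ d, if Leaves W (Dart.rev d) then φ.val d else 0 := by
    rw [← sum_dart_rev, ← Finset.sum_neg_distrib]
    refine Finset.sum_congr rfl fun d _ => ?_
    rw [φ.val_rev]
    split_ifs <;> simp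
  rw [h1, h3, neg_neg, ← add_zero (Finset.sum _ fun d => if Leaves W (Dart.rev d) then _ else _)]
  refine Eq.trans ?_ (congrArg _ h2)
  rw [← Finset.sum_add_distrib]
  refine Finset.sum_congr rfl fun d _ => ?_
  simp only [Leaves, source_rev, target_rev]
  by_cases h1 : Γ.target d ∈ W <;> by_cases h2 : Γ.source d ∈ W <;> simp [h1, h2]

theorem card_crosses (W : Finset Γ.V) (P : Γ.E → Prop) [DecidablePred P] :
    (Finset.univ.filter fun e => P e ∧ Γ.Crosses e W).card =
      ∑ d : Γ.Dart, if P d.1 ∧ Leaves W d then 1 else 0 := by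
  rw [Finset.card_filter, sum_dart_eq]
  refine Finset.sum_congr rfl fun e _ => ?_
  simp only [Crosses, Leaves, source, target, Bool.exists_bool, Bool.not_true, Bool.not_false]
  by_cases h0 : P e <;> by_cases h1 : Γ.ends e false ∈ W <;> by_cases h2 : Γ.ends e true ∈ W <;>
    simp [h0, h1, h2]

theorem polarization_eq (v : Γ.V) : Γ.polarization v = (Γ.canonicalDivisor v : ℝ) / 2 := by
  simp only [polarization, canonicalDivisor]
  push_cast
  ring

end Cuts

namespace PseudoDivisor

variable {Γ : LegGraph n} (A : Γ.PseudoDivisor)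

/-- The flow on the edges outside `S`. -/
def offFlow (φ : A.graph.Flow) (d : Γ.Dart) : ℤ :=
  if h : d.1 ∈ A.S then 0 else φ.val (keep d.1 h, d.2)

variable {A}

theorem offFlow_of_notMem (φ : A.graph.Flow) {d : Γ.Dart} (h : d.1 ∉ A.S) :
    A.offFlow φ d = φ.val (keep d.1 h, d.2) := dif_neg h

theorem offFlow_rev (φ : A.graph.Flow) (d : Γ.Dart) :
    A.offFlow φ (Dart.rev d) = -A.offFlow φ d := by
  by_cases h : d.1 ∈ A.S
  · have h' : (Dart.rev d).1 ∈ A.S := h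
    rw [offFlow, offFlow, dif_pos h, dif_pos h', neg_zero]
  · rw [offFlow_of_notMem φ h, offFlow_of_notMem φ (d := Dart.rev d) h]
    exact φ.antisymm _ _

/-- By the root equation, `2D - K` is minus the divisor of the flow, so its degree on `W` is the
outflow; the number of crossing edges supplies the summands `1`. All stability criteria are
applications of this formula. -/
theorem two_mul_beta {φ : A.graph.Flow} (hφ : A.IsRootFlow φ) (W : Finset A.graph.V) :
    2 * A.beta W = ((∑ d, if Leaves W d then φ.val d + 1 else 0 : ℤ) : ℝ) := by
  have h1 : ∑ v ∈ W, (2 * A.D v - A.graph.canonicalDivisor v) = -∑ v ∈ W, φ.div v := by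
    rw [← Finset.sum_neg_distrib]
    refine Finset.sum_congr rfl fun v _ => ?_
    have := hφ.2 v
    linarith
  have h2 := card_crosses W fun _ : A.graph.E => True
  simp only [true_and] at h2
  have h3 : ∑ d, (if Leaves W d then φ.val d + 1 else 0) =
      ∑ d, (if Leaves W d then φ.val d else 0) +
        ((Finset.univ.filter fun e => A.graph.Crosses e W).card : ℤ) := by
    rw [h2]
    push_cast
    rw [← Finset.sum_add_distrib]
    refine Finset.sum_congr rfl fun d _ => ?_
    split_ifs <;> simp
  rw [sum_div, neg_neg] at h1
  rw [h3, ← h1, beta]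
  simp only [polarization_eq, Finset.sum_sub_distrib, ← Finset.mul_sum, ← Finset.sum_div]
  push_cast
  ring

/-- The count is per half of an exceptional edge: its share `-1/2` of the value `-1`, the `1/2` for
crossing, and the `1/2` from `deg_S` cancel, except when the half leaves `Z` at a vertex of `W`,
where they add up to `1`. -/
theorem beta_eq (Z : Finset A.graph.V) (W : Finset Γ.V) (hW : ∀ v, v ∈ W ↔ vtx A.S v ∈ Z) :
    A.beta Z = A.betaRemoved W +
      ∑ d : Γ.Dart, if h : d.1 ∈ A.S then
        (if Γ.source d ∈ W ∧ exc d.1 h ∉ Z then 1 else 0) else 0 := by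
  have e1 : ((∑ v ∈ Z, A.D v : ℤ) : ℝ) = ((∑ v ∈ W, A.D (vtx A.S v) : ℤ) : ℝ) +
      ∑ d : Γ.Dart, if h : d.1 ∈ A.S then (if exc d.1 h ∈ Z then -1 / 2 else 0) else 0 := by
    have h1 : ∑ v ∈ Z, A.D v = ∑ v ∈ W, A.D (vtx A.S v) +
        ∑ e, if h : e ∈ A.S then (if exc e h ∈ Z then -1 else 0) else 0 := by
      have : ∑ v ∈ Z, A.D v = ∑ v, if v ∈ Z then A.D v else 0 := by
        rw [← Finset.sum_filter, Finset.filter_univ_mem]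
      rw [this, sum_subdivide_V]
      congr 1
      · simp only [← hW]
        rw [← Finset.sum_filter, Finset.filter_univ_mem]
      · refine Finset.sum_congr rfl fun e _ => ?_
        by_cases h : e ∈ A.S
        · simp only [dif_pos h, A.D_exc]
        · simp only [dif_neg h]
    rw [h1]
    push_cast
    congr 1
    rw [sum_dart_eq]
    refine Finset.sum_congr rfl fun e _ => ?_
    by_cases h : e ∈ A.S
    · simp only [dif_pos h]
      split_ifs <;> norm_num
    · simp [dif_neg h]
  have e2 : ∑ v ∈ Z, A.graph.polarization v = ∑ v ∈ W, Γ.polarization v := by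
    have : ∑ v ∈ Z, A.graph.polarization v = ∑ v, if v ∈ Z then A.graph.polarization v else 0 := by
      rw [← Finset.sum_filter, Finset.filter_univ_mem]
    rw [this, sum_subdivide_V]
    simp only [polarization_eq, subdivide_canonicalDivisor_exc, subdivide_canonicalDivisor_vtx,
      ← hW]
    rw [← Finset.sum_filter, Finset.filter_univ_mem]
    simp
  have e3 : ((Finset.univ.filter fun e => A.graph.Crosses e Z).card : ℝ) =
      ((Finset.univ.filter fun e => e ∉ A.S ∧ Γ.Crosses e W).card : ℝ) +
      ∑ d : Γ.Dart, if h : d.1 ∈ A.S then ((if Γ.source d ∈ W ∧ exc d.1 h ∉ Z then 1 else 0) +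
        (if exc d.1 h ∈ Z ∧ Γ.source d ∉ W then 1 else 0)) else 0 := by
    have h2 := card_crosses Z fun _ : A.graph.E => True
    simp only [true_and] at h2
    rw [h2, card_crosses, sum_subdivide_dart]
    push_cast
    rw [← Finset.sum_add_distrib]
    refine Finset.sum_congr rfl fun d _ => ?_
    by_cases h : d.1 ∈ A.S
    · simp only [h, dif_pos, not_true_eq_false, false_and, if_false, zero_add, Leaves, source,
        target, hW, subdivide_ends_half_false, subdivide_ends_half_true, Bool.not_true,
        Bool.not_false]
      push_cast
      rfl
    · simp only [h, dif_neg, not_false_eq_true, true_and, add_zero, Leaves, source,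
        target, hW, subdivide_ends_keep]
      exact cast_ite_one_zero _
  have e4 : ∑ v ∈ W, (Γ.degIn A.S v : ℝ) =
      ∑ d : Γ.Dart, if d.1 ∈ A.S then (if Γ.source d ∈ W then 1 else 0) else 0 := by
    simp only [degIn_eq_sum]
    push_cast
    have := sum_filter_sum_ite (fun v => v ∈ W) Γ.source
      (fun d : Γ.Dart => if d.1 ∈ A.S then (1 : ℝ) else 0)
    rw [Finset.filter_univ_mem] at this
    rw [this]
    refine Finset.sum_congr rfl fun d _ => ?_
    split_ifs <;> rfl
  rw [beta, betaRemoved, e1, e2, e3, Finset.sum_add_distrib, ← Finset.sum_div, e4]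
  have e5 : ∑ d : Γ.Dart, (if h : d.1 ∈ A.S then (if exc d.1 h ∈ Z then (-1 : ℝ) / 2 else 0)
        else 0) + (∑ d : Γ.Dart, if h : d.1 ∈ A.S then
        ((if Γ.source d ∈ W ∧ exc d.1 h ∉ Z then (1 : ℝ) else 0) +
        (if exc d.1 h ∈ Z ∧ Γ.source d ∉ W then 1 else 0)) else 0) / 2 +
      (∑ d : Γ.Dart, if d.1 ∈ A.S then (if Γ.source d ∈ W then (1 : ℝ) else 0) else 0) / 2 =
      ∑ d : Γ.Dart, if h : d.1 ∈ A.S then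
        (if Γ.source d ∈ W ∧ exc d.1 h ∉ Z then (1 : ℝ) else 0) else 0 := by
    rw [Finset.sum_div, Finset.sum_div, ← Finset.sum_add_distrib, ← Finset.sum_add_distrib]
    refine Finset.sum_congr rfl fun d _ => ?_
    by_cases h : d.1 ∈ A.S
    · by_cases h1 : Γ.source d ∈ W <;> by_cases h2 : exc d.1 h ∈ Z <;>
        (simp [h, h1, h2]; try norm_num)
    · simp [h]
  have e6 : ∑ v ∈ W, A.D (vtx A.S v) = ∑ v ∈ W, A.D (Sum.inl v) := rfl
  rw [← e5, e6]
  ring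

/-- The union of a set of vertices of `Γ` with all exceptional vertices. -/
def saturate (A : Γ.PseudoDivisor) (W : Finset Γ.V) : Finset A.graph.V :=
  Finset.univ.filter fun x => elimV A.S (fun v => decide (v ∈ W)) (fun _ _ => true) x = true

@[simp] theorem vtx_mem_saturate {W : Finset Γ.V} {v : Γ.V} :
    vtx A.S v ∈ A.saturate W ↔ v ∈ W := by simp [saturate]

@[simp] theorem exc_mem_saturate {W : Finset Γ.V} {e : Γ.E} {h : e ∈ A.S} :
    exc e h ∈ A.saturate W := by simp [saturate]

theorem betaRemoved_eq_beta (W : Finset Γ.V) : A.betaRemoved W = A.beta (A.saturate W) := by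
  rw [beta_eq (A.saturate W) W fun v => vtx_mem_saturate.symm]
  simp

/-- For a given trace on the vertices of `Γ`, the minimum of `β` is attained by including all
exceptional vertices. Semistability can thus be tested on subsets of the original vertices. -/
theorem betaRemoved_le_beta (Z : Finset A.graph.V) :
    A.betaRemoved (Finset.univ.filter fun v => vtx A.S v ∈ Z) ≤ A.beta Z := by
  rw [beta_eq Z (Finset.univ.filter fun v => vtx A.S v ∈ Z) fun v => by simp]
  refine le_add_of_nonneg_right (Finset.sum_nonneg fun d _ => ?_)
  split_ifs <;> norm_num

theorem exists_notMem_of_ne_univ {α : Type*} [Fintype α] {W : Finset α} (h : W ≠ Finset.univ) :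
    ∃ v, v ∉ W := by
  by_contra hc
  push Not at hc
  exact h (Finset.eq_univ_iff_forall.2 hc)

theorem saturate_ne_univ {W : Finset Γ.V} (h : W ≠ Finset.univ) :
    A.saturate W ≠ Finset.univ := by
  obtain ⟨v, hv⟩ := exists_notMem_of_ne_univ h
  exact fun h' => hv (vtx_mem_saturate.1 (h' ▸ Finset.mem_univ (vtx A.S v)))

/-- The semistability common to quasistable and polystable pseudo-divisors. -/
def IsSemistable (A : Γ.PseudoDivisor) : Prop := ∀ W, 0 ≤ A.betaRemoved W

theorem IsPolystable.isSemistable (h : A.IsPolystable) : A.IsSemistable := fun W => (h.2 W).1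

theorem IsQuasistable.isSemistable {v₀ : Γ.V} (h : A.IsQuasistable v₀) : A.IsSemistable := by
  intro W
  by_cases hW : W = Finset.univ
  · have h1 : A.saturate W = Finset.univ := by
      ext x
      rcases vtx_or_exc x with ⟨v, rfl⟩ | ⟨e, he, rfl⟩ <;> simp [hW]
    have h2 := h.1
    rw [HasPolarizationDegree] at h2
    rw [betaRemoved_eq_beta, h1, beta, h2, sub_self, zero_add]
    positivity
  · rw [betaRemoved_eq_beta]
    exact (h.2 _ (saturate_ne_univ hW)).1

theorem IsSemistable.beta_nonneg (h : A.IsSemistable) (Z : Finset A.graph.V) : 0 ≤ A.beta Z :=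
  (h _).trans (betaRemoved_le_beta Z)

variable (A) in
/-- A root flow with values in `{-1, 0, 1}`. -/
def IsUnitRootFlow (φ : A.graph.Flow) : Prop := A.IsRootFlow φ ∧ ∀ d, φ.val d ≤ 1

theorem IsUnitRootFlow.neg_one_le {φ : A.graph.Flow} (h : A.IsUnitRootFlow φ) (d : A.graph.Dart) :
    -1 ≤ φ.val d := by
  have := h.2 (Dart.rev d)
  rw [φ.val_rev] at this
  linarith

/-- The set of vertices at least as high as the source of `d`. -/
def superlevel {G : LegGraph n} (h : G.V → ℝ) (t : ℝ) : Finset G.V :=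
  Finset.univ.filter fun v => t ≤ h v

/-- Leaving a superlevel set decreases the height, which nonnegative flow cannot do. Superlevel sets
are thus the test sets on which `φ + 1` is nonpositive along the boundary. -/
theorem neg_of_leaves {G : LegGraph n} {φ : G.Flow} {h : G.V → ℝ} {t : ℝ}
    (hpos : ∀ d, 0 < φ.val d → h (G.source d) < h (G.target d))
    (hzero : ∀ d, φ.val d = 0 → h (G.source d) = h (G.target d)) {d : G.Dart}
    (hd : Leaves (superlevel h t) d) : φ.val d < 0 := by
  by_contra hc
  push Not at hc
  have h1 : t ≤ h (G.source d) := by simpa [superlevel] using hd.1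
  have h2 : h (G.target d) < t := by simpa [superlevel] using hd.2
  rcases hc.lt_or_eq with h3 | h3
  · have := hpos d h3
    linarith
  · have := hzero d h3.symm
    linarith

theorem leaves_superlevel {G : LegGraph n} {φ : G.Flow} {h : G.V → ℝ}
    (hpos : ∀ d, 0 < φ.val d → h (G.source d) < h (G.target d)) {d : G.Dart}
    (hd : φ.val d < 0) : Leaves (superlevel h (h (G.source d))) d := by
  have := hpos (Dart.rev d) (by rw [φ.val_rev]; linarith)
  rw [source_rev, target_rev] at this
  simp [Leaves, superlevel, this]

/-- If the flow were at least `2` somewhere, the reversed edge would leave the superlevel set at its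
source with contribution at most `-1`. No other leaving edge contributes positively, so `β` would be
negative there. -/
theorem IsSemistable.isUnitRootFlow (hA : A.IsSemistable) {φ : A.graph.Flow}
    (hφ : A.IsRootFlow φ) : A.IsUnitRootFlow φ := by
  refine ⟨hφ, fun d => ?_⟩
  by_contra hd
  push Not at hd
  obtain ⟨h, hpos, hzero⟩ := hφ.1.exists_height
  have hd' : φ.val (Dart.rev d) ≤ -2 := by rw [φ.val_rev]; linarith
  have h1 := two_mul_beta hφ (superlevel h (h (A.graph.source (Dart.rev d))))
  have h2 := hA.beta_nonneg (superlevel h (h (A.graph.source (Dart.rev d))))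
  have h3 : ∑ d', (if Leaves (superlevel h (h (A.graph.source (Dart.rev d)))) d' then
      φ.val d' + 1 else 0) < 0 := by
    refine Finset.sum_neg' (fun d' _ => ?_) ⟨Dart.rev d, Finset.mem_univ _, ?_⟩
    · split_ifs with hl
      · have := neg_of_leaves hpos hzero hl
        linarith
      · rfl
    · rw [if_pos (leaves_superlevel hpos (by linarith))]
      linarith
  have h4 : (0 : ℝ) ≤ ((∑ d', (if Leaves (superlevel h (h (A.graph.source (Dart.rev d)))) d' then
      φ.val d' + 1 else 0) : ℤ) : ℝ) := by rw [← h1]; linarith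
  exact absurd (Int.cast_nonneg_iff.1 h4) (not_le.2 h3)

namespace IsUnitRootFlow

variable {φ φ' : A.graph.Flow}

theorem beta_nonneg (hφ : A.IsUnitRootFlow φ) (Z : Finset A.graph.V) : 0 ≤ A.beta Z := by
  have h1 := two_mul_beta hφ.1 Z
  have h2 : 0 ≤ ∑ d, (if Leaves Z d then φ.val d + 1 else 0) := by
    refine Finset.sum_nonneg fun d _ => ?_
    have := hφ.neg_one_le d
    split_ifs <;> linarith
  have h3 : (0 : ℝ) ≤ ((∑ d, (if Leaves Z d then φ.val d + 1 else 0) : ℤ) : ℝ) :=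
    Int.cast_nonneg_iff.2 h2
  linarith

theorem isSemistable (hφ : A.IsUnitRootFlow φ) : A.IsSemistable := fun W => by
  rw [betaRemoved_eq_beta]
  exact hφ.beta_nonneg _

/-- For the superlevel set at the source of `d`, all edges leaving have `φ = -1`, so `β = 0`.
Computed with `φ'`, this `β` is half a sum of nonnegative terms, all of which must vanish. By
symmetry the two flows agree. -/
theorem eq_neg_one (hφ : A.IsUnitRootFlow φ) (hφ' : A.IsUnitRootFlow φ') {d : A.graph.Dart}
    (hd : φ.val d = -1) : φ'.val d = -1 := by
  obtain ⟨h, hpos, hzero⟩ := hφ.1.1.exists_height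
  have h1 := two_mul_beta hφ.1 (superlevel h (h (A.graph.source d)))
  rw [two_mul_beta hφ'.1] at h1
  have h2 : ∑ d', (if Leaves (superlevel h (h (A.graph.source d))) d' then
      φ.val d' + 1 else 0) = 0 := by
    refine Finset.sum_eq_zero fun d' _ => ?_
    split_ifs with hl
    · have := neg_of_leaves hpos hzero hl
      have := hφ.neg_one_le d'
      linarith
    · rfl
  rw [h2, Int.cast_inj, Finset.sum_eq_zero_iff_of_nonneg] at h1
  · have := h1 d (Finset.mem_univ _)
    rw [if_pos (leaves_superlevel hpos (by linarith))] at this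
    linarith
  · intro d' _
    have := hφ'.neg_one_le d'
    split_ifs <;> linarith

theorem unique (hφ : A.IsUnitRootFlow φ) (hφ' : A.IsUnitRootFlow φ') : φ = φ' := by
  refine Flow.ext fun d => ?_
  have h1 := hφ.eq_neg_one hφ' (d := d)
  have h2 := hφ'.eq_neg_one hφ (d := d)
  have h3 := hφ.eq_neg_one hφ' (d := Dart.rev d)
  have h4 := hφ'.eq_neg_one hφ (d := Dart.rev d)
  rw [φ.val_rev, φ'.val_rev] at h3 h4
  have h5 := hφ.2 d
  have h6 := hφ'.2 d
  have h7 := hφ.neg_one_le d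
  have h8 := hφ'.neg_one_le d
  omega

theorem isPseudoRoot (hφ : A.IsUnitRootFlow φ) : A.IsPseudoRoot := ⟨φ, hφ.1⟩

end IsUnitRootFlow

theorem IsPseudoRoot.isRootFlow (h : A.IsPseudoRoot) : A.IsRootFlow A.flow := by
  rw [flow, dif_pos h]
  exact h.choose_spec

/-- The flow of a pseudo-root is defined by choice; uniqueness identifies the choice with any
explicitly given unit flow. -/
theorem IsUnitRootFlow.flow_eq {φ : A.graph.Flow} (hφ : A.IsUnitRootFlow φ) : A.flow = φ :=
  (hφ.isSemistable.isUnitRootFlow hφ.isPseudoRoot.isRootFlow).unique hφ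

theorem IsPolystableRoot.isUnitRootFlow (h : A.IsPolystableRoot) : A.IsUnitRootFlow A.flow :=
  h.2.isSemistable.isUnitRootFlow h.1.isRootFlow

theorem IsQuasistableRoot.isUnitRootFlow {v₀ : Γ.V} (h : A.IsQuasistableRoot v₀) :
    A.IsUnitRootFlow A.flow :=
  h.2.isSemistable.isUnitRootFlow h.1.isRootFlow

namespace IsUnitRootFlow

variable {φ : A.graph.Flow}

/-- At an exceptional vertex `K = 0` and `D = -1`, so the inflow is `2`, shared by two half-edges
that carry at most `1` each. -/
theorem val_half (hφ : A.IsUnitRootFlow φ) {e : Γ.E} (h : e ∈ A.S) (b : Bool) :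
    φ.val (half e h b, false) = 1 := by
  have h1 := hφ.1.2 (exc e h)
  have h2 : φ.div (exc e h) = φ.val (half e h false, false) + φ.val (half e h true, false) := by
    rw [Flow.div, sum_subdivide_dart, sum_dart_eq, Finset.sum_eq_single_of_mem e (Finset.mem_univ _)]
    · simp [target, h]
    · intro e' _ he
      by_cases h' : e' ∈ A.S
      · simp [target, h', he]
      · simp [target, h']
  have h3 := subdivide_canonicalDivisor_exc A.S e h
  have h4 := hφ.2 (half e h false, false)
  have h5 := hφ.2 (half e h true, false)
  rw [A.D_exc, h2] at h1
  have h6 : A.graph.canonicalDivisor (exc e h) = 0 := h3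
  rw [h6] at h1
  cases b <;> linarith

theorem val_half_true (hφ : A.IsUnitRootFlow φ) {e : Γ.E} (h : e ∈ A.S) (b : Bool) :
    φ.val (half e h b, true) = -1 := by
  have := φ.antisymm (half e h b) false
  rw [hφ.val_half h b] at this
  exact this

theorem offFlow_le_one (hφ : A.IsUnitRootFlow φ) (d : Γ.Dart) : A.offFlow φ d ≤ 1 := by
  by_cases h : d.1 ∈ A.S
  · rw [offFlow, dif_pos h]; norm_num
  · rw [offFlow_of_notMem φ h]; exact hφ.2 _

theorem neg_one_le_offFlow (hφ : A.IsUnitRootFlow φ) (d : Γ.Dart) : -1 ≤ A.offFlow φ d := by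
  have := hφ.offFlow_le_one (Dart.rev d)
  rw [offFlow_rev] at this
  linarith

/-- After saturation the only leaving half-edges of exceptional edges start at exceptional vertices;
they carry `-1` and contribute nothing. -/
theorem two_mul_betaRemoved (hφ : A.IsUnitRootFlow φ) (W : Finset Γ.V) :
    2 * A.betaRemoved W =
      ((∑ d, if d.1 ∉ A.S ∧ Leaves W d then A.offFlow φ d + 1 else 0 : ℤ) : ℝ) := by
  rw [betaRemoved_eq_beta, two_mul_beta hφ.1, sum_subdivide_dart]
  congr 1
  refine Finset.sum_congr rfl fun d _ => ?_
  by_cases h : d.1 ∈ A.S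
  · simp only [h, dif_pos, not_true_eq_false, false_and, if_false]
    rw [hφ.val_half, hφ.val_half_true]
    simp [Leaves, target]
  · simp only [h, dif_neg, not_false_eq_true, true_and, offFlow_of_notMem φ h]
    simp only [Leaves, target, source, subdivide_ends_keep, vtx_mem_saturate]
    rfl

theorem hasPolarizationDegree (hφ : A.IsRootFlow φ) : A.HasPolarizationDegree := by
  have h1 : ∑ v, φ.div v = 0 := by
    rw [sum_div, neg_eq_zero]
    exact Finset.sum_eq_zero fun d _ => if_neg fun h => h.2 (Finset.mem_univ _)
  have h2 : ∑ v, A.graph.canonicalDivisor v = 2 * ∑ v, A.D v := by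
    simp only [← hφ.2, Finset.sum_add_distrib, h1, ← Finset.mul_sum, add_zero]
  rw [HasPolarizationDegree]
  simp only [polarization_eq]
  rw [← Finset.sum_div, ← Int.cast_sum, h2]
  push_cast
  ring

/-- A root is polystable if and only if its flow vanishes outside `S`. -/
theorem isPolystable_iff (hφ : A.IsUnitRootFlow φ) :
    A.IsPolystable ↔ ∀ d, A.offFlow φ d = 0 := by
  constructor
  · intro hA
    have key : ∀ d, ¬ A.offFlow φ d < 0 := by
      intro d hd
      have hdS : d.1 ∉ A.S := by
        intro h
        rw [offFlow, dif_pos h] at hd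
        exact lt_irrefl _ hd
      obtain ⟨h, hpos, hzero⟩ := hφ.1.1.exists_height
      let t := h (vtx A.S (Γ.source d))
      -- Every non-exceptional edge leaving this superlevel set has flow `-1`, so `β` vanishes on it
      -- although the edge of `d` crosses it outside `S`. This contradicts strictness.
      let W : Finset Γ.V := Finset.univ.filter fun v => t ≤ h (vtx A.S v)
      have hlv : ∀ d' (h' : d'.1 ∉ A.S),
          Leaves W d' ↔ Leaves (Γ := A.graph) (superlevel h t) (keep d'.1 h', d'.2) := by
        intro d' h'
        simp [Leaves, W, superlevel, source, target]
      have h1 := hφ.two_mul_betaRemoved W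
      have h2 : ∑ d, (if d.1 ∉ A.S ∧ Leaves W d then A.offFlow φ d + 1 else 0) = 0 := by
        refine Finset.sum_eq_zero fun d' _ => ?_
        split_ifs with hl
        · have h3 := neg_of_leaves hpos hzero ((hlv d' hl.1).1 hl.2)
          rw [← offFlow_of_notMem φ hl.1] at h3
          have := hφ.neg_one_le_offFlow d'
          linarith
        · rfl
      have h4 : Leaves W d := (hlv d hdS).2
        (leaves_superlevel hpos (d := (keep d.1 hdS, d.2)) (by rwa [← offFlow_of_notMem φ hdS]))
      have h5 := (hA.2 W).2 ⟨d.1, ⟨d.2, h4⟩, hdS⟩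
      rw [h2] at h1
      simp only [Int.cast_zero] at h1
      linarith
    intro d
    have h1 := key d
    have h2 := key (Dart.rev d)
    rw [offFlow_rev] at h2
    omega
  · intro h0
    refine ⟨hasPolarizationDegree hφ.1, fun W => ⟨hφ.isSemistable W, ?_⟩⟩
    rintro ⟨e, ⟨b, hb⟩, he⟩
    have h1 := hφ.two_mul_betaRemoved W
    have h2 : 0 < ∑ d : Γ.Dart, (if d.1 ∉ A.S ∧ Leaves W d then A.offFlow φ d + 1 else 0) := by
      refine Finset.sum_pos' (fun d _ => ?_) ⟨(e, b), Finset.mem_univ _, ?_⟩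
      · rw [h0]
        split_ifs <;> norm_num
      · rw [if_pos ⟨he, hb⟩, h0]
        norm_num
    have h3 : (0 : ℝ) < ((∑ d : Γ.Dart,
        (if d.1 ∉ A.S ∧ Leaves W d then A.offFlow φ d + 1 else 0) : ℤ) : ℝ) := Int.cast_pos.2 h2
    linarith

/-- A root is quasistable if and only if all vertices can be reached from `v₀` along oriented edges
outside `S` on which the flow is nonnegative. -/
theorem isQuasistable_iff (hφ : A.IsUnitRootFlow φ) {v₀ : Γ.V} :
    A.IsQuasistable v₀ ↔ ∀ v, Γ.Reach (fun d => d.1 ∉ A.S ∧ 0 ≤ A.offFlow φ d) v₀ v := by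
  classical
  constructor
  · intro hA
    -- Non-exceptional edges leaving the set of reached vertices have flow `-1`, so `β = 0` on a set
    -- containing `v₀`. If it is proper, this contradicts strictness.
    let W : Finset Γ.V := Finset.univ.filter fun v =>
      Γ.Reach (fun d => d.1 ∉ A.S ∧ 0 ≤ A.offFlow φ d) v₀ v
    by_contra hc
    push Not at hc
    obtain ⟨v, hv⟩ := hc
    have hW : W ≠ Finset.univ := fun h => hv (Finset.mem_filter.1 (h ▸ Finset.mem_univ v)).2
    have hv₀ : v₀ ∈ W := Finset.mem_filter.2 ⟨Finset.mem_univ _, Relation.ReflTransGen.refl⟩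
    have h1 := (hA.2 _ (saturate_ne_univ hW)).2 (vtx_mem_saturate.2 hv₀)
    rw [← betaRemoved_eq_beta] at h1
    have h2 := hφ.two_mul_betaRemoved W
    rw [Finset.sum_eq_zero] at h2
    · simp only [Int.cast_zero] at h2
      linarith
    · intro d _
      split_ifs with hl
      · have h3 : ¬ 0 ≤ A.offFlow φ d := fun h =>
          hl.2.2 (Finset.mem_filter.2 ⟨Finset.mem_univ _,
            (Finset.mem_filter.1 hl.2.1).2.tail ⟨d, ⟨hl.1, h⟩, rfl, rfl⟩⟩)
        have := hφ.neg_one_le_offFlow d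
        omega
      · rfl
  · intro hr
    refine ⟨hasPolarizationDegree hφ.1, fun Z hZ => ⟨hφ.beta_nonneg Z, fun hv₀ => ?_⟩⟩
    -- A single leaving edge with nonnegative flow makes `β` positive. If `Z` contains all original
    -- vertices it misses an exceptional vertex, and a half-edge into it carries `1`; otherwise a
    -- path from `v₀` must leave `Z`.
    have hex : ∃ d, Leaves Z d ∧ 0 ≤ φ.val d := by
      by_cases hW : ∀ v, vtx A.S v ∈ Z
      · obtain ⟨x, hx⟩ := exists_notMem_of_ne_univ hZ
        rcases vtx_or_exc x with ⟨v, rfl⟩ | ⟨e, he, rfl⟩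
        · exact absurd (hW v) hx
        · exact ⟨(half e he false, false), ⟨hW _, hx⟩, by rw [hφ.val_half]; norm_num⟩
      · push Not at hW
        obtain ⟨v, hv⟩ := hW
        by_contra hc
        push Not at hc
        refine hv (Reach.invariant (p := fun v => vtx A.S v ∈ Z) (fun d hd hs => ?_) (hr v) hv₀)
        by_contra ht
        have h1 := hc (keep d.1 hd.1, d.2) ⟨hs, ht⟩
        rw [← offFlow_of_notMem φ hd.1] at h1
        omega
    obtain ⟨d, hd, hd'⟩ := hex
    have h1 := two_mul_beta hφ.1 Z
    have h2 : 0 < ∑ d, (if Leaves Z d then φ.val d + 1 else 0) := by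
      refine Finset.sum_pos' (fun d _ => ?_) ⟨d, Finset.mem_univ _, ?_⟩
      · have := hφ.neg_one_le d
        split_ifs <;> linarith
      · rw [if_pos hd]
        linarith
    have h3 : (0 : ℝ) < ((∑ d, (if Leaves Z d then φ.val d + 1 else 0) : ℤ) : ℝ) :=
      Int.cast_pos.2 h2
    linarith

end IsUnitRootFlow

end PseudoDivisor

open PseudoDivisor

/-- Divisors, canonical divisors and divisors of flows all push forward, so the root equation does
too. Acyclicity is the only property that may be lost, whence the hypothesis. -/
theorem TripleSpecialization.isUnitRootFlow {Γ Γ' : LegGraph n} {A : Γ.PseudoDivisor}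
    {B : Γ'.PseudoDivisor} (f : TripleSpecialization A B) {φ : A.graph.Flow}
    (hφ : A.IsUnitRootFlow φ) (hac : (f.hat.pushFlow φ).Acyclic) :
    B.IsUnitRootFlow (f.hat.pushFlow φ) := by
  refine ⟨⟨hac, fun v => ?_⟩, fun d => hφ.2 _⟩
  have h1 : (fun v => 2 * A.D v + φ.div v) = A.graph.canonicalDivisor := funext hφ.1.2
  have h2 := f.hat.push_canonicalDivisor
  rw [← h1, Specialization.pushDivisor_add, Specialization.pushDivisor_const_mul,
    Specialization.push_div, f.push] at h2
  exact congrFun h2 v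

end LegGraph

end

/-! ### Composition and factorization of specializations of triples and root-graphs -/

open Set Filter Topology

noncomputable section

namespace LegGraph

variable {n : ℕ}

namespace TripleSpecialization

variable {Γ Γ' Γ'' : LegGraph n} {A : Γ.PseudoDivisor} {B : Γ'.PseudoDivisor}
  {C : Γ''.PseudoDivisor}

theorem hat_vtx (f : TripleSpecialization A B) (v : Γ.V) :
    f.hat.vmap (vtx A.S v) = vtx B.S (f.base.vmap v) := f.compat_vertex v

/-- The composition of two specializations of triples. -/
def comp (f : TripleSpecialization A B) (g : TripleSpecialization B C) :
    TripleSpecialization A C where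
  base := f.base.comp g.base
  hat := f.hat.comp g.hat
  subset := fun e he => f.subset _ (g.subset e he)
  compat_vertex := fun v =>
    (congrArg g.hat.vmap (f.compat_vertex v)).trans (g.compat_vertex _)
  compat_edge := fun e =>
    (f.compat_edge _).trans (congrArg f.base.emap (g.compat_edge e))
  push := by rw [Specialization.comp_pushDivisor, f.push, g.push]

/-- Original vertices go to original vertices, so the end over the exceptional vertex of `e` must be
the exceptional one. -/
theorem half_of_mem (f : TripleSpecialization A B) {e : Γ'.E} (he : e ∈ B.S) (b : Bool) :
    ∃ c, f.hat.emap (half e he b) = half (f.base.emap e) (f.subset e he) c ∧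
      f.base.vmap (Γ.ends (f.base.emap e) c) = Γ'.ends e b ∧
      f.hat.vmap (exc (f.base.emap e) (f.subset e he)) = exc e he := by
  have h1 : Γ.edgeOver A.S (f.hat.emap (half e he b)) = f.base.emap e := f.compat_edge _
  have h2 := f.hat.map_ends (half e he b)
  rcases keep_or_half (f.hat.emap (half e he b)) with ⟨e₀, he₀, h⟩ | ⟨e₀, he₀, c, h⟩
  · rw [h, edgeOver_keep] at h1
    exact absurd (f.subset e he) (h1 ▸ he₀)
  · rw [h, edgeOver_half] at h1
    subst h1
    rw [h] at h2
    have h3 := h2 false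
    have h4 := h2 true
    have hf : f.hat.flip (half e he b) = false := by
      by_contra hf
      rw [Bool.not_eq_false] at hf
      rw [hf] at h4
      exact absurd ((f.hat_vtx _).symm.trans h4) vtx_ne_exc
    rw [hf] at h3 h4
    exact ⟨c, h, vtx_inj.1 ((f.hat_vtx _).symm.trans h3), h4⟩

/-- Only one edge of the target lies over `e`, so one half survives and the other is contracted,
which moves the exceptional vertex to the corresponding end. -/
theorem half_of_notMem (f : TripleSpecialization A B) {e : Γ'.E} (he : e ∉ B.S)
    (hA : f.base.emap e ∈ A.S) :
    ∃ c, f.hat.emap (keep e he) = half (f.base.emap e) hA c ∧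
      (∀ y, f.hat.emap y ≠ half (f.base.emap e) hA (!c)) ∧
      f.hat.vmap (exc (f.base.emap e) hA) =
        vtx B.S (f.base.vmap (Γ.ends (f.base.emap e) (!c))) := by
  have h1 : Γ.edgeOver A.S (f.hat.emap (keep e he)) = f.base.emap e := f.compat_edge _
  rcases keep_or_half (f.hat.emap (keep e he)) with ⟨e₀, he₀, h⟩ | ⟨e₀, he₀, c, h⟩
  · rw [h, edgeOver_keep] at h1
    exact absurd (h1 ▸ hA) he₀
  · rw [h, edgeOver_half] at h1
    subst h1
    have hc : ∀ y, f.hat.emap y ≠ half (f.base.emap e) hA (!c) := by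
      intro y hy
      have h3 := f.compat_edge y
      rw [hy, edgeOver_half] at h3
      have h4 := f.base.emap_inj h3
      rcases keep_or_half y with ⟨e₁, he₁, rfl⟩ | ⟨e₁, he₁, b, rfl⟩
      · rw [edgeOver_keep] at h4
        subst h4
        rw [h, half_inj] at hy
        simp at hy
      · rw [edgeOver_half] at h4
        exact he (h4 ▸ he₁)
    refine ⟨c, h, hc, ?_⟩
    rw [← f.hat_vtx]
    exact (f.hat.map_contracted _ hc).symm

theorem keep_of_notMem (f : TripleSpecialization A B) {e : Γ'.E} (he : e ∉ B.S)
    (hA : f.base.emap e ∉ A.S) : f.hat.emap (keep e he) = keep (f.base.emap e) hA := by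
  have h1 : Γ.edgeOver A.S (f.hat.emap (keep e he)) = f.base.emap e := f.compat_edge _
  rcases keep_or_half (f.hat.emap (keep e he)) with ⟨e₀, he₀, h⟩ | ⟨e₀, he₀, c, h⟩
  · rw [h, edgeOver_keep] at h1
    subst h1
    exact h
  · rw [h, edgeOver_half] at h1
    exact absurd (h1 ▸ he₀) hA

theorem exists_over (S : Finset Γ.E) (e : Γ.E) : ∃ x, Γ.edgeOver S x = e := by
  by_cases h : e ∈ S
  · exact ⟨half e h false, rfl⟩
  · exact ⟨keep e h, rfl⟩

theorem contracted_iff (f : TripleSpecialization A B) {x : A.graph.E} :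
    (∀ e', f.base.emap e' ≠ Γ.edgeOver A.S x) → ∀ y, f.hat.emap y ≠ x := by
  rintro h y rfl
  exact h _ (f.compat_edge y).symm

theorem exists_contracted_half (f : TripleSpecialization A B) {e : Γ.E} (he : e ∈ A.S)
    (h : ∀ e' ∈ B.S, f.base.emap e' ≠ e) :
    ∃ b, f.hat.vmap (exc e he) = vtx B.S (f.base.vmap (Γ.ends e b)) := by
  by_cases h' : ∃ e', f.base.emap e' = e
  · obtain ⟨e', rfl⟩ := h'
    obtain ⟨c, -, -, h2⟩ := f.half_of_notMem (fun he' => h e' he' rfl) he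
    exact ⟨_, h2⟩
  · refine ⟨false, ?_⟩
    rw [← f.hat_vtx]
    exact (f.hat.map_contracted (half e he false)
      (f.contracted_iff fun e' he' => h' ⟨e', he'⟩)).symm

theorem D_vtx (f : TripleSpecialization A B) (v' : Γ'.V) :
    B.D (vtx B.S v') = ∑ v ∈ Finset.univ.filter (fun v => f.base.vmap v = v'), A.D (vtx A.S v) -
      ∑ e, if h : e ∈ A.S then (if f.hat.vmap (exc e h) = vtx B.S v' then 1 else 0) else 0 := by
  have h1 := congrFun f.push (vtx B.S v')
  rw [← h1, Specialization.pushDivisor, Finset.sum_filter, sum_subdivide_V, Finset.sum_filter,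
    sub_eq_add_neg, ← Finset.sum_neg_distrib]
  congr 1
  · refine Finset.sum_congr rfl fun v _ => ?_
    rw [f.hat_vtx]
    exact if_congr vtx_inj rfl rfl
  · refine Finset.sum_congr rfl fun e _ => ?_
    by_cases h : e ∈ A.S
    · simp only [dif_pos h, A.D_exc]
      split_ifs <;> rfl
    · simp only [dif_neg h, neg_zero]

end TripleSpecialization

namespace RootSpecialization

variable {Γ Γ' Γ'' : LegGraph n} {A : Γ.PseudoDivisor} {B : Γ'.PseudoDivisor}
  {C : Γ''.PseudoDivisor}

/-- The composition of two specializations of root-graphs. -/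
def comp (f : RootSpecialization A B) (g : RootSpecialization B C) : RootSpecialization A C where
  toTripleSpecialization := f.toTripleSpecialization.comp g.toTripleSpecialization
  push_flow := by
    change (f.hat.comp g.hat).pushFlow A.flow = _
    rw [Specialization.comp_pushFlow, f.push_flow, g.push_flow]

theorem comp_hat_incl (f : RootSpecialization A B) (g : RootSpecialization B C)
    (x : C.graph.E → ℝ) : (f.comp g).hat.incl x = f.hat.incl (g.hat.incl x) :=
  f.hat.comp_incl g.hat x

theorem inclKap_apply (f : RootSpecialization A B) (x : B.graph.E → ℝ) :
    f.inclKap x = A.cutSpace.mkQ (f.hat.incl x) := rfl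

theorem mapKap_mkQ (f : RootSpecialization A B) (x : B.graph.E → ℝ) :
    f.mapKap (B.cutSpace.mkQ x) = A.cutSpace.mkQ (f.hat.incl x) := rfl

theorem comp_inclKap (f : RootSpecialization A B) (g : RootSpecialization B C)
    (x : C.graph.E → ℝ) : (f.comp g).inclKap x = f.mapKap (g.inclKap x) := by
  rw [inclKap_apply, inclKap_apply, mapKap_mkQ, comp_hat_incl]

theorem flow_dart (f : RootSpecialization A B) (d : B.graph.Dart) :
    A.flow.val (f.hat.dart d) = B.flow.val d := congrArg (fun φ => Flow.val φ d) f.push_flow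

/-- If fewer edges are contracted by `g` than by `f`, then `f` factors through `g`. -/
theorem exists_factor (f : RootSpecialization A B) (g : RootSpecialization A C)
    (h : ∀ e, ∃ e', g.hat.emap e' = f.hat.emap e) :
    ∃ k : RootSpecialization C B, (∀ v, k.hat.vmap (g.hat.vmap v) = f.hat.vmap v) ∧
      ∀ d, g.hat.dart (k.hat.dart d) = f.hat.dart d := by
  obtain ⟨k₁, hv₁, hd₁⟩ := f.hat.exists_factor g.hat h
  have h0 : ∀ e, ∃ e', g.base.emap e' = f.base.emap e := by
    intro e
    obtain ⟨x, rfl⟩ := TripleSpecialization.exists_over B.S e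
    obtain ⟨y, hy⟩ := h x
    refine ⟨Γ''.edgeOver C.S y, ?_⟩
    rw [← g.compat_edge, ← f.compat_edge, hy]
  obtain ⟨k₀, hv₀, hd₀⟩ := f.base.exists_factor g.base h0
  have he₁ : ∀ x, g.hat.emap (k₁.emap x) = f.hat.emap x := fun x =>
    congrArg Prod.fst (hd₁ (x, false))
  have he₀ : ∀ x, g.base.emap (k₀.emap x) = f.base.emap x := fun x =>
    congrArg Prod.fst (hd₀ (x, false))
  have hedge : ∀ x, Γ''.edgeOver C.S (k₁.emap x) = k₀.emap (Γ'.edgeOver B.S x) := by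
    intro x
    apply g.base.emap_inj
    rw [← g.compat_edge, he₁, f.compat_edge, he₀]
  refine ⟨⟨⟨k₀, k₁, ?_, ?_, hedge, ?_⟩, ?_⟩, hv₁, hd₁⟩
  · intro e he
    by_contra hc
    -- If the image of `e` were not exceptional for `C`, both halves of `e` would be sent to the one
    -- edge over it.
    have key : ∀ b, k₁.emap (half e he b) = keep (k₀.emap e) hc := by
      intro b
      have h1 := hedge (half e he b)
      rcases keep_or_half (k₁.emap (half e he b)) with ⟨e₀, he₀, h⟩ | ⟨e₀, he₀, c, h⟩
      · rw [h, edgeOver_keep, edgeOver_half] at h1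
        subst h1
        exact h
      · rw [h, edgeOver_half, edgeOver_half] at h1
        exact absurd (h1 ▸ he₀) hc
    have := k₁.emap_inj ((key false).trans (key true).symm)
    rw [half_inj] at this
    exact absurd this.2 Bool.false_ne_true
  · intro w
    obtain ⟨v, rfl⟩ := g.base.vmap_surj w
    have h1 := hv₁ (vtx A.S v)
    rw [g.hat_vtx, f.hat_vtx, ← hv₀] at h1
    exact h1
  · rw [← f.push, ← g.push]
    funext x
    have := sum_fiber_fiber g.hat.vmap k₁.vmap A.D x
    simp only [hv₁] at this
    exact this
  · refine Flow.ext fun d => ?_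
    change C.flow.val (k₁.dart d) = _
    rw [← g.flow_dart, hd₁, f.flow_dart]

end RootSpecialization

namespace Specialization

/-- The identity. -/
def refl (Γ : LegGraph n) : Specialization Γ Γ :=
  mkOfCanonical id id (fun _ => false) Function.surjective_id Function.injective_id
    (fun _ b => by simp) (fun e he => absurd rfl (he e))
    (fun u v h => by cases (h : u = v); exact Relation.ReflTransGen.refl)
    (fun v => by simp [Finset.filter_eq']) (fun _ => rfl)

end Specialization

end LegGraph

end

/-! ### Polystable roots, the root `pol(B)`, and the order over a fixed graph -/

open Set Filter Topology

noncomputable section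

namespace LegGraph

variable {n : ℕ} {Γ Γ' : LegGraph n}

namespace PseudoDivisor

theorem IsUnitRootFlow.div_vtx {A : Γ.PseudoDivisor} {φ : A.graph.Flow}
    (hφ : A.IsUnitRootFlow φ) (v : Γ.V) :
    φ.div (vtx A.S v) = (∑ d, if Γ.target d = v then A.offFlow φ d else 0) - Γ.degIn A.S v := by
  rw [Flow.div, sum_subdivide_dart, degIn_eq_sum_int, ← Finset.sum_sub_distrib]
  refine Finset.sum_congr rfl fun d _ => ?_
  by_cases h : d.1 ∈ A.S
  · have h2 : A.graph.target (half d.1 h d.2, false) = exc d.1 h := rfl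
    have h3 : A.graph.target (half d.1 h d.2, true) = vtx A.S (Γ.source d) := rfl
    have h4 : A.offFlow φ d = 0 := dif_pos h
    simp only [h2, h3, h4, exc_ne_vtx, if_false, vtx_inj, hφ.val_half_true, h, if_true,
      ite_self]
    split_ifs <;> rfl
  · have h2 : A.graph.target (keep d.1 h, d.2) = vtx A.S (Γ.target d) := rfl
    rw [dif_neg h]
    simp only [h2, vtx_inj, ← offFlow_of_notMem φ h, h, if_false, ite_self, sub_zero]

theorem IsUnitRootFlow.two_mul_D {A : Γ.PseudoDivisor} {φ : A.graph.Flow}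
    (hφ : A.IsUnitRootFlow φ) (v : Γ.V) :
    2 * A.D (vtx A.S v) = Γ.canonicalDivisor v + Γ.degIn A.S v -
      ∑ d, if Γ.target d = v then A.offFlow φ d else 0 := by
  have h1 := hφ.1.2 (vtx A.S v)
  rw [hφ.div_vtx, subdivide_canonicalDivisor_vtx] at h1
  linarith

theorem IsUnitRootFlow.sum_source_offFlow {Q : Γ.PseudoDivisor}
    (hQ : Q.IsUnitRootFlow Q.flow) (v : Γ.V) :
    ∑ d, (if Γ.source d = v then Q.offFlow Q.flow d else 0) =
      2 * Q.D (vtx Q.S v) - Γ.canonicalDivisor v - Γ.degIn Q.S v := by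
  have h : ∑ d, (if Γ.target d = v then Q.offFlow Q.flow d else 0) =
      -∑ d, if Γ.source d = v then Q.offFlow Q.flow d else 0 := by
    rw [← sum_dart_rev, ← Finset.sum_neg_distrib]
    refine Finset.sum_congr rfl fun d _ => ?_
    rw [offFlow_rev, target_rev]
    split_ifs <;> simp
  have h1 := hQ.two_mul_D v
  linarith

/-- The flow on `Γ^S` with value `1` towards the exceptional vertices and zero outside `S`. -/
def stdFlow (S : Finset Γ.E) : (Γ.subdivide S).Flow where
  val := fun d => elimE S (fun _ _ => 0) (fun _ _ _ => if d.2 then -1 else 1) d.1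
  antisymm := by
    intro x b
    rcases keep_or_half x with ⟨e, h, rfl⟩ | ⟨e, h, c, rfl⟩ <;> cases b <;> simp

theorem stdFlow_keep (S : Finset Γ.E) {e : Γ.E} (h : e ∉ S) (b : Bool) :
    (stdFlow S).val (keep e h, b) = 0 := rfl

theorem stdFlow_half (S : Finset Γ.E) {e : Γ.E} (h : e ∈ S) (c b : Bool) :
    (stdFlow S).val (half e h c, b) = if b then -1 else 1 := rfl

theorem stdFlow_acyclic (S : Finset Γ.E) : (stdFlow S).Acyclic := by
  refine (stdFlow S).acyclic_of_height (h := elimV S (fun _ => 0) fun _ _ => 1) ?_ ?_ <;>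
  · rintro ⟨x, b⟩ hd
    rcases keep_or_half x with ⟨e, h, rfl⟩ | ⟨e, h, c, rfl⟩ <;> cases b <;>
      simp_all [stdFlow_keep, stdFlow_half, source, target]

theorem isUnitRootFlow_stdFlow {A : Γ.PseudoDivisor}
    (h : ∀ v, 2 * A.D (vtx A.S v) = Γ.canonicalDivisor v + Γ.degIn A.S v) :
    A.IsUnitRootFlow (stdFlow A.S) := by
  refine ⟨⟨stdFlow_acyclic A.S, fun x => ?_⟩, ?_⟩
  · rcases vtx_or_exc x with ⟨v, rfl⟩ | ⟨e, he, rfl⟩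
    · have h2 : (stdFlow A.S).div (vtx A.S v) = -Γ.degIn A.S v := by
        rw [Flow.div, sum_subdivide_dart, degIn_eq_sum_int, ← Finset.sum_neg_distrib]
        refine Finset.sum_congr rfl fun d _ => ?_
        by_cases h : d.1 ∈ A.S
        · have h2 : A.graph.target (half d.1 h d.2, false) = exc d.1 h := rfl
          have h3 : A.graph.target (half d.1 h d.2, true) = vtx A.S (Γ.source d) := rfl
          simp only [h2, h3, exc_ne_vtx, if_false, vtx_inj, stdFlow_half, h, if_true]
          split_ifs <;> rfl
        · simp only [dif_neg h, stdFlow_keep, h, if_false, ite_self, neg_zero]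
      rw [h2, h, subdivide_canonicalDivisor_vtx]
      ring
    · have h2 : (stdFlow A.S).div (exc e he) = 2 := by
        rw [Flow.div, sum_subdivide_dart, sum_dart_eq,
          Finset.sum_eq_single_of_mem e (Finset.mem_univ _)]
        · simp [target, he, stdFlow_half]
        · intro e' _ hne
          by_cases h' : e' ∈ A.S
          · simp [target, h', hne]
          · simp [target, h']
      rw [h2, A.D_exc, subdivide_canonicalDivisor_exc]
      rfl
  · rintro ⟨x, b⟩
    rcases keep_or_half x with ⟨e, h, rfl⟩ | ⟨e, h, c, rfl⟩
    · rw [stdFlow_keep]; norm_num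
    · rw [stdFlow_half]; split_ifs <;> norm_num

theorem offFlow_stdFlow (A : Γ.PseudoDivisor) (d : Γ.Dart) : A.offFlow (stdFlow A.S) d = 0 := by
  unfold offFlow
  split_ifs <;> rfl

/-- The flow of a polystable root is `stdFlow`: zero outside `S` and `1` into exceptional vertices.
The root equation at an original vertex then no longer involves an unknown flow. Conversely
`stdFlow` is always acyclic, with the exceptional vertices at height one. -/
theorem isPolystableRoot_iff {A : Γ.PseudoDivisor} : A.IsPolystableRoot ↔
    ∀ v, 2 * A.D (vtx A.S v) = Γ.canonicalDivisor v + Γ.degIn A.S v := by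
  constructor
  · intro h v
    rw [h.isUnitRootFlow.two_mul_D, Finset.sum_eq_zero, sub_zero]
    intro d _
    rw [h.isUnitRootFlow.isPolystable_iff.1 h.2, ite_self]
  · intro h
    have h1 := isUnitRootFlow_stdFlow h
    exact ⟨h1.isPseudoRoot, h1.isPolystable_iff.2 A.offFlow_stdFlow⟩

theorem IsPolystableRoot.flow_eq {A : Γ.PseudoDivisor} (h : A.IsPolystableRoot) :
    A.flow = stdFlow A.S := (isUnitRootFlow_stdFlow (isPolystableRoot_iff.1 h)).flow_eq

/-- A polystable root is determined by its set of exceptional edges. -/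
theorem IsPolystableRoot.ext {A B : Γ.PseudoDivisor} (hA : A.IsPolystableRoot)
    (hB : B.IsPolystableRoot) (h : A.S = B.S) : A = B := by
  refine PseudoDivisor.ext h fun v => ?_
  have h1 := isPolystableRoot_iff.1 hA v
  have h2 := isPolystableRoot_iff.1 hB v
  have h3 : Γ.degIn A.S v = Γ.degIn B.S v := by rw [h]
  rw [h3] at h1
  linarith

/-- The minimal polystable root above a semistable root. -/
def pol (B : Γ.PseudoDivisor) : Γ.PseudoDivisor where
  S := B.S ∪ Finset.univ.filter fun e => B.offFlow B.flow (e, false) ≠ 0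
  D := elimV _ (fun v => B.D (vtx B.S v) +
    ∑ d, if Γ.target d = v then (if B.offFlow B.flow d = 1 then 1 else 0) else 0) fun _ _ => -1
  exceptional := fun _ => rfl

theorem mem_pol_S {B : Γ.PseudoDivisor} {e : Γ.E} (b : Bool) :
    e ∈ B.pol.S ↔ e ∈ B.S ∨ B.offFlow B.flow (e, b) ≠ 0 := by
  have h := offFlow_rev B.flow (e, false)
  change B.offFlow B.flow (e, true) = _ at h
  cases b
  · simp [pol]
  · simp [pol, h]

theorem pol_D (B : Γ.PseudoDivisor) (v : Γ.V) : B.pol.D (vtx _ v) = B.D (vtx B.S v) +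
    ∑ d, if Γ.target d = v then (if B.offFlow B.flow d = 1 then 1 else 0) else 0 := rfl

/-- An edge newly made exceptional raises `deg_S` by one at each end. For `B`, its flow contributes
`-1` to `2D` at the head and `+1` at the tail, and `pol` adds `2` to `2D` at the head, so both ends
satisfy the equation for polystable roots. -/
theorem IsUnitRootFlow.isPolystableRoot_pol {B : Γ.PseudoDivisor}
    (hB : B.IsUnitRootFlow B.flow) : B.pol.IsPolystableRoot := by
  refine isPolystableRoot_iff.2 fun v => ?_
  have h1 : ∀ S : Finset Γ.E, (Γ.degIn S v : ℤ) =
      ∑ d : Γ.Dart, if Γ.target d = v then (if d.1 ∈ S then 1 else 0) else 0 := by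
    intro S
    rw [degIn_eq_sum_int, ← sum_dart_rev]
    rfl
  rw [pol_D, mul_add, hB.two_mul_D, h1, h1, Finset.mul_sum, sub_add, add_sub_assoc,
    ← Finset.sum_sub_distrib, ← Finset.sum_sub_distrib]
  congr 1
  refine Finset.sum_congr rfl fun d _ => ?_
  by_cases ht : Γ.target d = v
  · simp only [if_pos ht]
    have h2 := mem_pol_S (B := B) (e := d.1) d.2
    by_cases h : d.1 ∈ B.S
    · have h3 : B.offFlow B.flow d = 0 := dif_pos h
      simp [h, h2, h3]
    · have h4 := hB.offFlow_le_one d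
      have h5 := hB.neg_one_le_offFlow d
      simp only [h, h2, false_or, if_false]
      obtain h | h | h : B.offFlow B.flow d = -1 ∨ B.offFlow B.flow d = 0 ∨
          B.offFlow B.flow d = 1 := by omega
      all_goals simp [h]
  · simp only [if_neg ht, mul_zero, sub_zero]

end PseudoDivisor

namespace TripleSpecialization

/-- The specialization of triples over the identity given by the choice, for every edge in
`A.S \ B.S`, of the end to which the exceptional vertex is contracted. -/
def overId {A B : Γ.PseudoDivisor} (hsub : B.S ⊆ A.S) (c : Γ.E → Bool)
    (hc : ∀ v, B.D (vtx B.S v) = A.D (vtx A.S v) -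
      ∑ e, if e ∈ A.S ∧ e ∉ B.S ∧ Γ.ends e (c e) = v then 1 else 0) :
    TripleSpecialization A B where
  base := Specialization.refl Γ
  hat := (Specialization.refl Γ).liftSubdivide c hsub
  subset := hsub
  compat_vertex := fun _ => rfl
  compat_edge := (Specialization.refl Γ).edgeOver_liftEmap c hsub
  push := by
    funext x
    rcases vtx_or_exc x with ⟨v, rfl⟩ | ⟨e, he, rfl⟩
    · refine ((TripleSpecialization.toPush A (Specialization.refl Γ) c hsub).D_vtx v).trans ?_
      rw [hc]
      congr 1
      · change ∑ v' ∈ Finset.univ.filter (fun v' => v' = v), A.D (vtx A.S v') = _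
        rw [Finset.filter_eq' Finset.univ v]
        simp
      · refine Finset.sum_congr rfl fun e _ => ?_
        change (if h : e ∈ A.S then
          (if (Specialization.refl Γ).liftVmap A.S B.S c (exc e h) = vtx B.S v then 1 else 0)
          else 0) = _
        by_cases h : e ∈ A.S
        · by_cases h' : e ∈ B.S
          · have h3 := (Specialization.refl Γ).liftVmap_exc_of_mem A.S B.S c (e' := e) h h'
            change (Specialization.refl Γ).liftVmap A.S B.S c (exc e h) = _ at h3
            simp [h, h', h3]
          · have h3 := (Specialization.refl Γ).liftVmap_exc_of_notMem A.S B.S c (e' := e) h h'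
            change (Specialization.refl Γ).liftVmap A.S B.S c (exc e h) = _ at h3
            simp [h, h', h3]
        · simp [h]
    · rw [B.D_exc]
      exact (A.push (Specialization.refl Γ) c hsub).exceptional ⟨e, he⟩

theorem overId_isOverId {A B : Γ.PseudoDivisor} (hsub : B.S ⊆ A.S) (c : Γ.E → Bool)
    (hc : ∀ v, B.D (vtx B.S v) = A.D (vtx A.S v) -
      ∑ e, if e ∈ A.S ∧ e ∉ B.S ∧ Γ.ends e (c e) = v then 1 else 0) :
    (overId hsub c hc).IsOverId := ⟨fun _ => rfl, fun _ => rfl⟩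

end TripleSpecialization

namespace PseudoDivisor

/-- Combinatorial form of the relation `A ≥ B`. -/
theorem ge_iff {A B : Γ.PseudoDivisor} : A.Ge B ↔ B.S ⊆ A.S ∧ ∃ c : Γ.E → Bool, ∀ v,
    B.D (vtx B.S v) = A.D (vtx A.S v) -
      ∑ e, if e ∈ A.S ∧ e ∉ B.S ∧ Γ.ends e (c e) = v then 1 else 0 := by
  constructor
  · rintro ⟨f, hfv, hfe⟩
    have hsub : B.S ⊆ A.S := fun e he => by simpa [hfe] using f.subset e he
    refine ⟨hsub, ?_⟩
    have hc : ∀ e, ∃ c, ∀ h : e ∈ A.S, e ∉ B.S →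
        f.hat.vmap (exc e h) = vtx B.S (Γ.ends e c) := by
      intro e
      by_cases h : e ∈ A.S ∧ e ∉ B.S
      · obtain ⟨b, hb⟩ := f.exists_contracted_half h.1 fun e' he' => by
          rw [hfe]; rintro rfl; exact h.2 he'
        rw [hfv] at hb
        exact ⟨b, fun _ _ => hb⟩
      · exact ⟨false, fun h1 h2 => absurd ⟨h1, h2⟩ h⟩
    choose c hc using hc
    refine ⟨c, fun v => ?_⟩
    rw [f.D_vtx]
    congr 1
    · simp only [hfv]
      rw [Finset.filter_eq' Finset.univ v]
      simp
    · refine Finset.sum_congr rfl fun e _ => ?_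
      by_cases h : e ∈ A.S
      · by_cases h' : e ∈ B.S
        · obtain ⟨_, -, -, h3⟩ := f.half_of_mem h' false
          simp only [hfe] at h3
          simp only [h, h', dif_pos, h3, exc_ne_vtx, if_false, not_true_eq_false, false_and,
            and_false]
        · simp only [h, h', dif_pos, hc e h h', vtx_inj, not_false_eq_true, true_and]
      · simp [h]
  · rintro ⟨hsub, c, hc⟩
    exact ⟨TripleSpecialization.overId hsub c hc, TripleSpecialization.overId_isOverId hsub c hc⟩

theorem Ge.antisymm {A B : Γ.PseudoDivisor} (h : A.Ge B) (h' : B.Ge A) : A = B := by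
  obtain ⟨h1, c, hc⟩ := ge_iff.1 h
  obtain ⟨h2, -⟩ := ge_iff.1 h'
  refine PseudoDivisor.ext (Finset.Subset.antisymm h2 h1) fun v => ?_
  rw [hc, Finset.sum_eq_zero, sub_zero]
  intro e _
  exact if_neg fun he => he.2.1 (h2 he.1)

/-- Each new exceptional vertex is contracted to the head of the flow, so the surviving half is the
one at the tail, where `stdFlow` has the same direction and value as the flow of `B`. The last
clause records that halves at exceptional edges of `B` keep their ends, which is needed to compare
lengths. -/
theorem IsUnitRootFlow.exists_pol_specialization {B : Γ.PseudoDivisor}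
    (hB : B.IsUnitRootFlow B.flow) :
    ∃ f : RootSpecialization B.pol B, f.IsOverId ∧
      ∀ e (he : e ∈ B.S) b, ∃ h, f.hat.emap (half e he b) = half e h b := by
  have hsub : B.S ⊆ B.pol.S := fun e he => (mem_pol_S false).2 (Or.inl he)
  let c : Γ.E → Bool := fun e => decide (B.offFlow B.flow (e, false) = 1)
  have hrev : ∀ e, B.offFlow B.flow (e, true) = -B.offFlow B.flow (e, false) := fun e =>
    offFlow_rev B.flow (e, false)
  have hval : ∀ e, B.offFlow B.flow (e, false) ≠ 0 →
      B.offFlow B.flow (e, false) = 1 ∨ B.offFlow B.flow (e, false) = -1 := by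
    intro e he
    have h1 := hB.offFlow_le_one (e, false)
    have h2 := hB.neg_one_le_offFlow (e, false)
    omega
  have hc : ∀ v, B.D (vtx B.S v) = B.pol.D (vtx B.pol.S v) -
      ∑ e, if e ∈ B.pol.S ∧ e ∉ B.S ∧ Γ.ends e (c e) = v then 1 else 0 := by
    intro v
    rw [pol_D, add_sub_assoc, left_eq_add, sub_eq_zero, sum_dart_eq]
    refine Finset.sum_congr rfl fun e _ => ?_
    by_cases h : e ∈ B.S
    · have h3 : ∀ b, B.offFlow B.flow (e, b) = 0 := fun b => dif_pos h
      simp [h, h3]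
    · simp only [mem_pol_S (B := B) (e := e) false, h, false_or, hrev, target, Bool.not_false,
        Bool.not_true, not_false_eq_true, true_and, c]
      by_cases h0 : B.offFlow B.flow (e, false) = 0
      · simp [h0]
      · rcases hval e h0 with h1 | h1 <;> simp [h1]
  let f := TripleSpecialization.overId hsub c hc
  refine ⟨⟨f, Flow.ext ?_⟩, TripleSpecialization.overId_isOverId hsub c hc, fun e he b =>
    ⟨hsub he, ((Specialization.refl Γ).liftEmap_half c hsub he b).trans
      (congrArg (half e (hsub he)) (Bool.xor_false b))⟩⟩
  rintro ⟨x, b⟩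
  change B.pol.flow.val (f.hat.dart (x, b)) = _
  have hP := hB.isPolystableRoot_pol
  rw [hP.flow_eq]
  rcases keep_or_half x with ⟨e, h, rfl⟩ | ⟨e, h, b', rfl⟩
  · have hoff : B.flow.val (keep e h, b) = B.offFlow B.flow (e, b) :=
      (offFlow_of_notMem B.flow (d := (e, b)) h).symm
    by_cases h' : e ∈ B.pol.S
    · have h1 : f.hat.dart (keep e h, b) = (half e h' (xor (!(c e)) false), xor b (!(c e))) :=
        Prod.ext ((Specialization.refl Γ).liftEmap_keep_of_mem c hsub (e := e) h h')
          (congrArg (xor b) (if_pos h'))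
      rw [h1, stdFlow_half, hoff]
      rcases hval e (((mem_pol_S false).1 h').resolve_left h) with h2 | h2 <;> cases b <;>
        simp [h2, c, hrev]
    · have h1 : f.hat.dart (keep e h, b) = (keep e h', xor b false) :=
        Prod.ext ((Specialization.refl Γ).liftEmap_keep_of_notMem c hsub (e := e) h h')
          (congrArg (xor b) (if_neg h'))
      rw [h1, stdFlow_keep, hoff]
      by_contra hne
      exact h' ((mem_pol_S b).2 (Or.inr fun h2 => hne h2.symm))
  · have h1 : f.hat.dart (half e h b', b) = (half e (hsub h) (xor b' false), xor b false) := rfl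
    rw [h1, stdFlow_half]
    cases b
    · rw [hB.val_half]; rfl
    · rw [hB.val_half_true]; rfl

end PseudoDivisor

end LegGraph

end

/-! ### Minimality of `pol(B)`; shape of specializations from polystable roots -/

open Set Filter Topology

noncomputable section

namespace LegGraph

variable {n : ℕ} {Γ Γ' : LegGraph n}

namespace PseudoDivisor

theorem sum_degIn (S : Finset Γ.E) (W : Finset Γ.V) :
    ((∑ v ∈ W, Γ.degIn S v : ℕ) : ℝ) =
      ∑ e, if e ∈ S then ((if Γ.ends e false ∈ W then 1 else 0) +
        if Γ.ends e true ∈ W then 1 else 0 : ℝ) else 0 := by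
  have h1 : ∑ v ∈ W, Γ.degIn S v =
      ∑ d : Γ.Dart, if Γ.source d ∈ W then (if d.1 ∈ S then 1 else 0) else 0 := by
    rw [← sum_filter_sum_ite (fun v => v ∈ W)]
    simp only [degIn_eq_sum, Finset.filter_univ_mem]
  rw [h1, sum_dart_eq]
  push_cast
  refine Finset.sum_congr rfl fun e _ => ?_
  change ((if Γ.ends e false ∈ W then _ else _) + if Γ.ends e true ∈ W then _ else _) = _
  by_cases h1 : Γ.ends e false ∈ W <;> by_cases h2 : Γ.ends e true ∈ W <;>
    by_cases h3 : e ∈ S <;> simp [h1, h2, h3]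

/-- Contracting an exceptional vertex to the end `c e` moves its value `-1` there. Compared edge by
edge, `β` changes only if that end lies outside `W` and the other end inside, and then it grows by
`1`. -/
theorem betaRemoved_eq_of_ge {A B : Γ.PseudoDivisor} (hsub : B.S ⊆ A.S) (c : Γ.E → Bool)
    (hc : ∀ v, B.D (vtx B.S v) = A.D (vtx A.S v) -
      ∑ e, if e ∈ A.S ∧ e ∉ B.S ∧ Γ.ends e (c e) = v then 1 else 0) (W : Finset Γ.V) :
    B.betaRemoved W = A.betaRemoved W +
      ∑ e, if e ∈ A.S ∧ e ∉ B.S ∧ Γ.ends e (c e) ∉ W ∧ Γ.ends e (!c e) ∈ W then 1 else 0 := by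
  have e1 : ∀ C : Γ.PseudoDivisor, C.betaRemoved W = ((∑ v ∈ W, C.D (vtx C.S v) : ℤ) : ℝ) -
      ∑ v ∈ W, Γ.polarization v - ((∑ v ∈ W, Γ.degIn C.S v : ℕ) : ℝ) / 2 +
      (∑ e, if e ∉ C.S ∧ Γ.Crosses e W then 1 else 0) / 2 := by
    intro C
    rw [betaRemoved, Finset.sum_add_distrib, ← Finset.sum_div, Finset.card_filter]
    push_cast
    rw [← sub_sub]
    rfl
  have e2 : ((∑ v ∈ W, B.D (vtx B.S v) : ℤ) : ℝ) = ((∑ v ∈ W, A.D (vtx A.S v) : ℤ) : ℝ) -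
      ∑ e, if e ∈ A.S ∧ e ∉ B.S ∧ Γ.ends e (c e) ∈ W then 1 else 0 := by
    simp only [hc, Finset.sum_sub_distrib]
    rw [Finset.sum_comm]
    push_cast
    congr 1
    refine Finset.sum_congr rfl fun e _ => ?_
    by_cases h : e ∈ A.S ∧ e ∉ B.S
    · simp [h]
    · rw [if_neg fun h' => h ⟨h'.1, h'.2.1⟩]
      exact Finset.sum_eq_zero fun v _ => if_neg fun h' => h ⟨h'.1, h'.2.1⟩
  rw [e1, e1, e2, sum_degIn, sum_degIn, ← sub_eq_zero]
  have key : ∀ e, -(if e ∈ A.S ∧ e ∉ B.S ∧ Γ.ends e (c e) ∈ W then 1 else 0 : ℝ) -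
      (if e ∈ B.S then ((if Γ.ends e false ∈ W then 1 else 0) +
        if Γ.ends e true ∈ W then 1 else 0 : ℝ) else 0) / 2 +
      (if e ∉ B.S ∧ Γ.Crosses e W then 1 else 0) / 2 +
      (if e ∈ A.S then ((if Γ.ends e false ∈ W then 1 else 0) +
        if Γ.ends e true ∈ W then 1 else 0 : ℝ) else 0) / 2 -
      (if e ∉ A.S ∧ Γ.Crosses e W then 1 else 0) / 2 -
      (if e ∈ A.S ∧ e ∉ B.S ∧ Γ.ends e (c e) ∉ W ∧ Γ.ends e (!c e) ∈ W then 1 else 0) = 0 := by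
    intro e
    by_cases hA : e ∈ A.S
    · by_cases hB : e ∈ B.S
      · simp [hA, hB]
      · by_cases h1 : Γ.ends e false ∈ W <;> by_cases h2 : Γ.ends e true ∈ W <;>
          cases c e <;> simp [hA, hB, h1, h2, Crosses] <;> norm_num
    · have hB : e ∉ B.S := fun h => hA (hsub h)
      simp [hA, hB]
  have := Finset.sum_eq_zero fun e (_ : e ∈ Finset.univ) => key e
  simp only [Finset.sum_sub_distrib, Finset.sum_add_distrib, Finset.sum_neg_distrib,
    ← Finset.sum_div] at this
  linarith

/-- For an oriented edge with flow `1`, the superlevel set at its head has `β_B = 0`. For a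
polystable `C` above `B` this is `β_C` plus a nonnegative correction, so both vanish. Strictness for
`C` forces the edge to be exceptional in `C`, and vanishing of the correction forces contraction to
the head. These are exactly the choices of `pol`, so `C` specializes to it by keeping the remaining
ones. -/
theorem IsUnitRootFlow.isPol_pol {B : Γ.PseudoDivisor} (hB : B.IsUnitRootFlow B.flow) :
    B.pol.IsPol B := by
  obtain ⟨f, hf, -⟩ := hB.exists_pol_specialization
  refine ⟨hB.isPolystableRoot_pol.2, ⟨f.toTripleSpecialization, hf⟩, fun C hC hCB => ?_⟩
  obtain ⟨hsub, c, hc⟩ := ge_iff.1 hCB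
  obtain ⟨h, hpos, hzero⟩ := hB.1.1.exists_height
  have key : ∀ d, B.offFlow B.flow d = 1 → d.1 ∈ C.S ∧ c d.1 = !d.2 := by
    intro d hd
    have hdS : d.1 ∉ B.S := by
      intro h
      rw [offFlow, dif_pos h] at hd
      exact absurd hd (by norm_num)
    let t := h (vtx B.S (Γ.target d))
    let W : Finset Γ.V := Finset.univ.filter fun v => t ≤ h (vtx B.S v)
    have h1 := hB.two_mul_betaRemoved W
    have h2 : ∑ d, (if d.1 ∉ B.S ∧ Leaves W d then B.offFlow B.flow d + 1 else 0) = 0 := by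
      refine Finset.sum_eq_zero fun d' _ => ?_
      split_ifs with hl
      · have hlv : Leaves (Γ := B.graph) (superlevel h t) (keep d'.1 hl.1, d'.2) := by
          have := hl.2
          simpa [Leaves, W, superlevel, source, target] using this
        have h3 := neg_of_leaves hpos hzero hlv
        rw [← offFlow_of_notMem B.flow hl.1] at h3
        have := hB.neg_one_le_offFlow d'
        linarith
      · rfl
    rw [h2, betaRemoved_eq_of_ge hsub c hc, Int.cast_zero] at h1
    have h3 := hC.2 W
    have h4 : (0 : ℝ) ≤ ∑ e, if e ∈ C.S ∧ e ∉ B.S ∧ Γ.ends e (c e) ∉ W ∧ Γ.ends e (!c e) ∈ W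
        then 1 else 0 := Finset.sum_nonneg fun e _ => by split_ifs <;> norm_num
    have ht : Γ.target d ∈ W := by simp [W, t]
    have hs : Γ.source d ∉ W := by
      have h5 : h (vtx B.S (Γ.source d)) < h (vtx B.S (Γ.target d)) :=
        hpos (keep d.1 hdS, d.2) (by rw [← offFlow_of_notMem B.flow hdS, hd]; norm_num)
      simpa [W, t] using h5
    have h5 : d.1 ∈ C.S := by
      by_contra h5
      have := h3.2 ⟨d.1, ⟨!d.2, ht, by rw [Bool.not_not]; exact hs⟩, h5⟩
      linarith
    refine ⟨h5, ?_⟩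
    by_contra h6
    have h7 : c d.1 = d.2 := by
      revert h6
      cases c d.1 <;> cases d.2 <;> simp
    have h8 : (0 : ℝ) < ∑ e, if e ∈ C.S ∧ e ∉ B.S ∧ Γ.ends e (c e) ∉ W ∧ Γ.ends e (!c e) ∈ W
        then 1 else 0 := by
      refine Finset.sum_pos' (fun e _ => by split_ifs <;> norm_num) ⟨d.1, Finset.mem_univ _, ?_⟩
      rw [if_pos ⟨h5, hdS, by rw [h7]; exact hs, by rw [h7]; exact ht⟩]
      norm_num
    linarith [h3.1]
  have hval : ∀ e, B.offFlow B.flow (e, false) ≠ 0 → ∃ b, B.offFlow B.flow (e, b) = 1 := by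
    intro e he
    have h1 := hB.offFlow_le_one (e, false)
    have h2 := hB.neg_one_le_offFlow (e, false)
    have h3 : B.offFlow B.flow (e, true) = _ := offFlow_rev B.flow (e, false)
    obtain h | h : B.offFlow B.flow (e, false) = 1 ∨ B.offFlow B.flow (e, false) = -1 := by omega
    · exact ⟨false, h⟩
    · exact ⟨true, by rw [h3, h]; rfl⟩
  refine ge_iff.2 ⟨fun e he => ?_, c, fun v => ?_⟩
  · rcases (mem_pol_S false).1 he with he | he
    · exact hsub he
    · obtain ⟨b, hb⟩ := hval e he
      exact (key _ hb).1
  · rw [pol_D, hc, sub_add, sub_right_inj, sum_dart_eq, ← Finset.sum_sub_distrib]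
    refine Finset.sum_congr rfl fun e _ => ?_
    have h3 : B.offFlow B.flow (e, true) = _ := offFlow_rev B.flow (e, false)
    by_cases heB : e ∈ B.S
    · have h4 : ∀ b, B.offFlow B.flow (e, b) = 0 := fun b => dif_pos heB
      simp [heB, h4, mem_pol_S (B := B) (e := e) false]
    · by_cases h0 : B.offFlow B.flow (e, false) = 0
      · simp [heB, h0, h3, mem_pol_S (B := B) (e := e) false]
      · obtain ⟨b, hb⟩ := hval e h0
        obtain ⟨h5, h6⟩ := key _ hb
        simp only at h5 h6
        cases b
        · simp [heB, hb, h3, h5, h6, mem_pol_S (B := B) (e := e) false, target]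
        · rw [h3] at hb
          have h7 : B.offFlow B.flow (e, false) = -1 := by omega
          simp [heB, h7, h3, h5, h6, mem_pol_S (B := B) (e := e) false, target]

theorem IsPol.unique {A A' B : Γ.PseudoDivisor} (h : A.IsPol B) (h' : A'.IsPol B) : A = A' :=
  Ge.antisymm (h'.2.2 A h.1 h.2.1) (h.2.2 A' h'.1 h'.2.1)

end PseudoDivisor

namespace RootSpecialization

variable {P : Γ.PseudoDivisor} {Q : Γ'.PseudoDivisor}

theorem ends_ne_of_flow_pos {G : LegGraph n} {φ : G.Flow} (hφ : φ.Acyclic) {e : G.E} {b : Bool}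
    (h : 0 < φ.val (e, b)) : G.ends e b ≠ G.ends e (!b) := by
  obtain ⟨h', hpos, -⟩ := hφ.exists_height
  intro he
  have := hpos (e, b) h
  simp only [source, target, he] at this
  exact lt_irrefl _ this

/-- The surviving half is directed into the exceptional vertex with flow `1`, so it becomes the edge
`e` with flow `1` leaving the corresponding end. Positive acyclic flow excludes loops, hence the
flow determines which half survives. -/
theorem keep_of_mem (f : RootSpecialization P Q) (hP : P.IsPolystableRoot)
    (hQ : Q.IsUnitRootFlow Q.flow) {e : Γ'.E} (he : e ∉ Q.S) (hA : f.base.emap e ∈ P.S) :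
    ∃ c b, f.hat.emap (keep e he) = half (f.base.emap e) hA c ∧
      (∀ y, f.hat.emap y ≠ half (f.base.emap e) hA (!c)) ∧ Q.flow.val (keep e he, b) = 1 ∧
      f.base.vmap (Γ.ends (f.base.emap e) c) = Γ'.ends e b ∧ Γ'.ends e b ≠ Γ'.ends e (!b) := by
  obtain ⟨c, h1, h2, -⟩ := f.half_of_notMem he hA
  have hd : f.hat.dart (keep e he, f.hat.flip (keep e he)) =
      (half (f.base.emap e) hA c, false) := Prod.ext h1 (Bool.xor_self _)
  have h3 : Q.flow.val (keep e he, f.hat.flip (keep e he)) = 1 := by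
    rw [← f.flow_dart, hd, hP.flow_eq]
    rfl
  have h4 := f.hat.vmap_source (keep e he, f.hat.flip (keep e he))
  rw [hd] at h4
  refine ⟨c, f.hat.flip (keep e he), h1, h2, h3, vtx_inj.1 ((f.hat_vtx _).symm.trans h4), ?_⟩
  intro h5
  exact ends_ne_of_flow_pos hQ.1.1 (e := keep e he) (by rw [h3]; norm_num)
    (congrArg (vtx Q.S) h5)

theorem flow_keep_of_notMem (f : RootSpecialization P Q) (hP : P.IsPolystableRoot)
    {e : Γ'.E} (he : e ∉ Q.S) (hA : f.base.emap e ∉ P.S) (b : Bool) :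
    Q.flow.val (keep e he, b) = 0 := by
  rw [← f.flow_dart, Specialization.dart, f.keep_of_notMem he hA, hP.flow_eq]
  rfl

/-- Edges over `P.S` either remain exceptional or acquire flow `±1`, and all others have flow zero.
Hence the exceptional set of `pol` is visible from any polystable root above. -/
theorem mem_pol_S_iff (f : RootSpecialization P Q) (hP : P.IsPolystableRoot)
    (hQ : Q.IsUnitRootFlow Q.flow) (e : Γ'.E) : e ∈ Q.pol.S ↔ f.base.emap e ∈ P.S := by
  by_cases he : e ∈ Q.S
  · exact ⟨fun _ => f.subset e he, fun _ => (PseudoDivisor.mem_pol_S false).2 (Or.inl he)⟩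
  · by_cases hA : f.base.emap e ∈ P.S
    · obtain ⟨c, b, -, -, h, -⟩ := f.keep_of_mem hP hQ he hA
      refine ⟨fun _ => hA, fun _ => (PseudoDivisor.mem_pol_S b).2 (Or.inr ?_)⟩
      rw [PseudoDivisor.offFlow_of_notMem (d := (e, b)) Q.flow he, h]
      norm_num
    · rw [PseudoDivisor.mem_pol_S false,
        PseudoDivisor.offFlow_of_notMem (d := (e, false)) Q.flow he]
      simp [he, hA, f.flow_keep_of_notMem hP]

theorem eq_pol {P Q : Γ.PseudoDivisor} (f : RootSpecialization P Q) (hP : P.IsPolystableRoot)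
    (hQ : Q.IsUnitRootFlow Q.flow) (hf : f.IsOverId) : P = Q.pol := by
  refine hP.ext hQ.isPolystableRoot_pol ?_
  ext e
  rw [f.mem_pol_S_iff hP hQ, hf.2]

end RootSpecialization

end LegGraph

end

/-! ### Factorization through `pol` -/

open Set Filter Topology

noncomputable section

namespace LegGraph

variable {n : ℕ} {Γ Γ' : LegGraph n}

open PseudoDivisor

theorem keep_inj {S : Finset Γ.E} {e e' : Γ.E} {h : e ∉ S} {h' : e' ∉ S} :
    keep e h = keep e' h' ↔ e = e' :=
  ⟨fun h => congrArg Subtype.val (Sum.inl_injective h), fun h => by subst h; rfl⟩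

theorem Specialization.incl_congr {f g : Specialization Γ Γ'} (h : ∀ e, f.emap e = g.emap e)
    (x : Γ'.E → ℝ) : f.incl x = g.incl x := by
  have : f.emap = g.emap := funext h
  change Function.extend f.emap x 0 = Function.extend g.emap x 0
  rw [this]

theorem TripleSpecialization.exists_half {A : Γ.PseudoDivisor} {B : Γ'.PseudoDivisor}
    (f : TripleSpecialization A B) {e : Γ'.E} (he : e ∈ B.S) :
    ∃ s, ∀ b, f.hat.emap (half e he b) = half (f.base.emap e) (f.subset e he) (xor b s) ∧
      f.base.vmap (Γ.ends (f.base.emap e) (xor b s)) = Γ'.ends e b := by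
  obtain ⟨c₀, h₀, h₀', -⟩ := f.half_of_mem he false
  obtain ⟨c₁, h₁, h₁', -⟩ := f.half_of_mem he true
  have hne : c₀ ≠ c₁ := by
    rintro rfl
    have := f.hat.emap_inj (h₀.trans h₁.symm)
    rw [half_inj] at this
    exact absurd this.2 Bool.false_ne_true
  refine ⟨c₀, fun b => ?_⟩
  cases b
  · rw [Bool.false_xor]
    exact ⟨h₀, h₀'⟩
  · have : xor true c₀ = c₁ := by
      revert hne
      cases c₀ <;> cases c₁ <;> simp
    rw [this]
    exact ⟨h₁, h₁'⟩

/-- A specialization to a polystable root with the full set of exceptional edges. -/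
theorem exists_rootSpecialization_full {P : Γ.PseudoDivisor} {P' : Γ'.PseudoDivisor}
    (hP : P.IsPolystableRoot) (hP' : P'.IsPolystableRoot) (f : Specialization Γ Γ')
    (hS : ∀ e, e ∈ P'.S ↔ f.emap e ∈ P.S) :
    ∃ h : RootSpecialization P P', h.base = f ∧
      ∀ x, h.hat.emap x = f.liftEmap P.S P'.S (fun _ => false) (fun e he => (hS e).1 he) x := by
  let t := TripleSpecialization.toPush P f (S' := P'.S) (fun _ => false) fun e he => (hS e).1 he
  -- Since no exceptional edge loses its exceptional vertex without being contracted, `stdFlow`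
  -- pushes forward to `stdFlow`. The push-forward of `P` is then a polystable root with exceptional
  -- set `P'.S`, hence has the same divisor as `P'`.
  have hpush : t.hat.pushFlow P.flow = stdFlow P'.S := by
    rw [hP.flow_eq]
    refine Flow.ext ?_
    rintro ⟨x, b⟩
    rcases keep_or_half x with ⟨e, he, rfl⟩ | ⟨e, he, c, rfl⟩
    · have he' : f.emap e ∉ P.S := fun h => he ((hS e).2 h)
      have h1 : t.hat.emap (keep e he) = keep (f.emap e) he' := 
        f.liftEmap_keep_of_notMem (fun _ => false) (fun e he => (hS e).1 he) he he'
      change (stdFlow P.S).val (t.hat.emap (keep e he), _) = _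
      rw [h1]
      rfl
    · change (if xor b false = true then (-1 : ℤ) else 1) = if b = true then -1 else 1
      rw [Bool.xor_false]
  have hu := t.isUnitRootFlow hP.isUnitRootFlow (by rw [hpush]; exact stdFlow_acyclic _)
  have hpol : (P.push f (S' := P'.S) (fun _ => false) fun e he => (hS e).1 he).IsPolystableRoot := by
    refine ⟨hu.isPseudoRoot, hu.isPolystable_iff.2 fun d => ?_⟩
    rw [hpush]
    exact PseudoDivisor.offFlow_stdFlow _ d
  have hD : t.hat.pushDivisor P.D = P'.D := by
    have : ∀ v, (P.push f (S' := P'.S) (fun _ => false) fun e he => (hS e).1 he).D (vtx P'.S v) =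
        P'.D (vtx P'.S v) := fun v => by
      have h1 := isPolystableRoot_iff.1 hpol v
      have h2 := isPolystableRoot_iff.1 hP' v
      exact mul_left_cancel₀ (two_ne_zero (α := ℤ)) (h1.trans h2.symm)
    funext x
    rcases vtx_or_exc x with ⟨v, rfl⟩ | ⟨e, he, rfl⟩
    · exact this v
    · exact (PseudoDivisor.exceptional _ ⟨e, he⟩).trans (P'.D_exc he).symm
  exact ⟨⟨⟨f, t.hat, t.subset, t.compat_vertex, t.compat_edge, hD⟩, by rw [hP'.flow_eq]; exact hpush⟩,
    rfl, fun _ => rfl⟩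

namespace RootSpecialization

variable {P : Γ.PseudoDivisor} {P' Q : Γ'.PseudoDivisor}

/-- A specialization from a polystable root factors through the minimal polystable root above its
target. -/
theorem exists_factor_pol (f : RootSpecialization P Q) (hP : P.IsPolystableRoot)
    (hQ : Q.IsUnitRootFlow Q.flow) (f' : RootSpecialization P' Q) (hf' : f'.IsOverId)
    (hP' : P'.IsPolystableRoot) :
    ∃ h : RootSpecialization P P', ∀ y, h.hat.emap (f'.hat.emap y) = f.hat.emap y := by
  have hset : ∀ e, e ∈ P'.S ↔ f.base.emap e ∈ P.S := by
    intro e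
    rw [f'.eq_pol hP' hQ hf', f.mem_pol_S_iff hP hQ]
  -- For a loop, `flip` of the base specialization is not determined by the vertices and need not
  -- match the way the two halves are mapped. The orientations are therefore re-chosen so as to
  -- match the given maps on halves.
  have hs : ∀ e, ∃ s, (∀ b, f.base.vmap (Γ.ends (f.base.emap e) (xor b s)) = Γ'.ends e b) ∧
      ∀ he : e ∈ Q.S, ∃ s₂, ∀ b (h : e ∈ P'.S), f'.hat.emap (half e he b) = half e h (xor b s₂) ∧
        f.hat.emap (half e he b) =
          half (f.base.emap e) ((hset e).1 h) (xor (xor b s₂) s) := by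
    intro e
    by_cases he : e ∈ Q.S
    · obtain ⟨s₁, h₁⟩ := f.exists_half he
      obtain ⟨s₂, h₂⟩ := f'.exists_half he
      have hx : ∀ b, xor b (xor s₁ s₂) = xor (xor b s₂) s₁ := by
        intro b
        cases b <;> cases s₁ <;> cases s₂ <;> rfl
      refine ⟨xor s₁ s₂, fun b => ?_, fun _ => ⟨s₂, fun b h => ⟨?_, ?_⟩⟩⟩
      · rw [hx, (h₁ _).2]
        have := (h₂ b).2
        rwa [hf'.1, hf'.2] at this
      · rw [(h₂ b).1, half_inj]
        exact ⟨hf'.2 e, rfl⟩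
      · rw [(h₁ b).1, half_inj]
        refine ⟨rfl, ?_⟩
        cases b <;> cases s₁ <;> cases s₂ <;> rfl
    · exact ⟨f.base.flip e, f.base.map_ends e, fun h => absurd h he⟩
  choose s hs₁ hs₂ using hs
  let g : Specialization Γ Γ' := { f.base with flip := s, map_ends := hs₁ }
  obtain ⟨h, hb, he⟩ := exists_rootSpecialization_full hP hP' g hset
  refine ⟨h, fun y => ?_⟩
  rw [he]
  rcases keep_or_half y with ⟨e, heQ, rfl⟩ | ⟨e, heQ, b, rfl⟩
  · by_cases hA : f.base.emap e ∈ P.S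
    · obtain ⟨c, b, h1, -, h2, h3, h4⟩ := f.keep_of_mem hP hQ heQ hA
      have hA' : f'.base.emap e ∈ P'.S := by rw [hf'.2]; exact (hset e).2 hA
      obtain ⟨c', b', h1', -, h2', h3', h4'⟩ := f'.keep_of_mem hP' hQ heQ hA'
      have hbb : b = b' := by
        by_contra hne
        have h5 : b' = !b := by revert hne; cases b <;> cases b' <;> simp
        rw [h5, Q.flow.antisymm, h2] at h2'
        norm_num at h2'
      subst hbb
      rw [hf'.1, hf'.2] at h3'
      have hc' : c' = b := by
        by_contra hne
        have h5 : c' = !b := by revert hne; cases b <;> cases c' <;> simp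
        rw [h5] at h3'
        exact h4 h3'.symm
      have h6 : f'.hat.emap (keep e heQ) = half e ((hset e).2 hA) b := by
        rw [h1', half_inj]
        exact ⟨hf'.2 e, hc'⟩
      rw [h6, h1, g.liftEmap_half, half_inj]
      refine ⟨rfl, ?_⟩
      change xor b (s e) = c
      by_contra hne
      have h7 : c = xor (!b) (s e) := by revert hne; cases b <;> cases c <;> cases s e <;> simp
      rw [h7, hs₁] at h3
      exact h4 h3.symm
    · have hA' : f'.base.emap e ∉ P'.S := by rw [hf'.2]; exact fun h => hA ((hset e).1 h)
      have hA'' : e ∉ P'.S := fun h => hA ((hset e).1 h)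
      have h6 : f'.hat.emap (keep e heQ) = keep e hA'' := by
        rw [f'.keep_of_notMem heQ hA', keep_inj]
        exact hf'.2 e
      rw [h6, f.keep_of_notMem heQ hA]
      exact g.liftEmap_keep_of_notMem _ _ hA'' hA
  · obtain ⟨s₂, h₂⟩ := hs₂ e heQ
    have hm : e ∈ P'.S := (hset e).2 (f.subset e heQ)
    rw [(h₂ b hm).1, (h₂ b hm).2]
    rfl

/-- All specializations over the identity from a polystable root to a given root retain the same
edges. -/
theorem exists_emap_eq_of_isOverId {P Q : Γ.PseudoDivisor} (hP : P.IsPolystableRoot)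
    (hQ : Q.IsUnitRootFlow Q.flow) {f f' : RootSpecialization P Q} (hf : f.IsOverId)
    (hf' : f'.IsOverId) (y : Q.graph.E) : ∃ y', f'.hat.emap y' = f.hat.emap y := by
  rcases keep_or_half y with ⟨e, heQ, rfl⟩ | ⟨e, heQ, b, rfl⟩
  · refine ⟨keep e heQ, ?_⟩
    by_cases hA : e ∈ P.S
    · have hA₁ : f.base.emap e ∈ P.S := by rwa [hf.2]
      have hA₂ : f'.base.emap e ∈ P.S := by rwa [hf'.2]
      obtain ⟨c, b, h1, -, h2, h3, h4⟩ := f.keep_of_mem hP hQ heQ hA₁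
      obtain ⟨c', b', h1', -, h2', h3', h4'⟩ := f'.keep_of_mem hP hQ heQ hA₂
      have hbb : b = b' := by
        by_contra hne
        have h5 : b' = !b := by revert hne; cases b <;> cases b' <;> simp
        rw [h5, Q.flow.antisymm, h2] at h2'
        norm_num at h2'
      subst hbb
      rw [hf'.1, hf'.2] at h3'
      rw [hf.1, hf.2] at h3
      rw [h1, h1', half_inj]
      refine ⟨(hf'.2 e).trans (hf.2 e).symm, ?_⟩
      by_contra hne
      have h7 : c = b := by
        by_contra hne
        have h5 : c = !b := by revert hne; cases b <;> cases c <;> simp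
        rw [h5] at h3
        exact h4 h3.symm
      have h8 : c' = !b := by revert hne; rw [h7]; cases b <;> cases c' <;> simp
      rw [h8] at h3'
      exact h4 h3'.symm
    · have hA₁ : f.base.emap e ∉ P.S := by rwa [hf.2]
      have hA₂ : f'.base.emap e ∉ P.S := by rwa [hf'.2]
      rw [f.keep_of_notMem heQ hA₁, f'.keep_of_notMem heQ hA₂, keep_inj, hf.2, hf'.2]
  · obtain ⟨s, h⟩ := f.exists_half heQ
    obtain ⟨s', h'⟩ := f'.exists_half heQ
    refine ⟨half e heQ (xor b (xor s s')), ?_⟩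
    rw [(h b).1, (h' _).1, half_inj, hf.2, hf'.2]
    refine ⟨rfl, ?_⟩
    cases b <;> cases s <;> cases s' <;> rfl

end RootSpecialization

end LegGraph

end

/-! ### Faces of cones, the cut space, and reachable representatives -/

open Set Filter Topology

noncomputable section

namespace LegGraph

variable {n : ℕ} {Γ Γ' : LegGraph n}

open PseudoDivisor

namespace PseudoDivisor

variable {A : Γ.PseudoDivisor}

theorem mem_Lam_iff {x : A.graph.E → ℝ} : x ∈ A.Lam ↔ ∃ F, A.graph.IsPotential A.flow x F := by
  refine exists_potential_iff (ψ := fun d => (A.flow.val d : ℝ) * x d.1) fun d => ?_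
  rw [Flow.val_rev]
  push_cast
  exact neg_mul _ _

end PseudoDivisor

theorem RootSpecialization.incl_mem_Lam_iff {A : Γ.PseudoDivisor} {B : Γ'.PseudoDivisor}
    (f : RootSpecialization A B) {x : B.graph.E → ℝ} : f.hat.incl x ∈ A.Lam ↔ x ∈ B.Lam := by
  rw [mem_Lam_iff, mem_Lam_iff, f.hat.exists_isPotential_iff, f.push_flow]

/-- A specialization of triples retaining exactly the edges where `z` is nonzero is a specialization
of root-graphs, and `z` lies in the interior of the corresponding face. -/
theorem PseudoDivisor.IsUnitRootFlow.exists_root_of_range {A : Γ.PseudoDivisor}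
    {B : Γ'.PseudoDivisor} (hA : A.IsUnitRootFlow A.flow) {z : A.graph.E → ℝ} (hz : z ∈ A.lam)
    (f : TripleSpecialization A B) (hf : ∀ x, (∃ y, f.hat.emap y = x) ↔ z x ≠ 0) :
    ∃ (f' : RootSpecialization A B) (x : B.graph.E → ℝ), f'.toTripleSpecialization = f ∧
      x ∈ B.lamInt ∧ f'.hat.incl x = z ∧ B.IsUnitRootFlow B.flow := by
  let x : B.graph.E → ℝ := fun e => z (f.hat.emap e)
  have hx : ∀ e, 0 < x e := fun e =>
    lt_of_le_of_ne (hz.2 _) (Ne.symm ((hf (f.hat.emap e)).1 ⟨e, rfl⟩))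
  have hi : f.hat.incl x = z := by
    funext e
    by_cases h : ∃ y, f.hat.emap y = e
    · obtain ⟨y, rfl⟩ := h
      rw [f.hat.incl_emap]
    · rw [f.hat.incl_contracted x fun y hy => h ⟨y, hy⟩]
      exact (not_not.1 fun h' => h ((hf e).2 h')).symm
  have hpot := hz.1
  rw [mem_Lam_iff, ← hi, f.hat.exists_isPotential_iff] at hpot
  obtain ⟨F, hF⟩ := hpot
  -- The pushed-forward flow has a potential for the positive vector `x`, so it is acyclic. By
  -- uniqueness it is the flow of `B`, and compatibility with flows is automatic.
  have hu := f.isUnitRootFlow hA (hF.acyclic hx)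
  have hflow := hu.flow_eq
  refine ⟨⟨f, hflow.symm⟩, x, rfl, ⟨?_, hx⟩, hi, hflow.symm ▸ hu⟩
  rw [mem_Lam_iff, hflow]
  exact ⟨F, hF⟩

/-- Every point of a cone lies in the interior of a face. -/
theorem PseudoDivisor.IsUnitRootFlow.exists_contraction {A : Γ.PseudoDivisor}
    (hA : A.IsUnitRootFlow A.flow) {z : A.graph.E → ℝ} (hz : z ∈ A.lam) :
    ∃ (Γ' : LegGraph n) (B : Γ'.PseudoDivisor) (f : RootSpecialization A B) (x : B.graph.E → ℝ),
      x ∈ B.lamInt ∧ f.hat.incl x = z ∧ B.IsUnitRootFlow B.flow := by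
  obtain ⟨Γ', B, f, hf⟩ := exists_tripleSpecialization A {e | z e = 0}
  obtain ⟨f', x, -, h⟩ := hA.exists_root_of_range hz f hf
  exact ⟨Γ', B, f', x, h⟩

/-- The differential of a function on the vertices, as a vector with coordinates at the half-edges
of exceptional edges. -/
def halfDiff (S : Finset Γ.E) (p : Γ.V → ℝ) : (Γ.subdivide S).E → ℝ :=
  elimE S (fun _ _ => 0) fun e _ b => p (Γ.ends e b) - p (Γ.ends e (!b))

@[simp] theorem halfDiff_keep (S : Finset Γ.E) (p : Γ.V → ℝ) {e : Γ.E} (h : e ∉ S) :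
    halfDiff S p (keep e h) = 0 := rfl

@[simp] theorem halfDiff_half (S : Finset Γ.E) (p : Γ.V → ℝ) {e : Γ.E} (h : e ∈ S) (b : Bool) :
    halfDiff S p (half e h b) = p (Γ.ends e b) - p (Γ.ends e (!b)) := rfl

theorem halfDiff_add (S : Finset Γ.E) (p q : Γ.V → ℝ) :
    halfDiff S (p + q) = halfDiff S p + halfDiff S q := by
  funext x
  rcases keep_or_half x with ⟨e, he, rfl⟩ | ⟨e, he, b, rfl⟩
  · simp
  · simp; ring

theorem halfDiff_smul (S : Finset Γ.E) (c : ℝ) (p : Γ.V → ℝ) :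
    halfDiff S (c • p) = c • halfDiff S p := by
  funext x
  rcases keep_or_half x with ⟨e, he, rfl⟩ | ⟨e, he, b, rfl⟩
  · simp
  · simp; ring

namespace PseudoDivisor

variable {A : Γ.PseudoDivisor}

theorem cutVector_eq (W : Finset Γ.V) :
    A.cutVector W = halfDiff A.S fun v => if v ∈ W then 1 else 0 := by
  funext x
  rcases keep_or_half x with ⟨e, he, rfl⟩ | ⟨e, he, b, rfl⟩
  · rfl
  · rw [halfDiff_half]
    change (if Γ.Crosses e W then (if Γ.ends e b ∈ W then 1 else -1) else 0 : ℝ) = _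
    by_cases h1 : Γ.ends e false ∈ W <;> by_cases h2 : Γ.ends e true ∈ W <;> cases b <;>
      simp [Crosses, h1, h2]

/-- Level sets of `p` are crossed only by edges of `S`, so their cut vectors lie in the space.
Subtracting the level set of a nonzero value decreases the support of `p`. -/
theorem halfDiff_mem_cutSpace {p : Γ.V → ℝ}
    (hp : ∀ e ∉ A.S, p (Γ.ends e false) = p (Γ.ends e true)) :
    halfDiff A.S p ∈ A.cutSpace := by
  induction hk : (Finset.univ.filter fun v => p v ≠ 0).card using Nat.strong_induction_on
    generalizing p with
  | _ k ih =>
    by_cases h0 : ∃ v, p v ≠ 0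
    · obtain ⟨v, hv⟩ := h0
      let W : Finset Γ.V := Finset.univ.filter fun u => p u = p v
      let q : Γ.V → ℝ := fun u => if u ∈ W then 1 else 0
      have hq : ∀ u, q u = if p u = p v then 1 else 0 := fun u => by simp [q, W]
      have hW : halfDiff A.S q ∈ A.cutSpace := by
        refine Submodule.subset_span ⟨W, fun e he => ?_, (cutVector_eq W).symm⟩
        by_contra hS
        obtain ⟨b, h1, h2⟩ := he
        have h3 := hp e hS
        simp only [W, Finset.mem_filter, Finset.mem_univ, true_and] at h1 h2
        cases b
        · exact h2 (h3.symm.trans h1)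
        · exact h2 (h3.trans h1)
      have h1 : p = (p + (-p v) • q) + (p v) • q := by
        funext u
        simp
      rw [h1, halfDiff_add, halfDiff_smul]
      refine Submodule.add_mem _ (ih _ ?_ ?_ rfl) (Submodule.smul_mem _ _ hW)
      · rw [← hk]
        refine Finset.card_lt_card ⟨fun u hu => ?_, fun h => ?_⟩
        · simp only [Finset.mem_filter, Finset.mem_univ, true_and, Pi.add_apply, Pi.smul_apply,
            smul_eq_mul, hq] at hu ⊢
          intro h
          rw [h] at hu
          by_cases h' : (0 : ℝ) = p v
          · exact hv h'.symm
          · simp [h'] at hu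
        · have h2 := h (Finset.mem_filter.2 ⟨Finset.mem_univ v, hv⟩)
          simp [hq] at h2
      · intro e he
        simp only [Pi.add_apply, Pi.smul_apply, smul_eq_mul, hq, hp e he]
    · have h1 : p = (0 : ℝ) • p := by
        funext u
        rw [zero_smul]
        exact not_not.1 fun h => h0 ⟨u, h⟩
      rw [h1, halfDiff_smul, zero_smul]
      exact Submodule.zero_mem _

theorem mem_cutSpace_iff {u : A.graph.E → ℝ} : u ∈ A.cutSpace ↔
    ∃ p : Γ.V → ℝ, (∀ e ∉ A.S, p (Γ.ends e false) = p (Γ.ends e true)) ∧ u = halfDiff A.S p := by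
  constructor
  · intro hu
    induction hu using Submodule.span_induction with
    | mem u hu =>
      obtain ⟨W, hW, rfl⟩ := hu
      refine ⟨_, fun e he => ?_, cutVector_eq W⟩
      have h1 : ¬ Γ.Crosses e W := fun h => he (hW e h)
      by_cases h2 : Γ.ends e false ∈ W <;> by_cases h3 : Γ.ends e true ∈ W <;>
        simp_all [Crosses]
    | zero =>
      refine ⟨0, fun _ _ => rfl, ?_⟩
      have := halfDiff_smul A.S 0 (0 : Γ.V → ℝ)
      rw [zero_smul, zero_smul] at this
      exact this.symm
    | add u v _ _ hu hv =>
      obtain ⟨p, hp, rfl⟩ := hu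
      obtain ⟨q, hq, rfl⟩ := hv
      exact ⟨p + q, fun e he => by simp [hp e he, hq e he], (halfDiff_add _ _ _).symm⟩
    | smul c u _ hu =>
      obtain ⟨p, hp, rfl⟩ := hu
      exact ⟨c • p, fun e he => by simp [hp e he], (halfDiff_smul _ _ _).symm⟩
  · rintro ⟨p, hp, rfl⟩
    exact halfDiff_mem_cutSpace hp

/-- An oriented edge that is not exceptional, or whose half at the target has length zero. -/
def Free (z : A.graph.E → ℝ) (d : Γ.Dart) : Prop := ∀ h : d.1 ∈ A.S, z (half d.1 h (!d.2)) = 0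

/-- At a free step `z` vanishes on the half at the target, so the increment of `p` is `-z'` there,
hence nonpositive; across non-exceptional edges `p` is constant. Applied in both directions, this is
the maximum principle behind uniqueness. -/
theorem le_of_reach {z z' : A.graph.E → ℝ} {p : Γ.V → ℝ} {v₀ : Γ.V} (hz' : ∀ e, 0 ≤ z' e)
    (hp : ∀ e ∉ A.S, p (Γ.ends e false) = p (Γ.ends e true)) (hd : z - z' = halfDiff A.S p)
    {v : Γ.V} (h : Γ.Reach (Free z) v₀ v) : p v ≤ p v₀ := by
  refine Reach.invariant (p := fun v => p v ≤ p v₀) (fun d hfree hle => ?_) h le_rfl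
  by_cases hS : d.1 ∈ A.S
  · have h1 := congrFun hd (half d.1 hS (!d.2))
    rw [Pi.sub_apply, halfDiff_half, hfree hS, Bool.not_not] at h1
    have h2 := hz' (half d.1 hS (!d.2))
    change p (Γ.ends d.1 (!d.2)) ≤ _
    change p (Γ.ends d.1 d.2) ≤ _ at hle
    linarith
  · have h1 := hp d.1 hS
    change p (Γ.ends d.1 (!d.2)) ≤ _
    change p (Γ.ends d.1 d.2) ≤ _ at hle
    cases h2 : d.2 <;> rw [h2] at hle
    · rwa [Bool.not_false, ← h1]
    · rwa [Bool.not_true, h1]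

/-- Every class modulo the cut space has at most one nonnegative representative for which all
vertices are reachable. -/
theorem eq_of_reach {z z' : A.graph.E → ℝ} {v₀ : Γ.V} (hz : ∀ e, 0 ≤ z e) (hz' : ∀ e, 0 ≤ z' e)
    (h : ∀ v, Γ.Reach (Free z) v₀ v) (h' : ∀ v, Γ.Reach (Free z') v₀ v)
    (hd : z - z' ∈ A.cutSpace) : z = z' := by
  obtain ⟨p, hp, hpd⟩ := mem_cutSpace_iff.1 hd
  have h1 : z' - z = halfDiff A.S ((-1 : ℝ) • p) := by
    rw [halfDiff_smul, ← hpd, neg_one_smul, neg_sub]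
  have h2 : ∀ v, p v = p v₀ := by
    intro v
    have h3 := le_of_reach hz' hp hpd (h v)
    have h4 := le_of_reach hz (fun e he => by simp [hp e he]) h1 (h' v)
    simp only [Pi.smul_apply, smul_eq_mul] at h4
    linarith
  rw [← sub_eq_zero, hpd]
  funext x
  rcases keep_or_half x with ⟨e, he, rfl⟩ | ⟨e, he, b, rfl⟩
  · rfl
  · rw [halfDiff_half, h2, h2 (Γ.ends e (!b)), sub_self]
    rfl

open Classical in
/-- Every nonnegative vector is congruent modulo the cut space to a nonnegative one for which all
vertices are reachable. -/
theorem exists_reach (hΓ : Γ.Connected) (v₀ : Γ.V) {y : A.graph.E → ℝ} (hy : ∀ e, 0 ≤ y e) :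
    ∃ z : A.graph.E → ℝ, (∀ e, 0 ≤ z e) ∧ (∀ v, Γ.Reach (Free z) v₀ v) ∧ z - y ∈ A.cutSpace := by
  induction hk : (Finset.univ.filter fun v => ¬ Γ.Reach (Free y) v₀ v).card using
    Nat.strong_induction_on generalizing y with
  | _ k ih =>
    by_cases h0 : ∀ v, Γ.Reach (Free y) v₀ v
    · exact ⟨y, hy, h0, by rw [sub_self]; exact Submodule.zero_mem _⟩
    · push Not at h0
      obtain ⟨v, hv⟩ := h0
      let R : Finset Γ.V := Finset.univ.filter fun v => Γ.Reach (Free y) v₀ v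
      have hR : ∀ v, v ∈ R ↔ Γ.Reach (Free y) v₀ v := fun v => by simp [R]
      let X : Finset Γ.Dart := Finset.univ.filter fun d => Leaves R d
      have hX : ∀ d, d ∈ X ↔ Leaves R d := fun d => by simp [X]
      have hS : ∀ d, Leaves R d → d.1 ∈ A.S := by
        intro d hd
        by_contra hS
        exact hd.2 ((hR _).2 (((hR _).1 hd.1).trans (Reach.single fun h => absurd h hS)))
      let len : Γ.Dart → ℝ := fun d => if h : d.1 ∈ A.S then y (half d.1 h (!d.2)) else 0
      have hne : X.Nonempty := by
        obtain ⟨d, hd⟩ := hΓ.exists_dart (W := (· ∈ R))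
          ((hR v₀).2 Relation.ReflTransGen.refl) fun h => hv ((hR v).1 h)
        exact ⟨d, (hX d).2 hd⟩
      obtain ⟨d₀, hd₀, hmin⟩ := X.exists_min_image len hne
      let q : Γ.V → ℝ := fun v => if v ∈ R then 1 else 0
      have hq : ∀ e ∉ A.S, q (Γ.ends e false) = q (Γ.ends e true) := by
        intro e he
        by_contra hne
        by_cases h1 : Γ.ends e false ∈ R <;> by_cases h2 : Γ.ends e true ∈ R
        · simp [q, h1, h2] at hne
        · exact he (hS (e, false) ⟨h1, h2⟩)
        · exact he (hS (e, true) ⟨h2, h1⟩)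
        · simp [q, h1, h2] at hne
      -- All edges leaving the reached set `R` are exceptional with a positive half at the target.
      -- Adding a multiple of the cut vector of `R` shortens these halves simultaneously; the
      -- smallest of them is the largest admissible amount. It keeps the vector nonnegative, changes
      -- nothing inside `R`, and frees `d₀`.
      let y' : A.graph.E → ℝ := y + len d₀ • halfDiff A.S q
      have hlen : ∀ d, 0 ≤ len d := fun d => by
        simp only [len]
        split_ifs
        · exact hy _
        · exact le_rfl
      have hy'half : ∀ e (he : e ∈ A.S) b, y' (half e he b) =
          y (half e he b) + len d₀ * (q (Γ.ends e b) - q (Γ.ends e (!b))) := fun _ _ _ => rfl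
      have hy' : ∀ e, 0 ≤ y' e := by
        intro x
        rcases keep_or_half x with ⟨e, he, rfl⟩ | ⟨e, he, b, rfl⟩
        · change 0 ≤ y _ + len d₀ * 0
          rw [mul_zero, add_zero]
          exact hy _
        · rw [hy'half]
          have h3 := hy (half e he b)
          have h4 := hlen d₀
          by_cases h1 : Γ.ends e b ∈ R <;> by_cases h2 : Γ.ends e (!b) ∈ R
          · simpa [q, h1, h2] using h3
          · simp only [q, h1, h2, if_true, if_false]
            linarith
          · simp only [q, h1, h2, if_true, if_false]
            have h5 := hmin (e, !b) ((hX _).2 ⟨h2, by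
              change Γ.ends e (!!b) ∉ R
              rwa [Bool.not_not]⟩)
            have h6 : len (e, !b) = y (half e he b) := by
              simp only [len, dif_pos he, Bool.not_not]
            linarith
          · simpa [q, h1, h2] using h3
      have hreach : ∀ v, Γ.Reach (Free y) v₀ v → Γ.Reach (Free y') v₀ v := by
        intro v hv
        induction hv with
        | refl => exact Relation.ReflTransGen.refl
        | @tail a b h1 hs ih =>
          obtain ⟨d, hd, rfl, rfl⟩ := hs
          refine ih.trans (Reach.single fun h => ?_)
          have h2 : Γ.source d ∈ R := (hR _).2 h1
          have h3 : Γ.target d ∈ R := (hR _).2 (h1.trans (Reach.single hd))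
          rw [hy'half, Bool.not_not, hd h]
          change Γ.ends d.1 d.2 ∈ R at h2
          change Γ.ends d.1 (!d.2) ∈ R at h3
          simp [q, h2, h3]
      have hd₀' := (hX d₀).1 hd₀
      have hnew : Γ.Reach (Free y') v₀ (Γ.target d₀) := by
        refine (hreach _ ((hR _).1 hd₀'.1)).trans (Reach.single fun h => ?_)
        have h2 : Γ.ends d₀.1 d₀.2 ∈ R := hd₀'.1
        have h3 : Γ.ends d₀.1 (!d₀.2) ∉ R := hd₀'.2
        rw [hy'half, Bool.not_not]
        simp [q, h2, h3, len, h]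
      have hcard : (Finset.univ.filter fun v => ¬ Γ.Reach (Free y') v₀ v).card < k := by
        rw [← hk]
        refine Finset.card_lt_card ⟨fun u hu => ?_, fun h => ?_⟩
        · exact Finset.mem_filter.2 ⟨Finset.mem_univ _, fun h =>
            (Finset.mem_filter.1 hu).2 (hreach u h)⟩
        · have h2 := h (Finset.mem_filter.2 ⟨Finset.mem_univ (Γ.target d₀), fun h' =>
            hd₀'.2 ((hR _).2 h')⟩)
          exact (Finset.mem_filter.1 h2).2 hnew
      obtain ⟨z, h1, h2, h3⟩ := ih _ hcard hy' rfl
      refine ⟨z, h1, h2, ?_⟩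
      have h4 : z - y = (z - y') + len d₀ • halfDiff A.S q := by
        simp only [y']
        abel
      rw [h4]
      exact Submodule.add_mem _ h3 (Submodule.smul_mem _ _ (halfDiff_mem_cutSpace hq))

end PseudoDivisor

namespace RootSpecialization

variable {P : Γ.PseudoDivisor} {Q : Γ'.PseudoDivisor}

/-- Since `x` is positive, a free step is either contracted or runs along an edge of `Γ'` outside
`Q.S`. If that edge comes from an exceptional edge of `P`, its contracted half sits at the head of
the flow, so free means following the flow; otherwise the flow is zero. Hence free reachability is
the criterion for quasistability, pulled back to `Γ`. -/
theorem reach_free_iff (f : RootSpecialization P Q) (hP : P.IsPolystableRoot)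
    (hQ : Q.IsUnitRootFlow Q.flow) {x : Q.graph.E → ℝ} (hx : ∀ e, 0 < x e) (v₀ : Γ.V) :
    (∀ v, Γ.Reach (Free (f.hat.incl x)) v₀ v) ↔ Q.IsQuasistable (f.base.vmap v₀) := by
  rw [hQ.isQuasistable_iff]
  constructor
  · intro h v'
    obtain ⟨v, rfl⟩ := f.base.vmap_surj v'
    refine f.base.reach_map (fun d hd => ?_) (h v)
    rcases f.base.exists_dart_or d with ⟨⟨e, b'⟩, rfl⟩ | hc
    · refine Or.inr ⟨(e, b'), ?_, (f.base.vmap_source _).symm, (f.base.vmap_target _).symm⟩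
      have he : e ∉ Q.S := by
        intro he
        obtain ⟨s, hs⟩ := f.exists_half he
        have h1 := hd (f.subset e he)
        have h2 := (hs (xor (!(f.base.dart (e, b')).2) s)).1
        rw [Bool.xor_assoc, Bool.xor_self, Bool.xor_false] at h2
        rw [show half (f.base.dart (e, b')).1 (f.subset e he) (!(f.base.dart (e, b')).2) = _
          from h2.symm, f.hat.incl_emap] at h1
        exact (hx _).ne' h1
      refine ⟨he, ?_⟩
      rw [offFlow_of_notMem (d := (e, b')) Q.flow he]
      by_cases hA : f.base.emap e ∈ P.S
      · obtain ⟨c, b, h1, -, h2, h3, h4⟩ := f.keep_of_mem hP hQ he hA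
        have h5 := hd hA
        have h6 : c = (f.base.dart (e, b')).2 := by
          by_contra hne
          have h7 : c = !(f.base.dart (e, b')).2 := by
            revert hne
            cases c <;> cases (f.base.dart (e, b')).2 <;> simp
          rw [← h7] at h5
          rw [show half (f.base.dart (e, b')).1 hA c = _ from h1.symm, f.hat.incl_emap] at h5
          exact (hx _).ne' h5
        have h7 := f.base.map_ends e b'
        change f.base.vmap (Γ.ends (f.base.emap e) (f.base.dart (e, b')).2) = _ at h7
        rw [← h6, h3] at h7
        have h8 : b = b' := by
          by_contra hne
          have h9 : b' = !b := by revert hne; cases b <;> cases b' <;> simp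
          rw [h9] at h7
          exact h4 h7
        rw [← h8, h2]
        norm_num
      · rw [f.flow_keep_of_notMem hP he hA]
    · exact Or.inl (f.base.vmap_eq_of_contracted d hc)
  · intro h v
    refine f.base.reach_lift (fun d hc hS => ?_) (fun d' hd' hS => ?_) (h (f.base.vmap v))
    · exact f.hat.incl_contracted x (f.contracted_iff hc)
    · obtain ⟨e, b'⟩ := d'
      obtain ⟨he, hoff⟩ := hd'
      obtain ⟨c, b, h1, hcon, h2, h3, h4⟩ := f.keep_of_mem hP hQ he hS
      rw [offFlow_of_notMem (d := (e, b')) Q.flow he] at hoff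
      have h8 : b' = b := by
        by_contra hne
        have h9 : b' = !b := by revert hne; cases b <;> cases b' <;> simp
        rw [h9, Q.flow.antisymm, h2] at hoff
        norm_num at hoff
      have h7 := f.base.map_ends e
      have h6 : c = (f.base.dart (e, b')).2 := by
        by_contra hne
        have h9 : c = xor (!b') (f.base.flip e) := by
          revert hne
          simp only [Specialization.dart]
          cases c <;> cases b' <;> cases f.base.flip e <;> simp
        rw [h9, h7, h8] at h3
        exact h4 h3.symm
      rw [← h6]
      exact f.hat.incl_contracted x hcon

end RootSpecialization

end LegGraph

end

/-! ### Injectivity and disjointness of the faces -/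

open Set Filter Topology

noncomputable section

namespace LegGraph

variable {n : ℕ} {Γ Γ₁ Γ₂ : LegGraph n}

open PseudoDivisor

theorem exists_forall_add_mul_pos {ι : Type*} [Finite ι] {a b : ι → ℝ}
    (h : ∀ i, 0 < a i ∨ (a i = 0 ∧ 0 < b i)) : ∃ ε > 0, ∀ i, 0 < a i + ε * b i := by
  have h1 : ∀ i, ∀ᶠ ε in 𝓝[>] (0 : ℝ), 0 < a i + ε * b i := by
    intro i
    rcases h i with h | ⟨h0, h⟩
    · have hc : ContinuousAt (fun ε : ℝ => a i + ε * b i) 0 := by fun_prop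
      have : ∀ᶠ ε in 𝓝 (0 : ℝ), 0 < a i + ε * b i :=
        hc.eventually (lt_mem_nhds (by simpa using h))
      exact this.filter_mono nhdsWithin_le_nhds
    · filter_upwards [self_mem_nhdsWithin] with ε hε
      rw [h0, zero_add]
      exact mul_pos hε h
  obtain ⟨ε, h2, h3⟩ := ((eventually_all.2 h1).and self_mem_nhdsWithin).exists
  exact ⟨ε, h3, h2⟩

namespace PseudoDivisor

variable {A : Γ.PseudoDivisor}

theorem add_mem_Lam {x y : A.graph.E → ℝ} (hx : x ∈ A.Lam) (hy : y ∈ A.Lam) : x + y ∈ A.Lam := by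
  rw [mem_Lam_iff] at *
  obtain ⟨F, hF⟩ := hx
  obtain ⟨G, hG⟩ := hy
  refine ⟨F + G, fun d => ?_⟩
  rw [Pi.add_apply, mul_add, hF, hG]
  simp only [Pi.add_apply]
  ring

/-- The differential of `p` has an explicit potential: `-2p` at original vertices and minus the sum
of the two end values at an exceptional vertex. Hence membership in `Λ` depends only on the class
modulo the cut space. -/
theorem IsPolystableRoot.cutSpace_le (hA : A.IsPolystableRoot) {u : A.graph.E → ℝ}
    (hu : u ∈ A.cutSpace) : u ∈ A.Lam := by
  obtain ⟨p, hp, rfl⟩ := mem_cutSpace_iff.1 hu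
  rw [mem_Lam_iff, hA.flow_eq]
  refine ⟨elimV A.S (fun v => -2 * p v) fun e _ => -p (Γ.ends e false) - p (Γ.ends e true), ?_⟩
  rintro ⟨x, b⟩
  rcases keep_or_half x with ⟨e, he, rfl⟩ | ⟨e, he, c, rfl⟩
  · have h1 := hp e he
    rw [stdFlow_keep]
    change _ = elimV A.S _ _ (vtx A.S (Γ.ends e (!b))) - elimV A.S _ _ (vtx A.S (Γ.ends e b))
    rw [elimV_vtx, elimV_vtx]
    cases b <;> simp [h1]
  · rw [stdFlow_half, halfDiff_half]
    cases b
    · change _ = elimV A.S _ _ (exc e he) - elimV A.S _ _ (vtx A.S (Γ.ends e c))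
      rw [elimV_vtx, elimV_exc]
      cases c <;> simp <;> ring
    · change _ = elimV A.S _ _ (vtx A.S (Γ.ends e c)) - elimV A.S _ _ (exc e he)
      rw [elimV_vtx, elimV_exc]
      cases c <;> simp <;> ring

theorem IsPolystableRoot.mem_Lam_of_sub (hA : A.IsPolystableRoot) {y z : A.graph.E → ℝ}
    (hy : y ∈ A.Lam) (h : z - y ∈ A.cutSpace) : z ∈ A.Lam := by
  have := add_mem_Lam hy (hA.cutSpace_le h)
  rwa [add_sub_cancel] at this

theorem mkQ_eq_iff {y z : A.graph.E → ℝ} :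
    A.cutSpace.mkQ z = A.cutSpace.mkQ y ↔ z - y ∈ A.cutSpace := by
  rw [Submodule.mkQ_apply, Submodule.mkQ_apply, Submodule.Quotient.eq]

end PseudoDivisor

section Same

variable {P : Γ.PseudoDivisor} {A : Γ₁.PseudoDivisor} {B : Γ₂.PseudoDivisor}

namespace RootSpecialization

theorem exists_factor_bijective (f : RootSpecialization P A) (f' : RootSpecialization P B)
    (h : ∀ e, (∃ y, f.hat.emap y = e) ↔ ∃ y, f'.hat.emap y = e) :
    ∃ α : RootSpecialization A B, Function.Bijective α.hat.emap ∧
      (∀ v, α.hat.vmap (f.hat.vmap v) = f'.hat.vmap v) ∧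
      ∀ d, f.hat.dart (α.hat.dart d) = f'.hat.dart d := by
  obtain ⟨k, hv, hd⟩ := f'.exists_factor f fun e => (h _).2 ⟨e, rfl⟩
  refine ⟨k, ⟨k.hat.emap_inj, fun y => ?_⟩, hv, hd⟩
  obtain ⟨y', hy'⟩ := (h (f.hat.emap y)).1 ⟨y, rfl⟩
  refine ⟨y', f.hat.emap_inj ?_⟩
  rw [← hy']
  exact congrArg Prod.fst (hd (y', false))

theorem image_eq_of_same {f : RootSpecialization P A} {f' : RootSpecialization P B}
    (h : SameSpecialization f f') : f.inclKap '' A.lamInt = f'.inclKap '' B.lamInt := by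
  obtain ⟨α, hα, -, hd⟩ := h
  have he : ∀ e, f.hat.emap (α.hat.emap e) = f'.hat.emap e := fun e =>
    congrArg Prod.fst (hd (e, false))
  have hi : ∀ x, f.hat.incl (α.hat.incl x) = f'.hat.incl x := fun x => by
    rw [← f.comp_hat_incl α]
    exact Specialization.incl_congr he x
  ext k
  constructor
  · rintro ⟨x, hx, rfl⟩
    have hx' : α.hat.incl (fun e => x (α.hat.emap e)) = x := by
      funext e
      obtain ⟨y, rfl⟩ := hα.2 e
      rw [α.hat.incl_emap]
    refine ⟨fun e => x (α.hat.emap e), ⟨?_, fun e => hx.2 _⟩, ?_⟩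
    · rw [← α.incl_mem_Lam_iff, hx']
      exact hx.1
    · rw [inclKap_apply, inclKap_apply, ← hi, hx']
  · rintro ⟨x, hx, rfl⟩
    refine ⟨α.hat.incl x, ⟨α.incl_mem_Lam_iff.2 hx.1, fun e => ?_⟩, ?_⟩
    · obtain ⟨y, rfl⟩ := hα.2 e
      rw [α.hat.incl_emap]
      exact hx.2 y
    · rw [inclKap_apply, inclKap_apply, hi]

theorem incl_mem_lam (f : RootSpecialization P A) {x : A.graph.E → ℝ} (hx : x ∈ A.lam) :
    f.hat.incl x ∈ P.lam := ⟨f.incl_mem_Lam_iff.2 hx.1, f.hat.incl_nonneg hx.2⟩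

theorem inclKap_mem_kap (f : RootSpecialization P A) {x : A.graph.E → ℝ} (hx : x ∈ A.lam) :
    f.inclKap x ∈ P.kap := ⟨_, f.incl_mem_lam hx, rfl⟩

/-- For positive vectors, the retained edges are the support of the extension by zero. -/
theorem exists_emap_iff_of_incl_eq (f : RootSpecialization P A) (f' : RootSpecialization P B)
    {x : A.graph.E → ℝ} {x' : B.graph.E → ℝ} (hx : ∀ e, 0 < x e) (hx' : ∀ e, 0 < x' e)
    (h : f.hat.incl x = f'.hat.incl x') (e : P.graph.E) :
    (∃ y, f.hat.emap y = e) ↔ ∃ y, f'.hat.emap y = e := by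
  constructor
  · rintro ⟨y, rfl⟩
    by_contra hc
    have h1 := congrFun h (f.hat.emap y)
    rw [f.hat.incl_emap, f'.hat.incl_contracted x' fun y' hy' => hc ⟨y', hy'⟩] at h1
    exact (hx y).ne' h1
  · rintro ⟨y, rfl⟩
    by_contra hc
    have h1 := congrFun h (f'.hat.emap y)
    rw [f'.hat.incl_emap, f.hat.incl_contracted x fun y' hy' => hc ⟨y', hy'⟩] at h1
    exact (hx' y).ne h1

variable [NeZero n]

theorem reach_of_isQuasistableRoot (f : RootSpecialization P A) (hP : P.IsPolystableRoot)
    (hA : A.IsQuasistableRoot (Γ₁.leg 0)) {x : A.graph.E → ℝ} (hx : ∀ e, 0 < x e) (v : Γ.V) :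
    Γ.Reach (Free (f.hat.incl x)) (Γ.leg 0) v := by
  refine (f.reach_free_iff hP hA.isUnitRootFlow hx _).2 ?_ v
  rw [f.base.map_leg]
  exact hA.2

/-- Faces with a common point in the interior agree there as vectors. -/
theorem incl_eq_of_inclKap_eq (f : RootSpecialization P A) (f' : RootSpecialization P B)
    (hP : P.IsPolystableRoot) (hA : A.IsQuasistableRoot (Γ₁.leg 0))
    (hB : B.IsQuasistableRoot (Γ₂.leg 0)) {x : A.graph.E → ℝ} {x' : B.graph.E → ℝ}
    (hx : ∀ e, 0 < x e) (hx' : ∀ e, 0 < x' e) (h : f.inclKap x = f'.inclKap x') :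
    f.hat.incl x = f'.hat.incl x' :=
  eq_of_reach (f.hat.incl_nonneg fun e => (hx e).le) (f'.hat.incl_nonneg fun e => (hx' e).le)
    (f.reach_of_isQuasistableRoot hP hA hx) (f'.reach_of_isQuasistableRoot hP hB hx')
    (mkQ_eq_iff.1 h)

theorem inclKap_injOn (f : RootSpecialization P A) (hP : P.IsPolystableRoot)
    (hA : A.IsQuasistableRoot (Γ₁.leg 0)) : Set.InjOn f.inclKap A.lamInt := fun _ hx _ hx' h =>
  f.hat.incl_injective (f.incl_eq_of_inclKap_eq f hP hA hA hx.2 hx'.2 h)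

/-- A common point has equal reachable representatives. Their common support makes the two
contractions retain the same edges, so each specialization factors through the other. -/
theorem disjoint_of_not_same (f : RootSpecialization P A) (f' : RootSpecialization P B)
    (hP : P.IsPolystableRoot) (hA : A.IsQuasistableRoot (Γ₁.leg 0))
    (hB : B.IsQuasistableRoot (Γ₂.leg 0)) (h : ¬ SameSpecialization f f') :
    Disjoint (f.inclKap '' A.lamInt) (f'.inclKap '' B.lamInt) := by
  rw [Set.disjoint_left]
  rintro _ ⟨x, hx, rfl⟩ ⟨x', hx', hxx⟩
  refine h (f.exists_factor_bijective f' (f.exists_emap_iff_of_incl_eq f' hx.2 hx'.2 ?_))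
  exact f.incl_eq_of_inclKap_eq f' hP hA hB hx.2 hx'.2 hxx.symm

end RootSpecialization

end Same

section OverId

variable {P A B : Γ.PseudoDivisor}

theorem RootSpecialization.isOverId_factor {f : RootSpecialization P A}
    {f' : RootSpecialization P B} (hf : f.IsOverId) (hf' : f'.IsOverId)
    (k : RootSpecialization A B) (hv : ∀ v, k.hat.vmap (f.hat.vmap v) = f'.hat.vmap v)
    (hd : ∀ d, f.hat.dart (k.hat.dart d) = f'.hat.dart d) : k.IsOverId := by
  constructor
  · intro v
    have h1 := hv (vtx P.S v)
    rw [f.hat_vtx, f'.hat_vtx, k.hat_vtx, hf.1, hf'.1] at h1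
    exact vtx_inj.1 h1
  · intro e
    obtain ⟨x, rfl⟩ := TripleSpecialization.exists_over B.S e
    have h1 : f.hat.emap (k.hat.emap x) = f'.hat.emap x := congrArg Prod.fst (hd (x, false))
    have h2 := congrArg (Γ.edgeOver P.S) h1
    rwa [f.compat_edge, f'.compat_edge, hf.2, hf'.2, k.compat_edge] at h2

theorem image_eq_of_isOverId {f f' : RootSpecialization P A} (hP : P.IsPolystableRoot)
    (hA : A.IsUnitRootFlow A.flow) (hf : f.IsOverId) (hf' : f'.IsOverId) :
    f.inclKap '' A.lamInt = f'.inclKap '' A.lamInt := by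
  refine RootSpecialization.image_eq_of_same (f.exists_factor_bijective f' fun e => ?_)
  constructor
  · rintro ⟨y, rfl⟩
    exact RootSpecialization.exists_emap_eq_of_isOverId hP hA hf hf' y
  · rintro ⟨y, rfl⟩
    exact RootSpecialization.exists_emap_eq_of_isOverId hP hA hf' hf y

variable [NeZero n]

/-- A common point would give `A ≥ B` and `B ≥ A` over the identity, and this relation is
antisymmetric. -/
theorem disjoint_of_ne {f : RootSpecialization P A} {f' : RootSpecialization P B}
    (hP : P.IsPolystableRoot) (hA : A.IsQuasistableRoot (Γ.leg 0))
    (hB : B.IsQuasistableRoot (Γ.leg 0)) (hf : f.IsOverId) (hf' : f'.IsOverId) (h : A ≠ B) :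
    Disjoint (f.inclKap '' A.lamInt) (f'.inclKap '' B.lamInt) := by
  rw [Set.disjoint_left]
  rintro _ ⟨x, hx, rfl⟩ ⟨x', hx', hxx⟩
  have hi := f.incl_eq_of_inclKap_eq f' hP hA hB hx.2 hx'.2 hxx.symm
  have hr := f.exists_emap_iff_of_incl_eq f' hx.2 hx'.2 hi
  obtain ⟨k, -, hv, hd⟩ := f.exists_factor_bijective f' hr
  obtain ⟨k', -, hv', hd'⟩ := f'.exists_factor_bijective f fun e => (hr e).symm
  exact h (Ge.antisymm
    ⟨k.toTripleSpecialization, RootSpecialization.isOverId_factor hf hf' k hv hd⟩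
    ⟨k'.toTripleSpecialization, RootSpecialization.isOverId_factor hf' hf k' hv' hd'⟩)

end OverId

end LegGraph

end

/-! ### The two decompositions -/

open Set Filter Topology

noncomputable section

namespace LegGraph

variable {n : ℕ} {Γ Γ' : LegGraph n}

open PseudoDivisor

/-- A point in the interior of a face given by a specialization over the identity from a polystable
root can be moved to a positive vector in its class. -/
theorem RootSpecialization.exists_pos_representative {P B : Γ.PseudoDivisor}
    (f : RootSpecialization P B) (hP : P.IsPolystableRoot) (hB : B.IsUnitRootFlow B.flow)
    (hf : f.IsOverId) {x : B.graph.E → ℝ} (hx : ∀ e, 0 < x e) :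
    ∃ p : Γ.V → ℝ, (∀ e ∉ P.S, p (Γ.ends e false) = p (Γ.ends e true)) ∧
      ∀ e, 0 < (f.hat.incl x + halfDiff P.S p) e := by
  obtain ⟨h, hpos, hzero⟩ := hB.1.1.exists_height
  -- The missing half-edges are those at the heads of the flow. The differential of the height is
  -- positive there, so a small multiple makes them positive without spoiling the other coordinates.
  -- Edges outside `P.S` have zero flow, so the height is constant across them.
  let p : Γ.V → ℝ := fun v => h (vtx B.S v)
  have hp : ∀ e ∉ P.S, p (Γ.ends e false) = p (Γ.ends e true) := by
    intro e he
    have he' : f.base.emap e ∉ P.S := by rwa [hf.2]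
    have heB : e ∉ B.S := fun h => he' (f.subset e h)
    exact hzero (keep e heB, false) (f.flow_keep_of_notMem hP heB he' false)
  have hd : ∀ e, 0 < f.hat.incl x e ∨ (f.hat.incl x e = 0 ∧ 0 < halfDiff P.S p e) := by
    intro y
    by_cases hy : ∃ y', f.hat.emap y' = y
    · obtain ⟨y', rfl⟩ := hy
      rw [f.hat.incl_emap]
      exact Or.inl (hx y')
    · refine Or.inr ⟨f.hat.incl_contracted x fun y' hy' => hy ⟨y', hy'⟩, ?_⟩
      rcases keep_or_half y with ⟨e, he, rfl⟩ | ⟨e, he, b, rfl⟩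
      · have he' : f.base.emap e ∉ P.S := by rwa [hf.2]
        have heB : e ∉ B.S := fun h => he' (f.subset e h)
        refine absurd ⟨keep e heB, ?_⟩ hy
        rw [f.keep_of_notMem heB he', keep_inj, hf.2]
      · by_cases heB : e ∈ B.S
        · obtain ⟨s, hs⟩ := f.exists_half heB
          refine absurd ⟨half e heB (xor b s), ?_⟩ hy
          rw [(hs _).1, half_inj, hf.2, Bool.xor_assoc, Bool.xor_self, Bool.xor_false]
          exact ⟨rfl, rfl⟩
        · have he' : f.base.emap e ∈ P.S := by rwa [hf.2]
          obtain ⟨c, b', h1, -, h2, h3, h4⟩ := f.keep_of_mem hP hB heB he'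
          have hcb : b = !c := by
            by_contra hne
            have : c = b := by revert hne; cases b <;> cases c <;> simp
            subst this
            refine hy ⟨keep e heB, ?_⟩
            rw [h1, half_inj, hf.2]
            exact ⟨rfl, rfl⟩
          rw [hf.1, hf.2] at h3
          have hcb' : b' = c := by
            by_contra hne
            have : c = !b' := by revert hne; cases b' <;> cases c <;> simp
            rw [this] at h3
            exact h4 h3.symm
          subst hcb'
          have h5 : p (Γ.ends e b') < p (Γ.ends e (!b')) :=
            hpos (keep e heB, b') (by rw [h2]; norm_num)
          rw [halfDiff_half, hcb, Bool.not_not]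
          linarith
  obtain ⟨ε, -, hε⟩ := exists_forall_add_mul_pos hd
  refine ⟨ε • p, fun e he => by simp [hp e he], fun e => ?_⟩
  rw [halfDiff_smul]
  exact hε e

theorem RootSpecialization.inclKap_mem_kapInt {P B : Γ.PseudoDivisor}
    (f : RootSpecialization P B) (hP : P.IsPolystableRoot) (hB : B.IsUnitRootFlow B.flow)
    (hf : f.IsOverId) {x : B.graph.E → ℝ} (hx : x ∈ B.lamInt) : f.inclKap x ∈ P.kapInt := by
  obtain ⟨p, hp, hpos⟩ := f.exists_pos_representative hP hB hf hx.2
  have hc : f.hat.incl x + halfDiff P.S p - f.hat.incl x ∈ P.cutSpace := by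
    rw [add_sub_cancel_left]
    exact halfDiff_mem_cutSpace hp
  exact ⟨_, ⟨hP.mem_Lam_of_sub (f.incl_mem_Lam_iff.2 hx.1) hc, hpos⟩, mkQ_eq_iff.2 hc⟩

/-- Every point of `κ` lies in the interior of a cone of a quasistable root-graph. -/
theorem PolystableRootGraph.exists_mem_image {g : ℕ} [NeZero n] (P : PolystableRootGraph g n)
    {k : P.root.KapSpace} (hk : k ∈ P.root.kap) :
    ∃ (Q : QuasistableRootGraph g n) (f : RootSpecialization P.root Q.root),
      k ∈ f.inclKap '' Q.root.lamInt := by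
  obtain ⟨y, hy, rfl⟩ := hk
  -- The support of the reachable representative dictates the contraction, and reachability makes
  -- its target quasistable.
  obtain ⟨z, hz, hreach, hzy⟩ := exists_reach P.base.connected (P.base.graph.leg 0) hy.2
  obtain ⟨Γ', B, f, x, hx, hxz, hB⟩ := P.isRoot.isUnitRootFlow.exists_contraction
    (z := z) ⟨P.isRoot.mem_Lam_of_sub hy.1 hzy, hz⟩
  have hq : B.IsQuasistable (Γ'.leg 0) := by
    rw [← f.base.map_leg, ← f.reach_free_iff P.isRoot hB hx.2, hxz]
    exact hreach
  have hk : f.inclKap x = P.root.cutSpace.mkQ y := by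
    rw [RootSpecialization.inclKap_apply, hxz]
    exact mkQ_eq_iff.2 hzy
  exact ⟨⟨P.base.specialize f.base, B, hB.isPseudoRoot, hq⟩, f, x, hx, hk⟩

/-- Every point of the interior of `κ` lies in the interior of the cone of a quasistable root on the
same graph. -/
theorem PseudoDivisor.IsPolystableRoot.exists_mem_image {P : Γ.PseudoDivisor} [NeZero n]
    (hP : P.IsPolystableRoot) (hΓ : Γ.Connected) {k : P.KapSpace} (hk : k ∈ P.kapInt) :
    ∃ (B : Γ.PseudoDivisor) (f : RootSpecialization P B), f.IsOverId ∧
      B.IsQuasistableRoot (Γ.leg 0) ∧ k ∈ f.inclKap '' B.lamInt := by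
  classical
  obtain ⟨y, hy, rfl⟩ := hk
  obtain ⟨z, hz, hreach, hzy⟩ := exists_reach hΓ (Γ.leg 0) fun e => (hy.2 e).le
  obtain ⟨p, hp, hpd⟩ := mem_cutSpace_iff.1 hzy
  have hkeep : ∀ e he, z (keep e he) = y (keep e he) := fun e he => by
    have := congrFun hpd (keep e he)
    rwa [Pi.sub_apply, halfDiff_keep, sub_eq_zero] at this
  -- Edge lengths are invariant modulo the cut space, so a positive class keeps every edge of `Γ`:
  -- at most one half of an exceptional edge vanishes. Hence the contraction can be taken over the
  -- identity, with `c` marking the vanishing half.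
  have hsum : ∀ e he, 0 < z (half e he false) + z (half e he true) := fun e he => by
    have h1 := congrFun hpd (half e he false)
    have h2 := congrFun hpd (half e he true)
    rw [Pi.sub_apply, halfDiff_half] at h1 h2
    have h3 := hy.2 (half e he false)
    have h4 := hy.2 (half e he true)
    simp only [Bool.not_false, Bool.not_true] at h1 h2
    linarith
  let S' : Finset Γ.E := Finset.univ.filter fun e => ∃ h : e ∈ P.S, ∀ b, z (half e h b) ≠ 0
  have hS' : ∀ e, e ∈ S' ↔ ∃ h : e ∈ P.S, ∀ b, z (half e h b) ≠ 0 := fun e => by simp [S']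
  let c : Γ.E → Bool := fun e => decide (∃ h : e ∈ P.S, z (half e h true) = 0)
  have hc : ∀ e (h : e ∈ P.S), e ∉ S' → z (half e h (c e)) = 0 ∧ z (half e h (!c e)) ≠ 0 := by
    intro e h he
    have h1 := hsum e h
    by_cases h2 : z (half e h true) = 0
    · have h3 : c e = true := decide_eq_true ⟨h, h2⟩
      rw [h3]
      refine ⟨h2, fun h4 => ?_⟩
      rw [Bool.not_true] at h4
      rw [h2, h4, add_zero] at h1
      exact lt_irrefl _ h1
    · have h3 : c e = false := decide_eq_false fun ⟨_, h4⟩ => h2 h4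
      rw [h3]
      refine ⟨?_, h2⟩
      by_contra h4
      refine he ((hS' e).2 ⟨h, fun b => ?_⟩)
      cases b
      · exact h4
      · exact h2
  have hsub : ∀ e ∈ S', (Specialization.refl Γ).emap e ∈ P.S := fun e he => ((hS' e).1 he).1
  let t := TripleSpecialization.toPush P (Specialization.refl Γ) c hsub
  have ht : ∀ x, (∃ y, t.hat.emap y = x) ↔ z x ≠ 0 := by
    intro x
    change (∃ y, (Specialization.refl Γ).liftEmap P.S S' c hsub y = x) ↔ _
    rcases keep_or_half x with ⟨e, he, rfl⟩ | ⟨e, he, b, rfl⟩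
    · have heS : e ∉ S' := fun h => he (hsub e h)
      refine ⟨fun _ => ?_, fun _ => ⟨keep e heS,
        (Specialization.refl Γ).liftEmap_keep_of_notMem c hsub (e := e) heS he⟩⟩
      rw [hkeep]
      exact (hy.2 _).ne'
    · by_cases heS : e ∈ S'
      · refine ⟨fun _ => ((hS' e).1 heS).2 b, fun _ => ⟨half e heS b, ?_⟩⟩
        refine ((Specialization.refl Γ).liftEmap_half c hsub heS b).trans ?_
        exact congrArg (half e he) (Bool.xor_false b)
      · obtain ⟨h1, h2⟩ := hc e he heS
        have hx : xor (c e) ((Specialization.refl Γ).flip e) = c e := Bool.xor_false _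
        by_cases hb : b = c e
        · refine ⟨fun h3 => ?_, fun h3 => absurd (hb ▸ h1) h3⟩
          obtain ⟨y, hy⟩ := h3
          refine absurd hy ?_
          have := (Specialization.refl Γ).liftEmap_ne_half c hsub (e := e) he heS y
          rw [hx, ← hb] at this
          exact this
        · have hb' : b = !c e := by revert hb; cases b <;> cases c e <;> simp
          refine ⟨fun _ => hb' ▸ h2, fun _ => ⟨keep e heS, ?_⟩⟩
          exact (Specialization.refl Γ).liftEmap_half_of_ne c hsub (e := e) he heS (by rwa [hx])
  obtain ⟨f, x, hft, hx, hxz, hB⟩ := hP.isUnitRootFlow.exists_root_of_range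
    (z := z) ⟨hP.mem_Lam_of_sub hy.1 hzy, hz⟩ t ht
  have hid : f.IsOverId := by
    rw [hft]
    exact ⟨fun _ => rfl, fun _ => rfl⟩
  have hq : (P.push (Specialization.refl Γ) c hsub).IsQuasistable (Γ.leg 0) := by
    have := f.reach_free_iff hP hB hx.2 (Γ.leg 0)
    rw [hxz, f.base.map_leg] at this
    exact this.1 hreach
  refine ⟨_, f, hid, ⟨hB.isPseudoRoot, hq⟩, x, hx, ?_⟩
  rw [RootSpecialization.inclKap_apply, hxz]
  exact mkQ_eq_iff.2 hzy

/-- The decomposition of the interior of `κ`. -/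
theorem PseudoDivisor.IsPolystableRoot.kapInt_decomposition {P : Γ.PseudoDivisor} [NeZero n]
    (hP : P.IsPolystableRoot) (hΓ : Γ.Connected) :
    (∀ B : Γ.PseudoDivisor, B.IsQuasistableRoot (Γ.leg 0) →
        P.IsPol B → ∃ f : RootSpecialization P B, f.IsOverId) ∧
      ∀ F : (∀ i : {B : Γ.PseudoDivisor // B.IsQuasistableRoot (Γ.leg 0) ∧ P.IsPol B},
          {f : RootSpecialization P i.1 // f.IsOverId}),
        (∀ i, Set.InjOn (F i).1.inclKap i.1.lamInt) ∧
        (∀ i j, i ≠ j →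
          Disjoint ((F i).1.inclKap '' i.1.lamInt) ((F j).1.inclKap '' j.1.lamInt)) ∧
        P.kapInt = ⋃ i, (F i).1.inclKap '' i.1.lamInt := by
  refine ⟨fun B hB hPB => ?_, fun F => ⟨fun i => (F i).1.inclKap_injOn hP i.2.1, fun i j hij =>
    disjoint_of_ne hP i.2.1 j.2.1 (F i).2 (F j).2 fun h => hij (Subtype.ext h), ?_⟩⟩
  · rw [hPB.unique hB.isUnitRootFlow.isPol_pol]
    obtain ⟨f, hf, -⟩ := hB.isUnitRootFlow.exists_pol_specialization
    exact ⟨f, hf⟩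
  · ext k
    rw [Set.mem_iUnion]
    constructor
    · intro hk
      obtain ⟨B, f, hf, hB, hkf⟩ := hP.exists_mem_image hΓ hk
      have hPB : P.IsPol B := by
        rw [f.eq_pol hP hB.isUnitRootFlow hf]
        exact hB.isUnitRootFlow.isPol_pol
      refine ⟨⟨B, hB, hPB⟩, ?_⟩
      -- The family `F` is arbitrary, but the image does not depend on the specialization chosen
      -- over the identity.
      rwa [image_eq_of_isOverId hP hB.isUnitRootFlow (F ⟨B, hB, hPB⟩).2 hf]
    · rintro ⟨i, x, hx, rfl⟩
      exact (F i).1.inclKap_mem_kapInt hP i.2.1.isUnitRootFlow (F i).2 hx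

/-- The decomposition of `κ`. -/
theorem PolystableRootGraph.kap_decomposition {g : ℕ} [NeZero n] (P : PolystableRootGraph g n) :
    (∀ (Q : QuasistableRootGraph g n) (f : RootSpecialization P.root Q.root),
        Set.InjOn f.inclKap Q.root.lamInt) ∧
      (∀ (Q Q' : QuasistableRootGraph g n) (f : RootSpecialization P.root Q.root)
        (f' : RootSpecialization P.root Q'.root),
        (SameSpecialization f f' →
          f.inclKap '' Q.root.lamInt = f'.inclKap '' Q'.root.lamInt) ∧
        (¬ SameSpecialization f f' →
          Disjoint (f.inclKap '' Q.root.lamInt) (f'.inclKap '' Q'.root.lamInt))) ∧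
      P.root.kap = ⋃ (Q : QuasistableRootGraph g n) (f : RootSpecialization P.root Q.root),
        f.inclKap '' Q.root.lamInt := by
  refine ⟨fun Q f => f.inclKap_injOn P.isRoot Q.isRoot, fun Q Q' f f' =>
    ⟨RootSpecialization.image_eq_of_same, f.disjoint_of_not_same f' P.isRoot Q.isRoot
      Q'.isRoot⟩, ?_⟩
  ext k
  simp only [Set.mem_iUnion]
  constructor
  · exact P.exists_mem_image
  · rintro ⟨Q, f, x, hx, rfl⟩
    exact f.inclKap_mem_kap ⟨hx.1, fun e => (hx.2 e).le⟩

end LegGraph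

end

/-! ### The map `rho` and its inverse -/

open Set Filter Topology

noncomputable section

theorem ConeDiagram.continuous_toSpace_comp {C C' : ConeDiagram} {i : C.Obj} {j : C'.Obj}
    {T : C.Amb i → C'.Amb j} (hT : Continuous T) (h : ∀ x ∈ C.cone i, T x ∈ C'.cone j) :
    Continuous fun x : C.cone i => C'.toSpace j ⟨T x, h x x.2⟩ :=
  continuous_quot_mk.comp (continuous_sigmaMk.comp
    ((hT.comp continuous_subtype_val).subtype_mk fun x => h x x.2))

namespace LegGraph

variable {g n : ℕ}

open PseudoDivisor

/-- The point of `T^trop` given by a point of a cone. -/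
def tPoint (P : PolystableRootGraph g n) (k : P.root.KapSpace) (hk : k ∈ P.root.kap) : TTrop g n :=
  (polystableDiagram g n).toSpace P ⟨k, hk⟩

theorem tPoint_mapKap {P P' : PolystableRootGraph g n} (h : RootSpecialization P'.root P.root)
    {k : P.root.KapSpace} (hk : k ∈ P.root.kap) {k' : P'.root.KapSpace} (hk' : k' ∈ P'.root.kap)
    (he : k' = h.mapKap k) : tPoint P' k' hk' = tPoint P k hk :=
  (Quot.sound ⟨h, he⟩).symm

theorem tPoint_congr {P : PolystableRootGraph g n} {k k' : P.root.KapSpace} {hk : k ∈ P.root.kap}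
    (h : k = k') : tPoint P k hk = tPoint P k' (h ▸ hk) := by
  subst h
  rfl

theorem lamInt_subset_lam {Γ : LegGraph n} {A : Γ.PseudoDivisor} {x : A.graph.E → ℝ}
    (hx : x ∈ A.lamInt) : x ∈ A.lam := ⟨hx.1, fun e => (hx.2 e).le⟩

theorem PseudoDivisor.continuous_inclKap {Γ Γ' : LegGraph n} {A : Γ.PseudoDivisor}
    {B : Γ'.PseudoDivisor} (f : RootSpecialization A B) : Continuous f.inclKap :=
  continuous_quot_mk.comp (LinearMap.continuous_of_finiteDimensional f.hat.incl)

theorem incl_mem_integralVectors {Γ Γ' : LegGraph n} (f : Specialization Γ Γ') {x : Γ'.E → ℝ}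
    (hx : x ∈ integralVectors Γ'.E) : f.incl x ∈ integralVectors Γ.E := by
  intro e
  by_cases h : ∃ y, f.emap y = e
  · obtain ⟨y, rfl⟩ := h
    rw [f.incl_emap]
    exact hx y
  · exact ⟨0, by rw [f.incl_contracted x fun y hy => h ⟨y, hy⟩, Int.cast_zero]⟩

variable [NeZero n]

/-- The point of `R^trop` given by a point of a cone. -/
def rPoint (Q : QuasistableRootGraph g n) (x : Q.root.graph.E → ℝ) (hx : x ∈ Q.root.lam) :
    RTrop g n :=
  (quasistableDiagram g n).toSpace Q ⟨x, hx⟩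

theorem rPoint_incl {Q Q' : QuasistableRootGraph g n} (h : RootSpecialization Q'.root Q.root)
    {x : Q.root.graph.E → ℝ} (hx : x ∈ Q.root.lam) {x' : Q'.root.graph.E → ℝ}
    (hx' : x' ∈ Q'.root.lam) (he : x' = h.hat.incl x) : rPoint Q' x' hx' = rPoint Q x hx :=
  (Quot.sound ⟨h, he⟩).symm

namespace QuasistableRootGraph

/-- The minimal polystable root-graph above a quasistable root-graph. -/
abbrev pol (Q : QuasistableRootGraph g n) : PolystableRootGraph g n where
  base := Q.base
  root := Q.root.pol
  isRoot := Q.isRoot.isUnitRootFlow.isPolystableRoot_pol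

/-- The specialization over the identity from the minimal polystable root-graph. -/
def polMap (Q : QuasistableRootGraph g n) : RootSpecialization Q.root.pol Q.root :=
  Q.isRoot.isUnitRootFlow.exists_pol_specialization.choose

theorem polMap_isOverId (Q : QuasistableRootGraph g n) : Q.polMap.IsOverId :=
  Q.isRoot.isUnitRootFlow.exists_pol_specialization.choose_spec.1

theorem polMap_half (Q : QuasistableRootGraph g n) {e : Q.base.graph.E} (he : e ∈ Q.root.S)
    (b : Bool) : ∃ h, Q.polMap.hat.emap (half e he b) = half e h b :=
  Q.isRoot.isUnitRootFlow.exists_pol_specialization.choose_spec.2 e he b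

/-- The map to `T^trop` on a cone. -/
def toPolystable (Q : QuasistableRootGraph g n) (x : Q.root.graph.E → ℝ) (hx : x ∈ Q.root.lam) :
    TTrop g n :=
  tPoint Q.pol (Q.polMap.inclKap x) (Q.polMap.inclKap_mem_kap hx)

/-- The specialization factors through `pol` with the same retained edges, and the gluing in
`T^trop` identifies the two points. This gives both the description of `rho` on every cone above and
its well-definedness. -/
theorem tPoint_inclKap {P : PolystableRootGraph g n} {Q : QuasistableRootGraph g n}
    (f : RootSpecialization P.root Q.root) {x : Q.root.graph.E → ℝ} (hx : x ∈ Q.root.lam) :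
    tPoint P (f.inclKap x) (f.inclKap_mem_kap hx) = toPolystable Q x hx := by
  obtain ⟨h, hh⟩ := f.exists_factor_pol P.isRoot Q.isRoot.isUnitRootFlow Q.polMap
    Q.polMap_isOverId Q.pol.isRoot
  refine tPoint_mapKap h _ _ ?_
  rw [← RootSpecialization.comp_inclKap, RootSpecialization.inclKap_apply,
    RootSpecialization.inclKap_apply]
  exact congrArg _ (Specialization.incl_congr (fun e => (hh e).symm) x)

theorem toPolystable_incl {Q Q' : QuasistableRootGraph g n}
    (f : RootSpecialization Q'.root Q.root) {x : Q.root.graph.E → ℝ} (hx : x ∈ Q.root.lam)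
    {x' : Q'.root.graph.E → ℝ} (hx' : x' ∈ Q'.root.lam) (h : x' = f.hat.incl x) :
    toPolystable Q' x' hx' = toPolystable Q x hx := by
  subst h
  rw [← tPoint_inclKap (P := Q'.pol) (RootSpecialization.comp Q'.polMap f) hx]
  refine tPoint_congr ?_
  rw [RootSpecialization.inclKap_apply, RootSpecialization.inclKap_apply,
    RootSpecialization.comp_hat_incl]

/-- Every point of a cone of a quasistable root-graph lies in the interior of the cone of a
quasistable root-graph. -/
theorem exists_lamInt (Q : QuasistableRootGraph g n) {x : Q.root.graph.E → ℝ}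
    (hx : x ∈ Q.root.lam) :
    ∃ (Q' : QuasistableRootGraph g n) (f : RootSpecialization Q.root Q'.root)
      (x' : Q'.root.graph.E → ℝ), x' ∈ Q'.root.lamInt ∧ f.hat.incl x' = x := by
  obtain ⟨Γ', B, f, x', hx', hxx, hB⟩ := Q.isRoot.isUnitRootFlow.exists_contraction hx
  have hP := Q.isRoot.isUnitRootFlow.isPolystableRoot_pol
  have hq : B.IsQuasistable (Γ'.leg 0) := by
    have h1 : ((Q.polMap.comp f).base.vmap (Q.base.graph.leg 0)) = Γ'.leg 0 := Specialization.map_leg _ _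
    -- Free reachability depends only on the support, so all lengths may be set to one. Contracting
    -- further only produces more zeros, hence more free steps, and quasistability is inherited.
    rw [← h1, ← (Q.polMap.comp f).reach_free_iff hP hB (x := fun _ => 1) fun _ => one_pos]
    intro v
    refine Reach.mono (fun d hd h => ?_)
      (Q.polMap.reach_of_isQuasistableRoot hP Q.isRoot (x := fun _ => 1) (fun _ => one_pos) v)
    have h2 := hd h
    rw [RootSpecialization.comp_hat_incl]
    by_cases h3 : ∃ y, Q.polMap.hat.emap y = half d.1 h (!d.2)
    · obtain ⟨y, hy⟩ := h3
      rw [← hy, Specialization.incl_emap] at h2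
      exact absurd h2 one_ne_zero
    · exact Specialization.incl_contracted _ _ fun y hy => h3 ⟨y, hy⟩
  exact ⟨⟨Q.base.specialize f.base, B, hB.isPseudoRoot, hq⟩, f, x', hx', hxx⟩

/-- Equal images come from equal reachable vectors, so the two root-graphs are related by a
specialization carrying one point to the other. Thus the chosen quasistable representative in
`ofPolystable` does not matter. -/
theorem rPoint_eq_of_inclKap_eq {P : PolystableRootGraph g n} {Q Q' : QuasistableRootGraph g n}
    (f : RootSpecialization P.root Q.root) (f' : RootSpecialization P.root Q'.root)
    {x : Q.root.graph.E → ℝ} (hx : x ∈ Q.root.lamInt) {x' : Q'.root.graph.E → ℝ}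
    (hx' : x' ∈ Q'.root.lamInt) (h : f.inclKap x = f'.inclKap x') :
    rPoint Q x (lamInt_subset_lam hx) = rPoint Q' x' (lamInt_subset_lam hx') := by
  have hi := f.incl_eq_of_inclKap_eq f' P.isRoot Q.isRoot Q'.isRoot hx.2 hx'.2 h
  obtain ⟨α, -, -, hd⟩ := f.exists_factor_bijective f'
    (f.exists_emap_iff_of_incl_eq f' hx.2 hx'.2 hi)
  refine rPoint_incl α _ _ (f.hat.incl_injective ?_)
  rw [hi, ← f.comp_hat_incl α]
  exact Specialization.incl_congr (fun e => (congrArg Prod.fst (hd (e, false))).symm) x'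

end QuasistableRootGraph

open QuasistableRootGraph

/-- The map `R^trop → T^trop`. -/
def rho : RTrop g n → TTrop g n :=
  Quot.lift (fun p => toPolystable p.1 p.2.1 p.2.2) (by
    rintro ⟨Q, x, hx⟩ ⟨Q', x', hx'⟩ ⟨f, hf⟩
    exact (toPolystable_incl f hx hx' hf).symm)

theorem rho_rPoint_eq {P : PolystableRootGraph g n} {Q : QuasistableRootGraph g n}
    (f : RootSpecialization P.root Q.root) {x : Q.root.graph.E → ℝ} (hx : x ∈ Q.root.lam) :
    rho (rPoint Q x hx) = tPoint P (f.inclKap x) (f.inclKap_mem_kap hx) :=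
  (tPoint_inclKap f hx).symm

/-- The inverse map on a cone. -/
def ofPolystable (P : PolystableRootGraph g n) {k : P.root.KapSpace} (hk : k ∈ P.root.kap) :
    RTrop g n :=
  rPoint (P.exists_mem_image hk).choose (P.exists_mem_image hk).choose_spec.choose_spec.choose
    (lamInt_subset_lam (P.exists_mem_image hk).choose_spec.choose_spec.choose_spec.1)

theorem ofPolystable_inclKap {P : PolystableRootGraph g n} {Q : QuasistableRootGraph g n}
    (f : RootSpecialization P.root Q.root) {x : Q.root.graph.E → ℝ} (hx : x ∈ Q.root.lamInt)
    {k : P.root.KapSpace} (hk : k ∈ P.root.kap) (h : k = f.inclKap x) :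
    ofPolystable P hk = rPoint Q x (lamInt_subset_lam hx) := by
  refine rPoint_eq_of_inclKap_eq (P.exists_mem_image hk).choose_spec.choose f
    (P.exists_mem_image hk).choose_spec.choose_spec.choose_spec.1 hx ?_
  rw [(P.exists_mem_image hk).choose_spec.choose_spec.choose_spec.2, h]

/-- A face of the smaller cone is also a face of the larger one, by composition of specializations;
hence the inverse respects the gluing. -/
theorem ofPolystable_mapKap {P P' : PolystableRootGraph g n}
    (h : RootSpecialization P'.root P.root) {k : P.root.KapSpace} (hk : k ∈ P.root.kap)
    {k' : P'.root.KapSpace} (hk' : k' ∈ P'.root.kap) (he : k' = h.mapKap k) :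
    ofPolystable P hk = ofPolystable P' hk' := by
  obtain ⟨Q, f, x, hx, hxk⟩ := P.exists_mem_image hk
  rw [ofPolystable_inclKap f hx hk hxk.symm,
    ofPolystable_inclKap (RootSpecialization.comp h f) hx hk']
  rw [he, RootSpecialization.comp_inclKap, hxk]

/-- The inverse map `T^trop → R^trop`. -/
def rhoInv : TTrop g n → RTrop g n :=
  Quot.lift (fun p => ofPolystable p.1 p.2.2) (by
    rintro ⟨P, k, hk⟩ ⟨P', k', hk'⟩ ⟨h, he⟩
    exact ofPolystable_mapKap h hk hk' he)

theorem rhoInv_rho (r : RTrop g n) : rhoInv (rho r) = r := by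
  obtain ⟨⟨Q, x, hx⟩, rfl⟩ := Quot.exists_rep r
  obtain ⟨Q', f, x', hx', rfl⟩ := Q.exists_lamInt hx
  change ofPolystable Q.pol (Q.polMap.inclKap_mem_kap hx) = rPoint Q (f.hat.incl x') hx
  rw [ofPolystable_inclKap (P := Q.pol) (RootSpecialization.comp Q.polMap f) hx',
    rPoint_incl f (lamInt_subset_lam hx') hx rfl]
  rw [RootSpecialization.inclKap_apply, RootSpecialization.inclKap_apply,
    RootSpecialization.comp_hat_incl]

theorem rho_bijective : Function.Bijective (rho : RTrop g n → TTrop g n) := by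
  refine ⟨Function.LeftInverse.injective rhoInv_rho, fun t => ?_⟩
  obtain ⟨⟨P, k, hk⟩, rfl⟩ := Quot.exists_rep t
  obtain ⟨Q, f, x, hx, rfl⟩ := P.exists_mem_image hk
  exact ⟨rPoint Q x (lamInt_subset_lam hx), rho_rPoint_eq f _⟩

theorem continuous_rho : Continuous (rho : RTrop g n → TTrop g n) := by
  refine continuous_quot_lift _ (continuous_sigma fun Q => ?_)
  exact ConeDiagram.continuous_toSpace_comp (C := quasistableDiagram g n)
    (C' := polystableDiagram g n) (i := Q) (j := Q.pol) (continuous_inclKap Q.polMap)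
    fun x hx => Q.polMap.inclKap_mem_kap hx

theorem isRefinement_rho : ConeDiagram.IsRefinement (C := quasistableDiagram g n)
    (C' := polystableDiagram g n) rho := by
  refine ⟨⟨continuous_rho, fun Q => ⟨Q.pol, Q.polMap.inclKap, ?_, ?_, fun x => rfl⟩⟩,
    rho_bijective⟩
  · intro v hv
    exact ⟨_, incl_mem_integralVectors Q.polMap.hat hv, rfl⟩
  · exact fun x hx => Q.polMap.inclKap_mem_kap hx

end LegGraph

end

/-! ### Piecewise affine functions on an interval -/

open Set Filter Topology

noncomputable section

namespace LegGraph

theorem eventually_max_right (a t : ℝ) : ∀ᶠ s in 𝓝[>] t,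
    max (s - a) 0 = max (t - a) 0 + (if a ≤ t then 1 else 0) * (s - t) := by
  by_cases h : a ≤ t
  · filter_upwards [self_mem_nhdsWithin] with s hs
    have hs : t < s := hs
    rw [if_pos h, max_eq_left (by linarith), max_eq_left (by linarith)]
    ring
  · push Not at h
    filter_upwards [nhdsWithin_le_nhds (gt_mem_nhds h)] with s hs
    rw [if_neg (not_le.2 h), max_eq_right (by linarith), max_eq_right (by linarith)]
    ring

theorem eventually_max_left (a t : ℝ) : ∀ᶠ s in 𝓝[<] t,
    max (s - a) 0 = max (t - a) 0 - (if a < t then 1 else 0) * (t - s) := by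
  by_cases h : a < t
  · filter_upwards [nhdsWithin_le_nhds (lt_mem_nhds h)] with s hs
    rw [if_pos h, max_eq_left (by linarith), max_eq_left (by linarith)]
    ring
  · push Not at h
    filter_upwards [self_mem_nhdsWithin] with s hs
    have hs : s < t := hs
    rw [if_neg (not_lt.2 h), max_eq_right (by linarith), max_eq_right (by linarith)]
    ring

theorem slope_unique {w : ℝ → ℝ} {s c c' k : ℝ} (h : ∀ᶠ u in 𝓝[>] s, w u = w s + c * (u - s))
    (h' : ∀ᶠ u in 𝓝[>] s, w u = k + c' * u) (hk : w s = k + c' * s) : c = c' := by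
  obtain ⟨u, ⟨h1, h2⟩, h3⟩ := ((h.and h').and self_mem_nhdsWithin).exists
  have h3 : s < u := h3
  have h4 : (c - c') * (u - s) = 0 := by linarith
  rcases mul_eq_zero.1 h4 with h5 | h5 <;> linarith

/-- A function on an interval that is affine with integer slopes on either side of every point, with
matching slopes at the interior points, is affine. -/
theorem affine_of_slopes {w : ℝ → ℝ} {ℓ : ℝ} (hℓ : 0 < ℓ) {r l : ℝ → ℤ}
    (hr : ∀ t, 0 ≤ t → t < ℓ → ∀ᶠ s in 𝓝[>] t, w s = w t + r t * (s - t))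
    (hl : ∀ t, 0 < t → t ≤ ℓ → ∀ᶠ s in 𝓝[<] t, w s = w t + l t * (t - s))
    (hrl : ∀ t, 0 < t → t < ℓ → r t + l t = 0) :
    w ℓ = w 0 + r 0 * ℓ ∧ l ℓ = -r 0 := by
  have hright : ∀ t, 0 ≤ t → t < ℓ → ∀ᶠ s in 𝓝[>] t, r s = r t := by
    intro t h0 h1
    have h2 := eventually_eventually_nhdsWithin.2 (hr t h0 h1)
    filter_upwards [hr t h0 h1, h2, self_mem_nhdsWithin, nhdsWithin_le_nhds (gt_mem_nhds h1)]
      with s h3 h4 h5 h6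
    have h5 : t < s := h5
    rw [nhdsWithin_eq_nhds.2 (Ioi_mem_nhds h5)] at h4
    have := slope_unique (hr s (h0.trans h5.le) h6) (k := w t - r t * t) (c' := r t)
      ((h4.filter_mono nhdsWithin_le_nhds).mono fun u hu => by rw [hu]; ring) (by rw [h3]; ring)
    exact_mod_cast this
  have hleft : ∀ t, 0 < t → t ≤ ℓ → ∀ᶠ s in 𝓝[<] t, r s = -l t := by
    intro t h0 h1
    have h2 := eventually_eventually_nhdsWithin.2 (hl t h0 h1)
    filter_upwards [hl t h0 h1, h2, self_mem_nhdsWithin, nhdsWithin_le_nhds (lt_mem_nhds h0)]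
      with s h3 h4 h5 h6
    have h5 : s < t := h5
    rw [nhdsWithin_eq_nhds.2 (Iio_mem_nhds h5)] at h4
    have := slope_unique (hr s h6.le (h5.trans_le h1)) (k := w t + l t * t) (c' := ((-l t : ℤ) : ℝ))
      ((h4.filter_mono nhdsWithin_le_nhds).mono fun u hu => by rw [hu]; push_cast; ring)
      (by rw [h3]; push_cast; ring)
    exact_mod_cast this
  -- Right slopes are locally constant: from the right by affinity, from the left because the two
  -- outgoing slopes cancel. An integer-valued continuous function on an interval is constant.
  have hcont : ContinuousOn r (Ico 0 ℓ) := by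
    intro t ht
    have h1 : ∀ᶠ s in 𝓝[Ico 0 ℓ] t, r s = r t := by
      rcases ht.1.eq_or_lt with rfl | h0
      · rw [nhdsWithin_Ico_eq_nhdsGE hℓ, ← Ioi_insert, nhdsWithin_insert]
        exact eventually_sup.2 ⟨rfl, hright 0 le_rfl hℓ⟩
      · refine nhdsWithin_le_nhds ?_
        rw [← nhdsLT_sup_nhdsGE, ← Ioi_insert, nhdsWithin_insert]
        refine eventually_sup.2 ⟨(hleft t h0 ht.2.le).mono fun s hs => ?_,
          eventually_sup.2 ⟨rfl, hright t ht.1 ht.2⟩⟩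
        have := hrl t h0 ht.2
        omega
    exact tendsto_const_nhds.congr' (h1.mono fun s hs => hs.symm)
  have hconst : ∀ t, 0 ≤ t → t < ℓ → r t = r 0 := fun t h0 h1 =>
    isPreconnected_Ico.constant hcont ⟨h0, h1⟩ ⟨le_rfl, hℓ⟩
  have hlr : l ℓ = -r 0 := by
    obtain ⟨s, ⟨h1, h2⟩, h3⟩ := (((hleft ℓ hℓ le_rfl).and
      (nhdsWithin_le_nhds (lt_mem_nhds hℓ))).and self_mem_nhdsWithin).exists
    have := hconst s (le_of_lt h2) h3
    omega
  refine ⟨?_, hlr⟩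
  have hwc : ContinuousOn w (Icc 0 ℓ) := by
    intro t ht
    have hR : t < ℓ → ContinuousWithinAt w (Ioi t) t := fun h => by
      have h1 : Tendsto (fun s => w t + r t * (s - t)) (𝓝 t) (𝓝 (w t)) := by
        have : Continuous fun s => w t + r t * (s - t) := by fun_prop
        simpa using this.tendsto t
      exact (h1.mono_left nhdsWithin_le_nhds).congr' ((hr t ht.1 h).mono fun s hs => hs.symm)
    have hL : 0 < t → ContinuousWithinAt w (Iio t) t := fun h => by
      have h1 : Tendsto (fun s => w t + l t * (t - s)) (𝓝 t) (𝓝 (w t)) := by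
        have : Continuous fun s => w t + l t * (t - s) := by fun_prop
        simpa using this.tendsto t
      exact (h1.mono_left nhdsWithin_le_nhds).congr' ((hl t h ht.2).mono fun s hs => hs.symm)
    rcases ht.1.eq_or_lt with h0 | h0
    · refine ((continuousWithinAt_insert_self.2 (hR (h0 ▸ hℓ))).mono ?_)
      rw [Ioi_insert, ← h0]
      exact Icc_subset_Ici_self
    · rcases ht.2.eq_or_lt with h1 | h1
      · refine ((continuousWithinAt_insert_self.2 (hL h0)).mono ?_)
        rw [Iio_insert, h1]
        exact Icc_subset_Iic_self
      · refine ContinuousAt.continuousWithinAt ?_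
        exact continuousAt_iff_continuous_left'_right'.2 ⟨hL h0, hR h1⟩
  -- After subtracting the linear function of constant slope, a continuous function with zero right
  -- derivative remains.
  have hz : ∀ t ∈ Ico 0 ℓ, HasDerivWithinAt (fun t => w t - r 0 * t) 0 (Ici t) t := by
    intro t ht
    rw [← hasDerivWithinAt_Ioi_iff_Ici]
    refine (hasDerivWithinAt_const t (Ioi t) (w t - r 0 * t)).congr_of_eventuallyEq ?_ rfl
    refine (hr t ht.1 ht.2).mono fun s hs => ?_
    simp only [hs, hconst t ht.1 ht.2]
    ring
  have := constant_of_has_deriv_right_zero (hwc.sub (by fun_prop)) hz ℓ ⟨hℓ.le, le_rfl⟩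
  simp only [Pi.sub_apply, mul_zero, sub_zero] at this
  linarith

end LegGraph

end

/-! ### Slopes of a linear equivalence between roots -/

open Set Filter Topology

noncomputable section

namespace LegGraph

variable {n : ℕ} {Γ : LegGraph n}

open PseudoDivisor

/-- A harmonic one-form that is the differential of a function vanishes. -/
theorem eq_zero_of_harmonic {τ : Γ.Dart → ℤ} {ℓ : Γ.E → ℝ} {H : Γ.V → ℝ} (hℓ : ∀ e, 0 < ℓ e)
    (hrev : ∀ d, τ (Dart.rev d) = -τ d)
    (hharm : ∀ v, ∑ d, (if Γ.source d = v then τ d else 0) = 0)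
    (hH : ∀ d, (τ d : ℝ) * ℓ d.1 = H (Γ.target d) - H (Γ.source d)) (d : Γ.Dart) : τ d = 0 := by
  have h1 : ∑ d, (τ d : ℝ) * H (Γ.source d) = 0 := by
    have h2 : ∀ d, (τ d : ℝ) * H (Γ.source d) =
        ∑ v, H v * ((if Γ.source d = v then τ d else 0 : ℤ) : ℝ) := by
      intro d
      rw [Finset.sum_eq_single_of_mem (Γ.source d) (Finset.mem_univ _), if_pos rfl, mul_comm]
      intro v _ hv
      rw [if_neg (Ne.symm hv), Int.cast_zero, mul_zero]
    simp only [h2]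
    rw [Finset.sum_comm]
    refine Finset.sum_eq_zero fun v _ => ?_
    rw [← Finset.mul_sum, ← Int.cast_sum, hharm, Int.cast_zero, mul_zero]
  have h2 : ∑ d, (τ d : ℝ) * H (Γ.target d) = 0 := by
    rw [← sum_dart_rev]
    simp only [hrev, target_rev]
    push_cast
    simp only [neg_mul, Finset.sum_neg_distrib, h1, neg_zero]
  -- Summation by parts: the energy of the form is its pairing with the differential of `H`, which
  -- vanishes because the form is harmonic.
  have h3 : ∑ d, (τ d : ℝ) ^ 2 * ℓ d.1 = 0 := by
    have h4 : ∀ d, (τ d : ℝ) ^ 2 * ℓ d.1 =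
        (τ d : ℝ) * H (Γ.target d) - (τ d : ℝ) * H (Γ.source d) := fun d => by
      rw [← mul_sub, ← hH]
      ring
    simp only [h4, Finset.sum_sub_distrib, h1, h2, sub_zero]
  have h4 := (Finset.sum_eq_zero_iff_of_nonneg fun d _ =>
    mul_nonneg (sq_nonneg (τ d : ℝ)) (hℓ d.1).le).1 h3 d (Finset.mem_univ d)
  have h5 := (mul_eq_zero.1 h4).resolve_right (hℓ d.1).ne'
  exact_mod_cast pow_eq_zero_iff two_ne_zero |>.1 h5

namespace PseudoDivisor

variable {A : Γ.PseudoDivisor}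

/-- The length of the half of an exceptional edge at its target. -/
def targetHalf (x : A.graph.E → ℝ) (d : Γ.Dart) : ℝ :=
  if h : d.1 ∈ A.S then x (half d.1 h (!d.2)) else 0

theorem targetHalf_of_mem (x : A.graph.E → ℝ) {d : Γ.Dart} (h : d.1 ∈ A.S) :
    targetHalf x d = x (half d.1 h (!d.2)) := dif_pos h

theorem targetHalf_of_notMem (x : A.graph.E → ℝ) {d : Γ.Dart} (h : d.1 ∉ A.S) :
    targetHalf x d = 0 := dif_neg h

theorem lengths_of_mem (x : A.graph.E → ℝ) {e : Γ.E} (h : e ∈ A.S) :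
    A.lengths x e = x (half e h false) + x (half e h true) := by
  rw [lengths, Finset.sum_filter, sum_subdivide_E, Finset.sum_eq_single_of_mem e (Finset.mem_univ _)]
  · simp [h]
  · intro e' _ hne
    by_cases h' : e' ∈ A.S
    · simp [h', hne]
    · simp [h', hne]

theorem lengths_of_notMem (x : A.graph.E → ℝ) {e : Γ.E} (h : e ∉ A.S) :
    A.lengths x e = x (keep e h) := by
  rw [lengths, Finset.sum_filter, sum_subdivide_E, Finset.sum_eq_single_of_mem e (Finset.mem_univ _)]
  · simp [h]
  · intro e' _ hne
    by_cases h' : e' ∈ A.S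
    · simp [h', hne]
    · simp [h', hne]

theorem targetHalf_add_rev (x : A.graph.E → ℝ) (d : Γ.Dart) :
    targetHalf x d + targetHalf x (Dart.rev d) =
      ((if d.1 ∈ A.S then 1 else 0 : ℤ) : ℝ) * A.lengths x d.1 := by
  obtain ⟨e, b⟩ := d
  by_cases h : e ∈ A.S
  · rw [targetHalf_of_mem x (d := (e, b)) h, targetHalf_of_mem x (d := Dart.rev (e, b)) h,
      lengths_of_mem x h, if_pos h, Int.cast_one, one_mul]
    cases b
    · exact add_comm _ _
    · rfl
  · simp [targetHalf, Dart.rev, h]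

/-- The exceptional vertices are eliminated from a potential on the subdivision: across an
exceptional edge the difference is the length of the source half minus that of the target half. -/
theorem IsUnitRootFlow.exists_vertex_potential (hA : A.IsUnitRootFlow A.flow)
    {x : A.graph.E → ℝ} (hx : x ∈ A.Lam) : ∃ F : Γ.V → ℝ, ∀ d, F (Γ.target d) - F (Γ.source d) =
      A.offFlow A.flow d * A.lengths x d.1 + targetHalf x (Dart.rev d) - targetHalf x d := by
  obtain ⟨F, hF⟩ := mem_Lam_iff.1 hx
  refine ⟨fun v => F (vtx A.S v), ?_⟩
  rintro ⟨e, b⟩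
  by_cases h : e ∈ A.S
  · have h1 : ∀ b, x (half e h b) = F (exc e h) - F (vtx A.S (Γ.ends e b)) := fun b => by
      have := hF (half e h b, false)
      rw [hA.val_half, Int.cast_one, one_mul] at this
      exact this
    have h2 : A.offFlow A.flow (e, b) = 0 := dif_pos h
    simp only [targetHalf, Dart.rev, h, dif_pos, h2, Int.cast_zero, zero_mul, zero_add,
      Bool.not_not, h1, source, target]
    ring
  · have h1 := hF (keep e h, b)
    rw [← offFlow_of_notMem A.flow (d := (e, b)) h] at h1
    rw [targetHalf_of_notMem x (d := (e, b)) h, targetHalf_of_notMem x (d := Dart.rev (e, b)) h,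
      add_zero, sub_zero, lengths_of_notMem x h]
    exact h1.symm

end PseudoDivisor

section Tropical

variable {X : Γ.Metric} {Q B : Γ.PseudoDivisor} {x : Q.graph.E → ℝ} {y : B.graph.E → ℝ}

theorem pt_of_lt {e : Γ.E} {t : ℝ} (h : 0 < t ∧ t < X.len e) :
    X.pt e t = Sum.inr ⟨(e, t), h⟩ := dif_pos h

theorem pt_zero (e : Γ.E) : X.pt e 0 = Sum.inl (Γ.ends e false) := by
  rw [Metric.pt, dif_neg fun h => lt_irrefl _ h.1, if_pos le_rfl]

theorem pt_len (e : Γ.E) : X.pt e (X.len e) = Sum.inl (Γ.ends e true) := by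
  rw [Metric.pt, dif_neg fun h => lt_irrefl _ h.2, if_neg (not_le.2 (X.len_pos e))]

/-- The oriented edge `(e, true)` points to the end `false`, from which positions on `e` are
measured; its target half is therefore the position of the exceptional point. -/
theorem divisor_inr {A : Γ.PseudoDivisor} (x : A.graph.E → ℝ) {e : Γ.E} {t : ℝ}
    (h : 0 < t ∧ t < X.len e) : X.divisor A x (Sum.inr ⟨(e, t), h⟩) =
      -(if e ∈ A.S then (if t = targetHalf x (e, true) then 1 else 0) else 0) := by
  classical
  change (if ∃ h : e ∈ A.S, t = x (half e h false) then (-1 : ℤ) else 0) = _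
  by_cases h1 : e ∈ A.S
  · by_cases h2 : t = x (half e h1 false)
    · simp [targetHalf, h1, h2]
    · simp [targetHalf, h1, h2]
  · simp [h1]

theorem targetHalf_pos {A : Γ.PseudoDivisor} {x : A.graph.E → ℝ} (hx : ∀ e, 0 < x e)
    {d : Γ.Dart} (h : d.1 ∈ A.S) : 0 < targetHalf x d := by
  rw [targetHalf, dif_pos h]
  exact hx _

/-- Boundary values of the bending term: the exceptional point is strictly inside the edge, so the
bend is invisible at the end `false` and complete at the end `true`. -/
theorem targetHalf_max {A : Γ.PseudoDivisor} {x : A.graph.E → ℝ} (hx : ∀ e, 0 < x e)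
    (hxX : A.lengths x = X.len) (e : Γ.E) :
    ((if e ∈ A.S then 1 else 0 : ℤ) : ℝ) * max (X.len e - targetHalf x (e, true)) 0 =
        targetHalf x (e, false) ∧
      (if e ∈ A.S then 1 else 0 : ℤ) * (if targetHalf x (e, true) ≤ 0 then 1 else 0) = 0 ∧
      (if e ∈ A.S then 1 else 0 : ℤ) * (if targetHalf x (e, true) < X.len e then 1 else 0) =
        (if e ∈ A.S then 1 else 0 : ℤ) ∧
      ((if e ∈ A.S then 1 else 0 : ℤ) : ℝ) * max (0 - targetHalf x (e, true)) 0 = 0 := by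
  by_cases h : e ∈ A.S
  · have h1 := targetHalf_add_rev x (e, false)
    have h2 := targetHalf_pos hx (d := (e, false)) h
    have h3 := targetHalf_pos hx (d := (e, true)) h
    simp only [if_pos h, Int.cast_one, one_mul, hxX] at h1
    change targetHalf x (e, false) + targetHalf x (e, true) = _ at h1
    simp only [if_pos h, Int.cast_one, one_mul, if_neg (not_le.2 h3)]
    refine ⟨?_, trivial, if_pos (by linarith), max_eq_right (by linarith)⟩
    rw [max_eq_left (by linarith)]
    linarith
  · simp [h, targetHalf]

theorem ite_le_sub_ite_lt (c t : ℝ) :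
    (if c ≤ t then 1 else 0 : ℤ) - (if c < t then 1 else 0) = if t = c then 1 else 0 := by
  rcases lt_trichotomy c t with h | h | h
  · simp [h, h.le, h.ne']
  · simp [h]
  · simp [not_le.2 h, not_lt.2 h.le, h.ne]

/-- The restriction to an edge of a rational function giving a linear equivalence. -/
theorem slopes_of_linearlyEquivalent (f : X.RationalFunction)
    (hf : ∀ p, X.divisor Q x p - X.divisor B y p = f.div p) (hx : ∀ e, 0 < x e)
    (hy : ∀ e, 0 < y e) (hxX : Q.lengths x = X.len) (hyX : B.lengths y = X.len) (e : Γ.E) :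
    f.val (Sum.inl (Γ.ends e true)) = f.val (Sum.inl (Γ.ends e false)) +
        f.slope e true 0 * X.len e - targetHalf x (e, false) + targetHalf y (e, false) ∧
      f.slope e false (X.len e) = -f.slope e true 0 + (if e ∈ Q.S then 1 else 0) -
        (if e ∈ B.S then 1 else 0) := by
  let a := targetHalf x (e, true)
  let b := targetHalf y (e, true)
  let q : ℤ := if e ∈ Q.S then 1 else 0
  let r : ℤ := if e ∈ B.S then 1 else 0
  have ha := targetHalf_max hx hxX e
  have hb := targetHalf_max hy hyX e
  -- The divisor of `f` is `-1` at the exceptional point of `Q` and `+1` at that of `B`. Adding and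
  -- subtracting the corresponding ramps cancels both bends, even if the points coincide, and the
  -- result is affine.
  obtain ⟨h1, h2⟩ := affine_of_slopes (X.len_pos e)
    (w := fun t => f.val (X.pt e t) + q * max (t - a) 0 - r * max (t - b) 0)
    (r := fun t => f.slope e true t + q * (if a ≤ t then 1 else 0) - r * if b ≤ t then 1 else 0)
    (l := fun t => f.slope e false t - q * (if a < t then 1 else 0) + r * if b < t then 1 else 0)
    (by
      intro t h0 h1
      filter_upwards [f.slope_true e t h0 h1, eventually_max_right a t, eventually_max_right b t]
        with s h2 h3 h4
      rw [h2, h3, h4]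
      push_cast
      ring)
    (by
      intro t h0 h1
      filter_upwards [f.slope_false e t h0 h1, eventually_max_left a t, eventually_max_left b t]
        with s h2 h3 h4
      rw [h2, h3, h4]
      push_cast
      ring)
    (by
      intro t h0 h1
      have h2 := hf (Sum.inr ⟨(e, t), h0, h1⟩)
      rw [divisor_inr, divisor_inr] at h2
      change _ = f.slope e true t + f.slope e false t at h2
      have h4 := ite_le_sub_ite_lt a t
      have h5 := ite_le_sub_ite_lt b t
      have h6 : q * (if t = a then 1 else 0) = if e ∈ Q.S then (if t = a then 1 else 0) else 0 := by
        simp only [q]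
        split_ifs <;> simp
      have h7 : r * (if t = b then 1 else 0) = if e ∈ B.S then (if t = b then 1 else 0) else 0 := by
        simp only [r]
        split_ifs <;> simp
      change -(if e ∈ Q.S then (if t = a then 1 else 0) else 0) -
        -(if e ∈ B.S then (if t = b then 1 else 0) else 0) = _ at h2
      rw [← h6, ← h7, ← h4, ← h5] at h2
      linarith)
  simp only [pt_zero, pt_len] at h1 h2
  rw [ha.1, ha.2.2.2, ha.2.1, hb.1, hb.2.2.2, hb.2.1] at h1
  rw [ha.2.2.1, ha.2.1, hb.2.2.1, hb.2.1] at h2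
  simp only [add_zero, sub_zero] at h1 h2
  constructor
  · linarith
  · change _ = _ + q - r
    linarith

/-- The outgoing slope at the source of an oriented edge. -/
def sourceSlope (f : X.RationalFunction) (d : Γ.Dart) : ℤ :=
  if d.2 then f.slope d.1 false (X.len d.1) else f.slope d.1 true 0

theorem div_inl (f : X.RationalFunction) (v : Γ.V) :
    f.div (Sum.inl v) = ∑ d, if Γ.source d = v then sourceSlope f d else 0 := by
  rw [sum_dart_eq]
  rfl

/-- A quasistable and a polystable root that are linearly equivalent: the slopes of the rational
function. -/
theorem slopes_of_roots (hQ : Q.IsUnitRootFlow Q.flow) (hB : B.IsPolystableRoot)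
    (f : X.RationalFunction) (hf : ∀ p, X.divisor Q x p - X.divisor B y p = f.div p)
    (hxL : x ∈ Q.Lam) (hyL : y ∈ B.Lam) (hx : ∀ e, 0 < x e) (hy : ∀ e, 0 < y e)
    (hxX : Q.lengths x = X.len) (hyX : B.lengths y = X.len) (d : Γ.Dart) :
    2 * sourceSlope f d = (if d.1 ∈ Q.S then 1 else 0) - (if d.1 ∈ B.S then 1 else 0) +
        Q.offFlow Q.flow d ∧
      f.val (Sum.inl (Γ.target d)) - f.val (Sum.inl (Γ.source d)) =
        sourceSlope f d * X.len d.1 - targetHalf x d + targetHalf y d := by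
  have hslope := slopes_of_linearlyEquivalent f hf hx hy hxX hyX
  have hval : ∀ d : Γ.Dart, f.val (Sum.inl (Γ.target d)) - f.val (Sum.inl (Γ.source d)) =
      sourceSlope f d * X.len d.1 - targetHalf x d + targetHalf y d := by
    rintro ⟨e, b⟩
    obtain ⟨h1, h2⟩ := hslope e
    cases b
    · change f.val (Sum.inl (Γ.ends e true)) - f.val (Sum.inl (Γ.ends e false)) =
        f.slope e true 0 * X.len e - _ + _
      linarith
    · change f.val (Sum.inl (Γ.ends e false)) - f.val (Sum.inl (Γ.ends e true)) =
        f.slope e false (X.len e) * X.len e - _ + _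
      have h3 := targetHalf_add_rev x (e, true)
      have h4 := targetHalf_add_rev y (e, true)
      simp only [hxX, hyX] at h3 h4
      change _ + targetHalf x (e, false) = _ at h3
      change _ + targetHalf y (e, false) = _ at h4
      rw [h2]
      push_cast at h3 h4 ⊢
      linarith
  refine ⟨?_, hval d⟩
  obtain ⟨F, hF⟩ := hQ.exists_vertex_potential hxL
  obtain ⟨G, hG⟩ := hB.isUnitRootFlow.exists_vertex_potential hyL
  have hBoff := hB.isUnitRootFlow.isPolystable_iff.1 hB.2
  -- The slopes are compared with those predicted by the flow. The discrepancy is harmonic by the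
  -- two root equations at the vertices, and its product with the lengths is the differential of `2f
  -- - F + G`, with `F` and `G` the vertex potentials of the two roots.
  have key := eq_zero_of_harmonic (τ := fun d => 2 * sourceSlope f d - (if d.1 ∈ Q.S then 1 else 0) +
    (if d.1 ∈ B.S then 1 else 0) - Q.offFlow Q.flow d) (ℓ := X.len)
    (H := fun v => 2 * f.val (Sum.inl v) - F v + G v) X.len_pos (by
      rintro ⟨e, b⟩
      have h1 := (hslope e).2
      rw [offFlow_rev]
      cases b <;> simp only [sourceSlope, Dart.rev, h1, Bool.not_false, Bool.not_true, if_true,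
        Bool.false_eq_true, if_false] <;> ring) (by
      intro v
      have h1 := hf (Sum.inl v)
      rw [div_inl] at h1
      change Q.D (vtx Q.S v) - B.D (vtx B.S v) = _ at h1
      have h2 := hQ.sum_source_offFlow v
      have h3 := isPolystableRoot_iff.1 hB v
      have h6 : ∑ d, (if Γ.source d = v then 2 * sourceSlope f d - (if d.1 ∈ Q.S then 1 else 0) +
          (if d.1 ∈ B.S then 1 else 0) - Q.offFlow Q.flow d else 0) =
          2 * ∑ d, (if Γ.source d = v then sourceSlope f d else 0) - Γ.degIn Q.S v +
          Γ.degIn B.S v - ∑ d, (if Γ.source d = v then Q.offFlow Q.flow d else 0) := by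
        rw [degIn_eq_sum_int, degIn_eq_sum_int, Finset.mul_sum, ← Finset.sum_sub_distrib, ← Finset.sum_add_distrib,
          ← Finset.sum_sub_distrib]
        refine Finset.sum_congr rfl fun d _ => ?_
        by_cases h : Γ.source d = v <;> simp [h]
      rw [h6]
      linarith) (by
      intro d
      have h1 := hval d
      have h2 := hF d
      have h3 := hG d
      rw [hBoff, Int.cast_zero, zero_mul, zero_add] at h3
      have h4 := targetHalf_add_rev x d
      have h5 := targetHalf_add_rev y d
      rw [hxX] at h2 h4
      rw [hyX] at h5
      push_cast at h4 h5 ⊢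
      linarith) d
  have h : 2 * sourceSlope f d - (if d.1 ∈ Q.S then 1 else 0) + (if d.1 ∈ B.S then 1 else 0) -
    Q.offFlow Q.flow d = 0 := key
  linarith

end Tropical

end LegGraph

end

/-! ### Constructing the linear equivalence -/

open Set Filter Topology

noncomputable section

namespace LegGraph

variable {n : ℕ} {Γ : LegGraph n}

open PseudoDivisor

section Tropical

variable {X : Γ.Metric} {Q B : Γ.PseudoDivisor} {x : Q.graph.E → ℝ} {y : B.graph.E → ℝ}

/-- The rational function on a tropical curve with given values at the vertices and given slopes,
bent at the exceptional points. -/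
theorem linearlyEquivalent_of_slopes (hQ : Q.IsUnitRootFlow Q.flow) (hB : B.IsPolystableRoot)
    (hx : ∀ e, 0 < x e) (hy : ∀ e, 0 < y e)
    (hxX : Q.lengths x = X.len) (hyX : B.lengths y = X.len) {p : Γ.V → ℝ} {s : Γ.Dart → ℤ}
    (hs : ∀ d, 2 * s d = (if d.1 ∈ Q.S then 1 else 0) - (if d.1 ∈ B.S then 1 else 0) +
      Q.offFlow Q.flow d)
    (hp : ∀ d, p (Γ.target d) - p (Γ.source d) =
      s d * X.len d.1 - targetHalf x d + targetHalf y d) :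
    X.LinearlyEquivalent (X.divisor Q x) (X.divisor B y) := by
  let a : Γ.E → ℝ := fun e => targetHalf x (e, true)
  let b : Γ.E → ℝ := fun e => targetHalf y (e, true)
  let q : Γ.E → ℤ := fun e => if e ∈ Q.S then 1 else 0
  let r : Γ.E → ℤ := fun e => if e ∈ B.S then 1 else 0
  have ha := targetHalf_max hx hxX
  have hb := targetHalf_max hy hyX
  -- Linear interpolation with ramps: the slope drops by one at the exceptional point of `Q` and
  -- rises by one at that of `B`. The hypothesis on `p` is exactly that the value at the end `true`
  -- is correct.
  let u : Γ.E → ℝ → ℝ := fun e t => p (Γ.ends e false) + s (e, false) * t -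
    q e * max (t - a e) 0 + r e * max (t - b e) 0
  let val : X.Point → ℝ := Sum.elim p fun c => u c.1.1 c.1.2
  have hval : ∀ e t, 0 ≤ t → t ≤ X.len e → val (X.pt e t) = u e t := by
    intro e t h0 h1
    rcases h0.eq_or_lt with rfl | h0
    · rw [pt_zero]
      change p (Γ.ends e false) = p (Γ.ends e false) + s (e, false) * 0 -
        q e * max (0 - a e) 0 + r e * max (0 - b e) 0
      rw [(ha e).2.2.2, (hb e).2.2.2]
      ring
    · rcases h1.eq_or_lt with rfl | h1
      · rw [pt_len]
        change p (Γ.ends e true) = p (Γ.ends e false) + s (e, false) * X.len e -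
          q e * max (X.len e - a e) 0 + r e * max (X.len e - b e) 0
        rw [(ha e).1, (hb e).1]
        have : p (Γ.ends e true) - p (Γ.ends e false) = _ := hp (e, false)
        linarith
      · rw [pt_of_lt ⟨h0, h1⟩]
        rfl
  let f : X.RationalFunction :=
    { val := val
      slope := fun e c t =>
        if c then s (e, false) - q e * (if a e ≤ t then 1 else 0) + r e * (if b e ≤ t then 1 else 0)
        else -(s (e, false) - q e * (if a e < t then 1 else 0) + r e * (if b e < t then 1 else 0))
      slope_true := by
        intro e t h0 h1
        filter_upwards [eventually_max_right (a e) t, eventually_max_right (b e) t,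
          self_mem_nhdsWithin, nhdsWithin_le_nhds (gt_mem_nhds h1)] with w h2 h3 h4 h5
        have h4 : t < w := h4
        have h5 : w < X.len e := h5
        rw [hval e w (h0.trans h4.le) h5.le, hval e t h0 h1.le]
        simp only [u, h2, h3, if_true]
        push_cast
        ring
      slope_false := by
        intro e t h0 h1
        filter_upwards [eventually_max_left (a e) t, eventually_max_left (b e) t,
          self_mem_nhdsWithin, nhdsWithin_le_nhds (lt_mem_nhds h0)] with w h2 h3 h4 h5
        have h4 : w < t := h4
        have h5 : 0 < w := h5
        rw [hval e w h5.le (h4.le.trans h1), hval e t h0.le h1]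
        simp only [u, h2, h3, Bool.false_eq_true, if_false]
        push_cast
        ring }
  -- At the end `true` the outgoing slope includes the bends, and antisymmetry of the flow makes it
  -- equal to the prescribed `s (e, true)`.
  have hf : ∀ d, sourceSlope f d = s d := by
    rintro ⟨e, c⟩
    have h1 := hs (e, false)
    have h2 := hs (e, true)
    have h3 : Q.offFlow Q.flow (e, true) = _ := offFlow_rev Q.flow (e, false)
    cases c
    · change s (e, false) - q e * (if a e ≤ 0 then 1 else 0) +
        r e * (if b e ≤ 0 then 1 else 0) = _
      rw [(ha e).2.1, (hb e).2.1]
      ring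
    · change -(s (e, false) - q e * (if a e < X.len e then 1 else 0) +
        r e * (if b e < X.len e then 1 else 0)) = _
      rw [(ha e).2.2.1, (hb e).2.2.1]
      rw [h3] at h2
      simp only at h1 h2
      linarith
  refine ⟨f, ?_⟩
  rintro (v | ⟨⟨e, t⟩, h⟩)
  · rw [div_inl]
    change Q.D (vtx Q.S v) - B.D (vtx B.S v) = _
    have h2 := hQ.sum_source_offFlow v
    have h3 := isPolystableRoot_iff.1 hB v
    have h4 : 2 * ∑ d, (if Γ.source d = v then sourceSlope f d else 0) =
        Γ.degIn Q.S v - Γ.degIn B.S v +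
          ∑ d, (if Γ.source d = v then Q.offFlow Q.flow d else 0) := by
      rw [degIn_eq_sum_int, degIn_eq_sum_int, Finset.mul_sum, ← Finset.sum_sub_distrib,
        ← Finset.sum_add_distrib]
      refine Finset.sum_congr rfl fun d _ => ?_
      by_cases h : Γ.source d = v
      · simp only [if_pos h, hf, hs]
      · simp only [if_neg h]
        rfl
    linarith
  · rw [divisor_inr, divisor_inr]
    change _ = (s (e, false) - q e * (if a e ≤ t then 1 else 0) +
      r e * (if b e ≤ t then 1 else 0)) +
      -(s (e, false) - q e * (if a e < t then 1 else 0) + r e * (if b e < t then 1 else 0))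
    have h4 := ite_le_sub_ite_lt (a e) t
    have h5 := ite_le_sub_ite_lt (b e) t
    have h6 : q e * (if t = a e then 1 else 0) =
        if e ∈ Q.S then (if t = a e then 1 else 0) else 0 := by
      simp only [q]
      split_ifs <;> simp
    have h7 : r e * (if t = b e then 1 else 0) =
        if e ∈ B.S then (if t = b e then 1 else 0) else 0 := by
      simp only [r]
      split_ifs <;> simp
    change -(if e ∈ Q.S then (if t = a e then 1 else 0) else 0) -
      -(if e ∈ B.S then (if t = b e then 1 else 0) else 0) = _
    rw [← h6, ← h7, ← h4, ← h5]
    ring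

end Tropical

section Pol

variable {Q B : Γ.PseudoDivisor}

/-- The slope of the rational function relating a quasistable root to the polystable root
above it. -/
def polSlope (Q : Γ.PseudoDivisor) (d : Γ.Dart) : ℤ := if Q.offFlow Q.flow d = -1 then -1 else 0

theorem incl_keep {f : RootSpecialization B Q} (hf : f.IsOverId) (x : Q.graph.E → ℝ) {e : Γ.E} (h : e ∉ B.S) :
    f.hat.incl x (keep e h) = Q.lengths x e := by
  have hA : f.base.emap e ∉ B.S := by rwa [hf.2]
  have heQ : e ∉ Q.S := fun h' => hA (f.subset e h')
  have h1 : f.hat.emap (keep e heQ) = keep e h := by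
    rw [f.keep_of_notMem heQ hA, keep_inj, hf.2]
  rw [← h1, f.hat.incl_emap, lengths_of_notMem x heQ]

/-- On an edge where `pol` adds an exceptional vertex, the whole length sits on the half at the tail
of the flow. This is the target half of `d` exactly when the flow along `d` is `-1`. -/
theorem targetHalf_incl {f : RootSpecialization B Q} (hB : B.IsPolystableRoot)
    (hQ : Q.IsUnitRootFlow Q.flow) (hf : f.IsOverId)
    (hh : ∀ e (he : e ∈ Q.S) b, ∃ h, f.hat.emap (half e he b) = half e h b) (x : Q.graph.E → ℝ)
    (d : Γ.Dart) : targetHalf (f.hat.incl x) d = targetHalf x d - polSlope Q d * Q.lengths x d.1 := by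
  by_cases hdQ : d.1 ∈ Q.S
  · have h0 : Q.offFlow Q.flow d = 0 := dif_pos hdQ
    obtain ⟨h, h1⟩ := hh d.1 hdQ (!d.2)
    rw [targetHalf_of_mem _ h, targetHalf_of_mem _ hdQ, ← h1, f.hat.incl_emap]
    simp [polSlope, h0]
  · rw [targetHalf_of_notMem x hdQ, lengths_of_notMem x hdQ]
    have h0 : Q.offFlow Q.flow d = _ := offFlow_of_notMem Q.flow hdQ
    by_cases hdB : d.1 ∈ B.S
    · have hA : f.base.emap d.1 ∈ B.S := by rwa [hf.2]
      obtain ⟨c, b, h1, h2, h3, h4, h5⟩ := f.keep_of_mem hB hQ hdQ hA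
      rw [hf.1, hf.2] at h4
      have hcb : c = b := by
        by_contra hne
        have : c = !b := by revert hne; cases b <;> cases c <;> simp
        rw [this] at h4
        exact h5 h4.symm
      subst hcb
      have hhalf : ∀ b, half (f.base.emap d.1) hA b = half d.1 hdB b := fun b =>
        half_inj.2 ⟨hf.2 _, rfl⟩
      rw [hhalf] at h1
      simp only [hhalf] at h2
      rw [targetHalf_of_mem _ hdB]
      by_cases hd : d.2 = c
      · rw [← hd] at h2 h3
        rw [f.hat.incl_contracted x h2]
        simp [polSlope, h0, h3]
      · have hd' : c = !d.2 := by revert hd; cases c <;> cases d.2 <;> simp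
        have h6 : Q.flow.val (keep d.1 hdQ, d.2) = -1 := by
          have := Q.flow.antisymm (keep d.1 hdQ) d.2
          rw [← hd', h3] at this
          linarith
        rw [← hd', ← h1, f.hat.incl_emap]
        simp [polSlope, h0, h6]
    · have hA : f.base.emap d.1 ∉ B.S := by rwa [hf.2]
      rw [targetHalf_of_notMem _ hdB]
      simp [polSlope, h0, f.flow_keep_of_notMem hB hdQ hA]

theorem two_mul_polSlope (f : RootSpecialization B Q) (hB : B.IsPolystableRoot)
    (hQ : Q.IsUnitRootFlow Q.flow) (hf : f.IsOverId) (d : Γ.Dart) : 2 * polSlope Q d =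
    (if d.1 ∈ Q.S then 1 else 0) - (if d.1 ∈ B.S then 1 else 0) + Q.offFlow Q.flow d := by
  have h1 := f.mem_pol_S_iff hB hQ d.1
  rw [hf.2, mem_pol_S d.2] at h1
  change d.1 ∈ Q.S ∨ Q.offFlow Q.flow d ≠ 0 ↔ _ at h1
  have h2 := hQ.offFlow_le_one d
  have h3 := hQ.neg_one_le_offFlow d
  rw [polSlope]
  by_cases hd : d.1 ∈ Q.S
  · have h0 : Q.offFlow Q.flow d = 0 := dif_pos hd
    simp [hd, h0, h1.1 (Or.inl hd)]
  · obtain h | h | h : Q.offFlow Q.flow d = -1 ∨ Q.offFlow Q.flow d = 0 ∨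
      Q.offFlow Q.flow d = 1 := by omega
    all_goals
      rw [h] at h1
      simp [hd] at h1
      simp [hd, h, h1]

end Pol

end LegGraph

end

/-! ### Identification of `rho` with linear equivalence -/

open Set Filter Topology

noncomputable section

namespace LegGraph

open PseudoDivisor QuasistableRootGraph

section Local

variable {n : ℕ} {Γ : LegGraph n} {X : Γ.Metric} {Q B : Γ.PseudoDivisor} {x : Q.graph.E → ℝ}
  {y : B.graph.E → ℝ}

/-- Parity: the right-hand side is even only if an edge is exceptional for `B` precisely when it is
exceptional for `Q` or carries flow `±1`. -/
theorem mem_S_iff_of_two_mul {s : Γ.Dart → ℤ} (hQ : Q.IsUnitRootFlow Q.flow)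
    (hs : ∀ d, 2 * s d = (if d.1 ∈ Q.S then 1 else 0) - (if d.1 ∈ B.S then 1 else 0) +
      Q.offFlow Q.flow d) : B.S = Q.pol.S := by
  ext e
  rw [mem_pol_S false]
  have h1 := hs (e, false)
  have h2 := hQ.offFlow_le_one (e, false)
  have h3 := hQ.neg_one_le_offFlow (e, false)
  by_cases he : e ∈ Q.S
  · have h0 : Q.offFlow Q.flow (e, false) = 0 := dif_pos he
    by_cases hb : e ∈ B.S
    · simp [he, hb]
    · simp only [he, hb, h0, if_true, if_false] at h1
      omega
  · by_cases hb : e ∈ B.S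
    · simp only [he, hb, if_true, if_false] at h1
      simp only [hb, he, false_or, true_iff]
      omega
    · simp only [he, hb, if_false] at h1
      simp only [hb, he, false_or, false_iff, not_not]
      omega

theorem sub_incl_eq_halfDiff {f : RootSpecialization B Q} (hB : B.IsPolystableRoot)
    (hQ : Q.IsUnitRootFlow Q.flow) (hf : f.IsOverId)
    (hh : ∀ e (he : e ∈ Q.S) b, ∃ h, f.hat.emap (half e he b) = half e h b)
    (hxy : Q.lengths x = B.lengths y) {p : Γ.V → ℝ}
    (hp : ∀ d, p (Γ.target d) - p (Γ.source d) =
      polSlope Q d * Q.lengths x d.1 - targetHalf x d + targetHalf y d) :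
    y - f.hat.incl x = halfDiff B.S p := by
  funext z
  rcases keep_or_half z with ⟨e, he, rfl⟩ | ⟨e, he, b, rfl⟩
  · rw [Pi.sub_apply, incl_keep hf, halfDiff_keep, hxy, lengths_of_notMem y he, sub_self]
  · have h1 := hp (e, !b)
    have h2 := targetHalf_incl hB hQ hf hh x (e, !b)
    rw [targetHalf_of_mem (d := (e, !b)) _ he] at h2
    rw [targetHalf_of_mem (d := (e, !b)) y he] at h1
    simp only [source, target, Bool.not_not] at h1 h2
    rw [Pi.sub_apply, halfDiff_half]
    linarith

/-- The two values of the differential on an exceptional edge cancel, and extension by zero puts the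
full length of an unsplit edge on one of its halves. -/
theorem lengths_incl_add_halfDiff {f : RootSpecialization B Q} (hB : B.IsPolystableRoot)
    (hQ : Q.IsUnitRootFlow Q.flow) (hf : f.IsOverId)
    (hh : ∀ e (he : e ∈ Q.S) b, ∃ h, f.hat.emap (half e he b) = half e h b)
    (x : Q.graph.E → ℝ) (p : Γ.V → ℝ) :
    B.lengths (f.hat.incl x + halfDiff B.S p) = Q.lengths x := by
  funext e
  by_cases he : e ∈ B.S
  · have h1 := targetHalf_incl hB hQ hf hh x (e, true)
    have h2 := targetHalf_incl hB hQ hf hh x (e, false)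
    have h3 := targetHalf_add_rev x (e, false)
    have h4 := two_mul_polSlope f hB hQ hf (e, true)
    have h5 := two_mul_polSlope f hB hQ hf (e, false)
    have h6 : Q.offFlow Q.flow (e, true) = _ := offFlow_rev Q.flow (e, false)
    have h7 : polSlope Q (e, true) + polSlope Q (e, false) = (if e ∈ Q.S then 1 else 0) - 1 := by
      simp only [if_pos he, h6] at h4 h5
      linarith
    have h8 : (polSlope Q (e, true) : ℝ) + polSlope Q (e, false) =
        ((if e ∈ Q.S then 1 else 0 : ℤ) : ℝ) - 1 := by exact_mod_cast h7
    rw [targetHalf_of_mem (d := (e, true)) _ he] at h1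
    rw [targetHalf_of_mem (d := (e, false)) _ he] at h2
    simp only [Bool.not_true, Bool.not_false] at h1 h2
    change targetHalf x (e, false) + targetHalf x (e, true) = _ at h3
    rw [lengths_of_mem _ he, Pi.add_apply, Pi.add_apply, halfDiff_half, halfDiff_half, h1, h2,
      Bool.not_true, Bool.not_false]
    simp only at h3
    linear_combination h3 - Q.lengths x e * h8
  · rw [lengths_of_notMem _ he, Pi.add_apply, halfDiff_keep, add_zero, incl_keep hf]

theorem lengths_pos {A : Γ.PseudoDivisor} {x : A.graph.E → ℝ} (hx : ∀ e, 0 < x e) (e : Γ.E) :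
    0 < A.lengths x e := by
  by_cases he : e ∈ A.S
  · rw [lengths_of_mem x he]
    exact add_pos (hx _) (hx _)
  · rw [lengths_of_notMem x he]
    exact hx _

theorem linearlyEquivalent_incl_add_halfDiff {f : RootSpecialization B Q}
    (hB : B.IsPolystableRoot) (hQ : Q.IsUnitRootFlow Q.flow) (hf : f.IsOverId)
    (hh : ∀ e (he : e ∈ Q.S) b, ∃ h, f.hat.emap (half e he b) = half e h b)
    (hx : ∀ e, 0 < x e) (hxX : Q.lengths x = X.len) {p : Γ.V → ℝ}
    (hp : ∀ e ∉ B.S, p (Γ.ends e false) = p (Γ.ends e true))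
    (hy : ∀ e, 0 < (f.hat.incl x + halfDiff B.S p) e) :
    X.LinearlyEquivalent (X.divisor Q x) (X.divisor B (f.hat.incl x + halfDiff B.S p)) := by
  refine linearlyEquivalent_of_slopes hQ hB hx hy hxX
    ((lengths_incl_add_halfDiff hB hQ hf hh x p).trans hxX) (p := p) (s := polSlope Q)
    (two_mul_polSlope f hB hQ hf) ?_
  rintro ⟨e, b⟩
  have h1 := targetHalf_incl hB hQ hf hh x (e, b)
  rw [hxX] at h1
  by_cases he : e ∈ B.S
  · rw [targetHalf_of_mem (d := (e, b)) _ he] at h1 ⊢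
    rw [Pi.add_apply, h1, halfDiff_half, Bool.not_not]
    simp only [source, target]
    ring
  · rw [targetHalf_of_notMem (d := (e, b)) _ he] at h1 ⊢
    have h2 := hp e he
    have h3 : p (Γ.target (e, b)) - p (Γ.source (e, b)) = 0 := by
      cases b
      · exact sub_eq_zero.2 h2.symm
      · exact sub_eq_zero.2 h2
    rw [h3]
    linarith

end Local

variable {g n : ℕ} [NeZero n]

/-- The slope formula forces `B = pol(Q)` and the slopes `polSlope`. The vertex values of the
rational function then express the difference of the two length vectors as an element of the cut
space. -/
theorem rho_eq_of_linearlyEquivalent {Q : QuasistableRootGraph g n}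
    {B : Q.base.graph.PseudoDivisor} (hB : B.IsPolystableRoot) {X : Q.base.graph.Metric}
    {x : Q.root.graph.E → ℝ} {y : B.graph.E → ℝ} (hx : x ∈ Q.root.lam) (hy : y ∈ B.lam)
    (hx₀ : ∀ e, 0 < x e) (hy₀ : ∀ e, 0 < y e) (hxX : Q.root.lengths x = X.len)
    (hyX : B.lengths y = X.len)
    (h : X.LinearlyEquivalent (X.divisor Q.root x) (X.divisor B y)) :
    rho (rPoint Q x hx) = tPoint ⟨Q.base, B, hB⟩ (B.cutSpace.mkQ y) ⟨y, hy, rfl⟩ := by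
  obtain ⟨f, hf⟩ := h
  have hQ := Q.isRoot.isUnitRootFlow
  have key := slopes_of_roots hQ hB f hf hx.1 hy.1 hx₀ hy₀ hxX hyX
  have hS := mem_S_iff_of_two_mul hQ fun d => (key d).1
  have hBpol : B = Q.root.pol := hB.ext hQ.isPolystableRoot_pol hS
  subst hBpol
  have hslope : ∀ d, sourceSlope f d = polSlope Q.root d := fun d => by
    have h1 := (key d).1
    rw [← two_mul_polSlope Q.polMap hB hQ Q.polMap_isOverId] at h1
    linarith
  have hd := sub_incl_eq_halfDiff (x := x) (y := y) hB hQ Q.polMap_isOverId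
    (fun e he b => Q.polMap_half he b) (hxX.trans hyX.symm)
    (p := fun v => f.val (Sum.inl v)) (fun d => by
      rw [← hslope, hxX]
      exact (key d).2)
  refine tPoint_congr (P := Q.pol) (mkQ_eq_iff.2 ?_)
  have h1 : Q.polMap.hat.incl x - y = halfDiff Q.root.pol.S
      ((-1 : ℝ) • fun v => f.val (Sum.inl v)) := by
    rw [halfDiff_smul, ← hd, neg_one_smul, neg_sub]
  rw [h1]
  -- Outside the exceptional set of `pol` the flow, and hence the slope, is zero, so the rational
  -- function has the same value at both ends.
  refine halfDiff_mem_cutSpace fun e he => ?_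
  have h2 := (key (e, false)).2
  have h3 : Q.root.offFlow Q.root.flow (e, false) = 0 := by
    by_contra h
    exact he ((mem_pol_S false).2 (Or.inr h))
  have h4 : e ∉ Q.root.S := fun h => he ((mem_pol_S false).2 (Or.inl h))
  rw [hslope, targetHalf_of_notMem (d := (e, false)) x h4,
    targetHalf_of_notMem (d := (e, false)) y he] at h2
  have h5 : f.val (Sum.inl (Q.base.graph.ends e true)) -
      f.val (Sum.inl (Q.base.graph.ends e false)) = 0 := by
    refine Eq.trans h2 ?_
    simp [polSlope, h3]
  simp only [Pi.smul_apply, smul_eq_mul]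
  linarith

theorem rho_eq_iff (r : RTrop g n) (t : TTrop g n) : rho r = t ↔ SameTheta r t := by
  constructor
  · rintro rfl
    obtain ⟨⟨Q₀, x₀, hx₀⟩, rfl⟩ := Quot.exists_rep r
    obtain ⟨Q, f, x, hx, rfl⟩ := Q₀.exists_lamInt hx₀
    have hr : rPoint Q₀ (f.hat.incl x) hx₀ = rPoint Q x (lamInt_subset_lam hx) :=
      rPoint_incl f (lamInt_subset_lam hx) hx₀ rfl
    change SameTheta (rPoint Q₀ (f.hat.incl x) hx₀) (rho (rPoint Q₀ (f.hat.incl x) hx₀))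
    rw [hr]
    have hQ := Q.isRoot.isUnitRootFlow
    have hB := hQ.isPolystableRoot_pol
    -- Extension by zero has zero lengths and so does not give an actual divisor on the curve. A
    -- positive representative of the same class is used, and `p` supplies the vertex values of the
    -- rational function.
    obtain ⟨p, hp, hy⟩ := Q.polMap.exists_pos_representative hB hQ Q.polMap_isOverId hx.2
    have hc : Q.polMap.hat.incl x + halfDiff Q.root.pol.S p - Q.polMap.hat.incl x ∈
        Q.root.pol.cutSpace := by
      rw [add_sub_cancel_left]
      exact halfDiff_mem_cutSpace hp
    have hyl : Q.polMap.hat.incl x + halfDiff Q.root.pol.S p ∈ Q.root.pol.lam :=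
      ⟨hB.mem_Lam_of_sub (Q.polMap.incl_mem_Lam_iff.2 hx.1) hc, fun e => (hy e).le⟩
    refine ⟨Q, Q.root.pol, hB, ⟨Q.root.lengths x, lengths_pos hx.2⟩, x, _, lamInt_subset_lam hx,
      hyl, hx.2, hy, rfl, lengths_incl_add_halfDiff hB hQ Q.polMap_isOverId
        (fun e he b => Q.polMap_half he b) x p,
      linearlyEquivalent_incl_add_halfDiff hB hQ Q.polMap_isOverId
        (fun e he b => Q.polMap_half he b) hx.2 rfl hp hy, rfl, ?_⟩
    exact tPoint_congr (P := Q.pol) (mkQ_eq_iff.2 hc).symm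
  · rintro ⟨Q, B, hB, X, x, y, hx, hy, hx₀, hy₀, hxX, hyX, h, rfl, rfl⟩
    exact rho_eq_of_linearlyEquivalent hB hx hy hx₀ hy₀ hxX hyX h

end LegGraph

end

theorem mainTheorem9 (g n : ℕ) [NeZero n] :
    -- the map `ρ`, given by passing to linearly equivalent polystable roots, is a refinement; on
    -- every cone `λ` it is the inclusion into the cone `κ` of any polystable root-graph above
    (∃ ρ : RTrop g n → TTrop g n,
      (∀ r t, ρ r = t ↔ SameTheta r t) ∧
      ConeDiagram.IsRefinement (C := quasistableDiagram g n) (C' := polystableDiagram g n) ρ ∧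
      ∀ (P : PolystableRootGraph g n) (Q : QuasistableRootGraph g n)
        (f : RootSpecialization P.root Q.root) (x : Q.root.graph.E → ℝ) (hx : x ∈ Q.root.lam),
        ∃ h : f.inclKap x ∈ P.root.kap,
          ρ ((quasistableDiagram g n).toSpace Q ⟨x, hx⟩) =
            (polystableDiagram g n).toSpace P ⟨f.inclKap x, h⟩) ∧
    ∀ P : PolystableRootGraph g n,
      -- the decomposition of `κ°`, indexed by the quasistable pseudo-roots `B` on the same graph
      -- with `pol(B) = P`
      ((∀ B : P.base.graph.PseudoDivisor, B.IsQuasistableRoot (P.base.graph.leg 0) →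
          P.root.IsPol B → ∃ f : RootSpecialization P.root B, f.IsOverId) ∧
        ∀ F : (∀ i : {B : P.base.graph.PseudoDivisor //
            B.IsQuasistableRoot (P.base.graph.leg 0) ∧ P.root.IsPol B},
            {f : RootSpecialization P.root i.1 // f.IsOverId}),
          (∀ i, Set.InjOn (F i).1.inclKap i.1.lamInt) ∧
          (∀ i j, i ≠ j →
            Disjoint ((F i).1.inclKap '' i.1.lamInt) ((F j).1.inclKap '' j.1.lamInt)) ∧
          P.root.kapInt = ⋃ i, (F i).1.inclKap '' i.1.lamInt) ∧
      -- the decomposition of `κ`, indexed by the isomorphism classes of specializations of `P` to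
      -- quasistable root-graphs
      ((∀ (Q : QuasistableRootGraph g n) (f : RootSpecialization P.root Q.root),
          Set.InjOn f.inclKap Q.root.lamInt) ∧
        (∀ (Q Q' : QuasistableRootGraph g n) (f : RootSpecialization P.root Q.root)
          (f' : RootSpecialization P.root Q'.root),
          (SameSpecialization f f' →
            f.inclKap '' Q.root.lamInt = f'.inclKap '' Q'.root.lamInt) ∧
          (¬ SameSpecialization f f' →
            Disjoint (f.inclKap '' Q.root.lamInt) (f'.inclKap '' Q'.root.lamInt))) ∧
        P.root.kap = ⋃ (Q : QuasistableRootGraph g n) (f : RootSpecialization P.root Q.root),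
          f.inclKap '' Q.root.lamInt) := by
  refine ⟨⟨rho, rho_eq_iff, isRefinement_rho, fun P Q f x hx =>
    ⟨f.inclKap_mem_kap hx, rho_rPoint_eq f hx⟩⟩, fun P =>
    ⟨P.isRoot.kapInt_decomposition P.base.connected, P.kap_decomposition⟩⟩
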